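/- **Setting.** Let $(X,Y)\in\mathbb R^d\times\mathbb R$ be a couple of random variables with $\mathbb E\|X\|^2<\infty$ and $\mathbb E(Y^2)<\infty$. Put $R(\theta)=\mathbb E[(Y-\langle\theta,X\rangle)^2]$, let $\theta_*\in\arg\min_{\theta\in\mathbb R^d}R(\theta)$, $G=\mathbb E(XX^\top)$, and let $G^{-1/2}$ be the pseudo-inverse square root of $G$: if $G=U\,\mathrm{diag}(\lambda_i)U^\top$ with $U$ orthogonal, then $G^{-1/2}=U\,\mathrm{diag}(\mathbf 1(\lambda_i>0)\lambda_i^{-1/2})U^\top$. Let $p,q\in[1,2]$ and assume that $$\kappa=\sup\{\mathbb E(\langle\theta,X\rangle^4):\theta\in\mathbb R^d,\ \mathbb E(\langle\theta,X\rangle^2)\le1\}<\infty,\qquad 0<C=\mathbb E[(Y-\langle\theta_*,X\rangle)^2\|G^{-1/2}X\|^2]<\infty,$$ $$\kappa'=C^{-2}\,\mathbb E[(Y-\langle\theta_*,X\rangle)^4\|G^{-1/2}X\|^4]<\infty,\qquad \mathbb E(\|G^{-1/2}X\|^{2q(p+1)})<\infty .$$ For a sample $(X_1,Y_1),\dots,(X_n,Y_n)$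 of $n$ independent copies of $(X,Y)$, let $\hat\theta\in\arg\min_{\theta}\sum_{i=1}^n(Y_i-\langle\theta,X_i\rangle)^2$ be any (measurable) empirical risk minimizer, and put $\mathcal E=R(\hat\theta)-R(\theta_*)$ and $m_r=\mathbb E(\|G^{-1/2}X\|^{r})$. For $\kappa>1$ and $\epsilon\in(0,1)$ put $L=\log(\epsilon^{-1})+0.73\,d$ and $$\mu=\sqrt{\tfrac{2(\kappa-1)}{n}L}+6.81\sqrt{\tfrac{2\kappa d}{n}},\qquad \hat\delta=\frac{\mu}{1-2\mu},\qquad \gamma_-=\frac{2L}{3(\kappa-1)n},$$ $$C_q=\frac{q^{q-1}}{2(q-1)^{q-1}(1-q/2)^{(2-q)/q}}\quad(C_1=C_2=1),$$ $$\tilde\gamma_+=\frac1{p+1}\Bigl(\frac{2L}{(\kappa-1)n}\Bigr)^{p/2}(1+\hat\delta)^{p+1}\Bigl[m_{2(p+1)}+\frac{C_q\,m_{2q(p+1)}^{1/q}}{\epsilon^{1/q}n^{1-1/q}}\Bigr],$$ and consider the condition $$n>\Bigl[20\sqrt{\kappa d}+\Bigl(\tfrac52+\tfrac1{2(\kappa-1)}\Bigr)\sqrt{2(\kappa-1)L}\Bigr]^2.\tag{1}$$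 **Proposition 4.12.** Below, $K$ denotes a universal constant; it depends on nothing at all. In parts 1 and 3–5, the constants and thresholds that are not universal do not depend on the choice of $\hat\theta$. 1. Let $\kappa>1$ and $\epsilon\in(0,1/2)$. If (1) holds and $\gamma_-<1$, there is an event $\Omega$ with $\mathbb P(\Omega)\ge1-2\epsilon$, on which $\mathcal E$ is integrable, such that $$(1-\tilde\gamma_+)_+^2(1-\hat\delta)_+^2\Bigl[1-\sqrt6\Bigl(1+\tfrac{\kappa'-3}{3n}\Bigr)^{1/2}\epsilon^{1/2}\Bigr]\frac Cn\le\mathbb E(\mathcal E\,\mathbf 1_\Omega)\le\mathbb E(\mathcal E\mid\Omega)\le\frac{(1+\hat\delta)^2}{(1-\gamma_-)^2(1-2\epsilon)}\,\frac Cn .$$ Moreover, if $p>1$ and $n$ is larger than some integer that depends only on $\epsilon$, $p$, $q$, $\theta_*$ and the law of $(X,Y)$, this event also satisfies $$\Bigl|\tfrac nC\mathbb E(\mathcal E\mid\Omega)-1\Bigr|\vee\Bigl|\tfrac nC\mathbb E(\mathcal E\,\mathbf 1_\Omega)-1\Bigr|\le K\Bigl(\sqrt{\kappa[d+\log(\epsilon^{-1})]/n}+\epsilon^{1/2}\Bigr).$$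 2. Let $\kappa>1$, $\epsilon\in(0,1)$ and $M>0$. If (1) holds, then $$\tfrac nC\,\mathbb E[\min\{\mathcal E,M\}]\ge(1-\hat\delta)_+^2(1-\tilde\gamma_+)_+^2\Bigl[1-\tfrac{3C}{4Mn}\Bigl(1+\tfrac{\kappa'-3}{3n}\Bigr)-\sqrt6\Bigl(1+\tfrac{\kappa'-3}{3n}\Bigr)^{1/2}\epsilon^{1/2}\Bigr].$$ 3. If $q>1$, then for any $M>0$ and any $n\ge K\kappa[d+\log\kappa]$, $$\tfrac nC\,\mathbb E[\min\{\mathcal E,M\}]\ge1-K\Bigl(\sqrt{\tfrac{\kappa[d+\log n]}{n}}+\Bigl(\tfrac{\log n+d}{\kappa n}\Bigr)^{p/2}m_{2q(p+1)}^{1/q}+\tfrac{(1+\kappa'/n)C}{Mn}+(1+\kappa'/n)^{1/2}n^{-(q-1)/2}\Bigr).$$ 4. If $q\in(1,2)$, then for any fixed $M>0$, as $n\to\infty$, $$\Bigl|\tfrac nC\,\mathbb E[\min\{\mathcal E,M\}]-1\Bigr|=O(n^{-(q-1)/2}).$$ 5. If $q\in(1,2)$, then, as $n\to\infty$, $$\Bigl|\tfrac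 nC\,\mathbb E\bigl[\min\{\mathcal E,\,C\exp(n^{2-q})\}\bigr]-1\Bigr|=O(n^{-(q-1)/2}),$$ $$\mathbb P[\mathcal E\ge C\exp(n^{2-q})]\le\frac{\mathbb E[\min\{\mathcal E,C\exp(n^{2-q})\}]}{C\exp(n^{2-q})}=O\Bigl(\frac1{n\exp(n^{2-q})}\Bigr).$$ 6. (Orders of magnitude.) For any $\kappa_0>1$ there is a constant $a>0$, depending only on $\kappa_0$, such that, when $\kappa\ge\kappa_0$: for any $\epsilon\in(0,1)$ and any $n\ge a\,\kappa[d+\log(\epsilon^{-1})]$, condition (1) and $\gamma_-<1$ are satisfied, $$\hat\delta\le a\sqrt{\tfrac{\kappa[d+\log(\epsilon^{-1})]}{n}},\qquad \tilde\gamma_+\le a\Bigl(\tfrac{\log(\epsilon^{-1})+d}{\kappa n}\Bigr)^{p/2}\Bigl[m_{2(p+1)}+\tfrac{m_{2q(p+1)}^{1/q}}{\epsilon^{1/q}n^{1-1/q}}\Bigr];$$ and if $q>1$ and $\epsilon=n^{-(q-1)}$, then for any $n\ge a\,\kappa[d+\log\kappa]$ condition (1) is satisfied and $\tilde\gamma_+\le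 a\bigl(\tfrac{\log n+d}{\kappa n}\bigr)^{p/2}m_{2q(p+1)}^{1/q}$. -/

import Mathlib

open MeasureTheory

universe u

noncomputable section

namespace LeastSquares

/-! ### The law of the couple `(X, Y)`

`ν` is the law of the couple `(X, Y)` on `ℝ^d × ℝ`; `z.1` stands for `X` and `z.2` for `Y`. -/

/-- The quadratic risk `R(θ) = E[(Y - ⟨θ, X⟩)²]`. -/
def risk {d : ℕ} (ν : Measure (EuclideanSpace ℝ (Fin d) × ℝ))
    (θ : EuclideanSpace ℝ (Fin d)) : ℝ :=
  ∫ z, (z.2 - inner ℝ θ z.1) ^ 2 ∂ν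

/-- The Gram matrix `G = E(X Xᵀ)`. -/
def gram {d : ℕ} (ν : Measure (EuclideanSpace ℝ (Fin d) × ℝ)) : Matrix (Fin d) (Fin d) ℝ :=
  Matrix.of fun i j => ∫ z, z.1 i * z.1 j ∂ν

lemma gram_isHermitian {d : ℕ} (ν : Measure (EuclideanSpace ℝ (Fin d) × ℝ)) :
    (gram ν).IsHermitian := by
  ext i j
  simp [gram, mul_comm]

/-- The pseudo-inverse square root `G^{-1/2} = U diag(1(λᵢ > 0) λᵢ^{-1/2}) Uᵀ`, where
`G = U diag(λᵢ) Uᵀ` is a diagonalization of `G` in an orthonormal basis. -/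
def gramInvSqrt {d : ℕ} (ν : Measure (EuclideanSpace ℝ (Fin d) × ℝ)) :
    Matrix (Fin d) (Fin d) ℝ :=
  ((gram_isHermitian ν).eigenvectorUnitary : Matrix (Fin d) (Fin d) ℝ) *
    Matrix.diagonal (fun i =>
      if 0 < (gram_isHermitian ν).eigenvalues i
      then (Real.sqrt ((gram_isHermitian ν).eigenvalues i))⁻¹ else 0) *
    star ((gram_isHermitian ν).eigenvectorUnitary : Matrix (Fin d) (Fin d) ℝ)

/-- The Euclidean norm `‖G^{-1/2} x‖`. -/
def whitenedNorm {d : ℕ} (ν : Measure (EuclideanSpace ℝ (Fin d) × ℝ))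
    (x : EuclideanSpace ℝ (Fin d)) : ℝ :=
  ‖Matrix.toEuclideanLin (gramInvSqrt ν) x‖

/-- `sup { E(⟨θ, X⟩⁴) : θ ∈ ℝ^d, E(⟨θ, X⟩²) ≤ 1 }`, as an extended non-negative real number. -/
def kurtosis {d : ℕ} (ν : Measure (EuclideanSpace ℝ (Fin d) × ℝ)) : ENNReal :=
  ⨆ (θ : EuclideanSpace ℝ (Fin d))
    (_ : ∫⁻ z, ENNReal.ofReal ((inner ℝ θ z.1) ^ 2) ∂ν ≤ 1),
      ∫⁻ z, ENNReal.ofReal ((inner ℝ θ z.1) ^ 4) ∂ν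

/-- The real number `κ` (used only when the supremum is finite). -/
def kappa {d : ℕ} (ν : Measure (EuclideanSpace ℝ (Fin d) × ℝ)) : ℝ := (kurtosis ν).toReal

/-- `C = E[(Y - ⟨θ⋆, X⟩)² ‖G^{-1/2} X‖²]`. -/
def rateConst {d : ℕ} (ν : Measure (EuclideanSpace ℝ (Fin d) × ℝ))
    (θs : EuclideanSpace ℝ (Fin d)) : ℝ :=
  ∫ z, (z.2 - inner ℝ θs z.1) ^ 2 * whitenedNorm ν z.1 ^ 2 ∂ν

/-- `κ' = E[(Y - ⟨θ⋆, X⟩)⁴ ‖G^{-1/2} X‖⁴] / E[(Y - ⟨θ⋆, X⟩)² ‖G^{-1/2} X‖²]²`. -/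
def kappa' {d : ℕ} (ν : Measure (EuclideanSpace ℝ (Fin d) × ℝ))
    (θs : EuclideanSpace ℝ (Fin d)) : ℝ :=
  (∫ z, (z.2 - inner ℝ θs z.1) ^ 4 * whitenedNorm ν z.1 ^ 4 ∂ν) / rateConst ν θs ^ 2

/-- The moment `E(‖G^{-1/2} X‖^r)`. -/
def whitenedMoment {d : ℕ} (ν : Measure (EuclideanSpace ℝ (Fin d) × ℝ)) (r : ℝ) : ℝ :=
  ∫ z, whitenedNorm ν z.1 ^ r ∂ν

/-- The assumptions on the law of `(X, Y)`, on the optimal parameter `θ⋆` and on the exponents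
`p` and `q`. The fields `memLp_fst` and `memLp_snd` say that `G` and the risk `R` are finite. -/
structure Assumptions {d : ℕ} (ν : Measure (EuclideanSpace ℝ (Fin d) × ℝ))
    (θs : EuclideanSpace ℝ (Fin d)) (p q : ℝ) : Prop where
  one_le_p : 1 ≤ p
  p_le_two : p ≤ 2
  one_le_q : 1 ≤ q
  q_le_two : q ≤ 2
  memLp_fst : MemLp (fun z : EuclideanSpace ℝ (Fin d) × ℝ => z.1) 2 ν
  memLp_snd : MemLp (fun z : EuclideanSpace ℝ (Fin d) × ℝ => z.2) 2 ν
  isArgmin : ∀ θ, risk ν θs ≤ risk ν θ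
  kurtosis_lt_top : kurtosis ν < ⊤
  integrable_rateConst :
    Integrable (fun z => (z.2 - inner ℝ θs z.1) ^ 2 * whitenedNorm ν z.1 ^ 2) ν
  rateConst_pos : 0 < rateConst ν θs
  integrable_kappa' :
    Integrable (fun z => (z.2 - inner ℝ θs z.1) ^ 4 * whitenedNorm ν z.1 ^ 4) ν
  integrable_moment : Integrable (fun z => whitenedNorm ν z.1 ^ (2 * q * (p + 1))) ν

/-! ### The sample and the empirical risk minimizer -/

/-- `Z i = (X_i, Y_i)`, `i < n`, is a sample of `n` independent copies of a couple with law `ν`,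
and `θhat` is a random vector that almost surely minimizes the empirical risk. -/
structure IsERM {d n : ℕ} (ν : Measure (EuclideanSpace ℝ (Fin d) × ℝ))
    {S : Type*} [MeasurableSpace S] (P : Measure S)
    (Z : Fin n → S → EuclideanSpace ℝ (Fin d) × ℝ)
    (θhat : S → EuclideanSpace ℝ (Fin d)) : Prop where
  indep : ProbabilityTheory.iIndepFun Z P
  law : ∀ i, ProbabilityTheory.HasLaw (Z i) ν P
  aemeasurable : AEMeasurable θhat P
  isArgmin : ∀ᵐ ω ∂P, ∀ θ : EuclideanSpace ℝ (Fin d),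
    ∑ i, ((Z i ω).2 - inner ℝ (θhat ω) (Z i ω).1) ^ 2 ≤
      ∑ i, ((Z i ω).2 - inner ℝ θ (Z i ω).1) ^ 2

/-- The excess risk `R(θ) - R(θ⋆)`. -/
def excess {d : ℕ} (ν : Measure (EuclideanSpace ℝ (Fin d) × ℝ))
    (θs θ : EuclideanSpace ℝ (Fin d)) : ℝ :=
  risk ν θ - risk ν θs

/-! ### The non-asymptotic quantities -/

/-- `log(ε⁻¹) + 0.73 d`. -/
def confTerm (d : ℕ) (ε : ℝ) : ℝ := Real.log ε⁻¹ + 0.73 * d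

/-- `μ = √((2(κ-1)/n) [log(ε⁻¹) + 0.73 d]) + 6.81 √(2κd/n)`. -/
def mu (κ : ℝ) (d : ℕ) (ε : ℝ) (n : ℕ) : ℝ :=
  Real.sqrt (2 * (κ - 1) / n * confTerm d ε) + 6.81 * Real.sqrt (2 * κ * d / n)

/-- The condition `n > [20 √(κd) + (5/2 + 1/(2(κ-1))) √(2(κ-1)[log(ε⁻¹) + 0.73 d])]²`
on the sample size; meaningful for `κ > 1`. -/
def SampleSizeCond (κ : ℝ) (d : ℕ) (ε : ℝ) (n : ℕ) : Prop :=
  (20 * Real.sqrt (κ * d) +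
    (5 / 2 + 1 / (2 * (κ - 1))) * Real.sqrt (2 * (κ - 1) * confTerm d ε)) ^ 2 < (n : ℝ)

/-- `δ̂ = μ / (1 - 2μ)`. -/
def deltaHat (κ : ℝ) (d : ℕ) (ε : ℝ) (n : ℕ) : ℝ :=
  mu κ d ε n / (1 - 2 * mu κ d ε n)

/-- `γ₋ = 2[log(ε⁻¹) + 0.73 d] / (3(κ-1)n)`. -/
def gammaMinus (κ : ℝ) (d : ℕ) (ε : ℝ) (n : ℕ) : ℝ :=
  2 * confTerm d ε / (3 * (κ - 1) * n)

/-- `C_q = q^{q-1} / (2 (q-1)^{q-1} (1-q/2)^{(2-q)/q})`. Since `0 ^ 0 = 1`, the formula gives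
`C_1 = C_2 = 1`, which are its limits at the end points. -/
def cq (q : ℝ) : ℝ :=
  q ^ (q - 1) / (2 * (q - 1) ^ (q - 1) * (1 - q / 2) ^ ((2 - q) / q))

/-- The deterministic bound `γ̃₊`. -/
def gammaPlus {d : ℕ} (ν : Measure (EuclideanSpace ℝ (Fin d) × ℝ)) (p q ε : ℝ) (n : ℕ) : ℝ :=
  1 / (p + 1) * (2 * confTerm d ε / ((kappa ν - 1) * n)) ^ (p / 2) *
    (1 + deltaHat (kappa ν) d ε n) ^ (p + 1) *
    (whitenedMoment ν (2 * (p + 1)) +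
      cq q * whitenedMoment ν (2 * q * (p + 1)) ^ (1 / q) /
        (ε ^ (1 / q) * (n : ℝ) ^ (1 - 1 / q)))

/-- `(1 - γ̃₊)₊² (1 - δ̂)₊²`. -/
def lowerFactor {d : ℕ} (ν : Measure (EuclideanSpace ℝ (Fin d) × ℝ)) (p q ε : ℝ) (n : ℕ) : ℝ :=
  max (1 - gammaPlus ν p q ε n) 0 ^ 2 * max (1 - deltaHat (kappa ν) d ε n) 0 ^ 2

end LeastSquares

end

/-!
Let `W = G^{-1/2} X` be the whitened vector. The excess risk of `θ` is `‖G^{1/2} (θ - θ⋆)‖²`, and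
the score `V = (Y - ⟨θ⋆, X⟩) W` has mean `0` and satisfies `E ‖V‖² = C`, `E ‖V‖⁴ = κ' C²`. For the
vector `w = G^{1/2} (θ̂ - θ⋆)`, the normal equations of the empirical problem say that the empirical
quadratic form `N(w) = n⁻¹ ∑ ⟨w, Wᵢ⟩²` is the inner product of `w` with the mean score
`S = n⁻¹ ∑ Vᵢ`. If `a ≤ N ≤ b` on the unit vectors, then `‖S‖ / b ≤ ‖w‖ ≤ ‖S‖ / a`
(`norm_le_of_form_ge`, `norm_ge_of_form_le`). The excess risk is thus compared with `‖S‖²`, whose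
mean is `C / n` exactly and whose fourth moment is explicit (`moments_sum`).

The uniform bounds for `N` come from the PAC-Bayesian inequality with Gaussian prior and posteriors
(`pacBayes_centeredSq`), under a bound for the kurtosis only. For the lower bound
(`empirical_lower`) it suffices to truncate the norm of `W`, because the quadratic form is
nonnegative. For the upper bound (`empirical_upper`) the logarithmic influence function
`log (1 + x + x² / 2)` is used, and the price is an empirical mean of a moment of `‖W‖`, which
`mean_deviation` controls by the two moments in `γ̃₊`.

The two-sided bound on an event of probability at least `1 - 3ε/2` gives the expectations on this
event: the upper bound at once, the lower bound by the Cauchy–Schwarz inequality on the complement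
(`exists_event_integral_bounds`). For the truncated excess risk, the inequality
`x - x² / (4 M) ≤ min x M` gives the lower bound (`integral_min_excess_ge`), and the upper bound
adds `M` times the probability of the exceptional event (`integral_min_excess_le`).

All these bounds hold with `κ` replaced by any `k ≥ κ` with `k > 1`. With `k = 2κ` they cover the
case `κ = 1`. The rates follow with `ε = n^{-(q-1)}` for the lower bounds
(`truncated_lower_bound_rate`) and with `ε = n⁻² exp(-n^{2-q})` for the upper bounds
(`exists_truncated_rate`).
-/

namespace LeastSquares

open ProbabilityTheory Filter
open scoped NNReal ENNReal Topology

/-! ### Elementary inequalities for the exponential and the logarithm -/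

lemma log_quad_pos (x : ℝ) : 0 < 1 + x + x ^ 2 / 2 := by nlinarith [sq_nonneg (x + 1)]

lemma hasDerivAt_sub_log_quad (x : ℝ) :
    HasDerivAt (fun x : ℝ => x - Real.log (1 + x + x ^ 2 / 2))
      ((x ^ 2 / 2) / (1 + x + x ^ 2 / 2)) x := by
  have h1 : HasDerivAt (fun x : ℝ => 1 + x + x ^ 2 / 2) (1 + x) x := by
    have := (((hasDerivAt_id' x).const_add 1).add (((hasDerivAt_id' x).pow 2).div_const 2))
    exact this.congr_deriv (by push_cast; ring)
  refine ((hasDerivAt_id' x).sub (h1.log (log_quad_pos x).ne')).congr_deriv ?_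
  have := (log_quad_pos x).ne'
  rw [eq_div_iff this, sub_mul, div_mul_cancel₀ _ this]
  ring

lemma sub_log_quad_nonpos {x : ℝ} (hx : x ≤ 0) : x - Real.log (1 + x + x ^ 2 / 2) ≤ 0 := by
  have hm : Monotone (fun x : ℝ => x - Real.log (1 + x + x ^ 2 / 2)) := by
    refine monotone_of_deriv_nonneg (fun x => (hasDerivAt_sub_log_quad x).differentiableAt) ?_
    intro x
    rw [(hasDerivAt_sub_log_quad x).deriv]
    have := log_quad_pos x
    positivity
  simpa using hm hx

/-- A function which vanishes at `0` and has a nonnegative derivative is nonnegative. -/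
lemma nonneg_of_hasDerivAt_nonneg {f f' : ℝ → ℝ} (hf : ∀ x, HasDerivAt f (f' x) x)
    (h0 : f 0 = 0) (hf' : ∀ x, 0 ≤ x → 0 ≤ f' x) {x : ℝ} (hx : 0 ≤ x) : 0 ≤ f x := by
  have hm : MonotoneOn f (Set.Ici 0) := by
    refine monotoneOn_of_deriv_nonneg (convex_Ici 0)
      (fun x _ => (hf x).continuousAt.continuousWithinAt)
      (fun x _ => (hf x).differentiableAt.differentiableWithinAt) ?_
    intro x hx
    rw [interior_Ici] at hx
    rw [(hf x).deriv]
    exact hf' x (le_of_lt hx)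
  have := hm (Set.self_mem_Ici) hx hx
  rwa [h0] at this

lemma sub_log_quad_le_sq {x : ℝ} (hx : 0 ≤ x) :
    x - Real.log (1 + x + x ^ 2 / 2) ≤ x ^ 2 / 6 := by
  have := nonneg_of_hasDerivAt_nonneg
    (f := fun x : ℝ => x ^ 2 / 6 - (x - Real.log (1 + x + x ^ 2 / 2)))
    (f' := fun x => 2 * x / 6 - (x ^ 2 / 2) / (1 + x + x ^ 2 / 2))
    (fun x => by
      have := (((hasDerivAt_id' x).pow 2).div_const 6).sub (hasDerivAt_sub_log_quad x)
      exact this.congr_deriv (by push_cast; ring)) (by simp) (fun y hy => by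
        rw [sub_nonneg, div_le_iff₀ (log_quad_pos y)]
        nlinarith [mul_nonneg hy (sq_nonneg (y - 1 / 2))]) hx
  linarith

lemma sub_log_quad_le_cube {x : ℝ} (hx : 0 ≤ x) :
    x - Real.log (1 + x + x ^ 2 / 2) ≤ x ^ 3 / 6 := by
  have := nonneg_of_hasDerivAt_nonneg
    (f := fun x : ℝ => x ^ 3 / 6 - (x - Real.log (1 + x + x ^ 2 / 2)))
    (f' := fun x => 3 * x ^ 2 / 6 - (x ^ 2 / 2) / (1 + x + x ^ 2 / 2))
    (fun x => by
      have := (((hasDerivAt_id' x).pow 3).div_const 6).sub (hasDerivAt_sub_log_quad x)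
      exact this.congr_deriv (by push_cast; ring)) (by simp) (fun y hy => by
        rw [sub_nonneg, div_le_iff₀ (log_quad_pos y)]
        nlinarith [pow_nonneg hy 2, pow_nonneg hy 3, pow_nonneg hy 4]) hx
  linarith

lemma abs_log_quad_le (x : ℝ) : |Real.log (1 + x + x ^ 2 / 2)| ≤ 1 + |x| + x ^ 2 := by
  have hp := log_quad_pos x
  have h2 := Real.log_le_sub_one_of_pos hp
  have h3 : -(1 : ℝ) ≤ Real.log (1 + x + x ^ 2 / 2) := by
    have : Real.log (Real.exp (-1)) ≤ Real.log (1 + x + x ^ 2 / 2) := by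
      apply Real.log_le_log (Real.exp_pos _)
      have : Real.exp (-1) ≤ 1 / 2 := by
        rw [Real.exp_neg, inv_eq_one_div]
        apply one_div_le_one_div_of_le (by norm_num)
        have := Real.add_one_le_exp (1 : ℝ)
        linarith
      nlinarith [sq_nonneg (x + 1)]
    rwa [Real.log_exp] at this
  rw [abs_le]
  constructor
  · nlinarith [abs_nonneg x, sq_nonneg x]
  · nlinarith [le_abs_self x, sq_nonneg x]

lemma exp_le_quad_of_nonpos {y : ℝ} (hy : y ≤ 0) : Real.exp y ≤ 1 + y + y ^ 2 / 2 := by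
  have := sub_log_quad_nonpos hy
  calc Real.exp y ≤ Real.exp (Real.log (1 + y + y ^ 2 / 2)) := Real.exp_le_exp.2 (by linarith)
    _ = _ := Real.exp_log (log_quad_pos y)

lemma exp_le_quad_add_cube {y : ℝ} (hy : y ≤ 2) :
    Real.exp y ≤ 1 + y + y ^ 2 / 2 + 0.3 * max y 0 ^ 3 := by
  rcases le_total y 0 with h | h
  · rw [max_eq_right h]
    have := exp_le_quad_of_nonpos h
    linarith
  · rw [max_eq_left h]
    -- the ratio `(exp y - 1 - y - y²/2) / y³` increases with `y` and is below `0.3` at `y = 2`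
    have hs : HasSum (fun k : ℕ => y ^ k / (k.factorial : ℝ)) (Real.exp y) := by
      have := NormedSpace.expSeries_div_hasSum_exp (𝔸 := ℝ) y
      rwa [← Real.exp_eq_exp_ℝ] at this
    have hs2 : HasSum (fun k : ℕ => (2 : ℝ) ^ k / (k.factorial : ℝ)) (Real.exp 2) := by
      have := NormedSpace.expSeries_div_hasSum_exp (𝔸 := ℝ) (2 : ℝ)
      rwa [← Real.exp_eq_exp_ℝ] at this
    have h1 := (hasSum_nat_add_iff' 3).2 hs
    have h2 := ((hasSum_nat_add_iff' 3).2 hs2).mul_left ((y / 2) ^ 3)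
    have hle := hasSum_le (fun k => by
      show y ^ (k + 3) / ((k + 3).factorial : ℝ) ≤
        (y / 2) ^ 3 * (2 ^ (k + 3) / ((k + 3).factorial : ℝ))
      rw [mul_div_assoc', div_le_div_iff_of_pos_right (by positivity)]
      have : y ^ k ≤ 2 ^ k := pow_le_pow_left₀ h hy k
      have h3 : (y / 2) ^ 3 * 2 ^ (k + 3) = y ^ 3 * 2 ^ k := by ring
      rw [h3, pow_add, mul_comm]
      exact mul_le_mul_of_nonneg_left this (by positivity)) h1 h2
    have he : Real.exp 2 ≤ 7.39 := by
      have := Real.exp_one_lt_d9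
      have h0 := Real.exp_pos 1
      rw [show (2 : ℝ) = 1 + 1 by norm_num, Real.exp_add]
      nlinarith
    simp [Finset.sum_range_succ, Nat.factorial] at hle
    nlinarith [pow_nonneg h 3, hle]

/-! ### Gaussian shifts and moments -/

lemma iteratedDeriv_exp_sq (v : ℝ) :
    let e := fun t : ℝ => Real.exp (v * t ^ 2 / 2)
    iteratedDeriv 3 e 0 = 0 ∧ iteratedDeriv 4 e 0 = 3 * v ^ 2 ∧ iteratedDeriv 5 e 0 = 0 ∧
      iteratedDeriv 6 e 0 = 15 * v ^ 3 := by
  intro e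
  have he : ∀ t, HasDerivAt e (v * t * e t) t := by
    intro t
    have h := (((hasDerivAt_id' t).pow 2).const_mul v).div_const 2
    exact (h.exp).congr_deriv (by simp only [e, Pi.pow_apply]; push_cast; ring)
  have key : ∀ (f f' : ℝ → ℝ), (∀ t, HasDerivAt f (f' t) t) →
      deriv (fun t => f t * e t) = fun t => (f' t + v * t * f t) * e t := by
    intro f f' hf
    ext t
    exact ((hf t).mul (he t)).deriv.trans (by ring)
  have h1 : iteratedDeriv 1 e = fun t => (v * t) * e t := by
    rw [iteratedDeriv_one]; ext t; rw [(he t).deriv]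
  have hp : ∀ (k : ℕ) (t : ℝ), HasDerivAt (fun t : ℝ => t ^ k) (k * t ^ (k - 1)) t :=
    fun k t => hasDerivAt_pow k t
  have h2 : iteratedDeriv 2 e = fun t => (v + v ^ 2 * t ^ 2) * e t := by
    rw [iteratedDeriv_succ, h1, key (fun t => v * t) (fun _ => v)
      (fun t => ((hasDerivAt_id' t).const_mul v).congr_deriv (by ring))]
    ext t; ring
  have h3 : iteratedDeriv 3 e = fun t => (3 * v ^ 2 * t + v ^ 3 * t ^ 3) * e t := by
    rw [iteratedDeriv_succ, h2, key (fun t => v + v ^ 2 * t ^ 2) (fun t => v ^ 2 * (2 * t))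
      (fun t => (((hp 2 t).const_mul _).const_add _).congr_deriv (by simp))]
    ext t; ring
  have h4 : iteratedDeriv 4 e = fun t => (3 * v ^ 2 + 6 * v ^ 3 * t ^ 2 + v ^ 4 * t ^ 4) * e t := by
    rw [iteratedDeriv_succ, h3, key (fun t => 3 * v ^ 2 * t + v ^ 3 * t ^ 3)
      (fun t => 3 * v ^ 2 + v ^ 3 * (3 * t ^ 2))
      (fun t => (((hasDerivAt_id' t).const_mul _).add ((hp 3 t).const_mul _)).congr_deriv
        (by simp))]
    ext t; ring
  have h5 : iteratedDeriv 5 e = fun t =>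
      (15 * v ^ 3 * t + 10 * v ^ 4 * t ^ 3 + v ^ 5 * t ^ 5) * e t := by
    rw [iteratedDeriv_succ, h4, key (fun t => 3 * v ^ 2 + 6 * v ^ 3 * t ^ 2 + v ^ 4 * t ^ 4)
      (fun t => 6 * v ^ 3 * (2 * t) + v ^ 4 * (4 * t ^ 3))
      (fun t => ((((hp 2 t).const_mul _).const_add _).add ((hp 4 t).const_mul _)).congr_deriv
        (by simp))]
    ext t; ring
  have h6 : iteratedDeriv 6 e = fun t =>
      (15 * v ^ 3 + 45 * v ^ 4 * t ^ 2 + 15 * v ^ 5 * t ^ 4 + v ^ 6 * t ^ 6) * e t := by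
    rw [iteratedDeriv_succ, h5, key (fun t => 15 * v ^ 3 * t + 10 * v ^ 4 * t ^ 3 + v ^ 5 * t ^ 5)
      (fun t => 15 * v ^ 3 + 10 * v ^ 4 * (3 * t ^ 2) + v ^ 5 * (5 * t ^ 4))
      (fun t => ((((hasDerivAt_id' t).const_mul _).add ((hp 3 t).const_mul _)).add
        ((hp 5 t).const_mul _)).congr_deriv (by simp))]
    ext t; ring
  rw [h3, h4, h5, h6]
  simp [e]

/-- The first six moments of a centered Gaussian law. -/
lemma gaussianReal_moments (v : ℝ≥0) :
    (∫ x, x ∂gaussianReal 0 v = 0) ∧ (∫ x, x ^ 2 ∂gaussianReal 0 v = v) ∧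
    (∫ x, x ^ 3 ∂gaussianReal 0 v = 0) ∧ (∫ x, x ^ 4 ∂gaussianReal 0 v = 3 * v ^ 2) ∧
    (∫ x, x ^ 5 ∂gaussianReal 0 v = 0) ∧ (∫ x, x ^ 6 ∂gaussianReal 0 v = 15 * v ^ 3) := by
  have hm : mgf (fun x => x) (gaussianReal 0 v) = fun t => Real.exp (v * t ^ 2 / 2) := by
    rw [mgf_fun_id_gaussianReal]; simp
  have hk : ∀ n : ℕ, ∫ x, x ^ n ∂gaussianReal 0 v =
      iteratedDeriv n (fun t => Real.exp ((v : ℝ) * t ^ 2 / 2)) 0 := by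
    intro n
    rw [← hm, iteratedDeriv_mgf_zero]
    · rfl
    · rw [integrableExpSet_fun_id_gaussianReal]; simp
  obtain ⟨h3, h4, h5, h6⟩ := iteratedDeriv_exp_sq (v : ℝ)
  refine ⟨by rw [integral_id_gaussianReal], ?_, ?_, ?_, ?_, ?_⟩
  · have := variance_fun_id_gaussianReal (μ := 0) (v := v)
    rw [variance_eq_integral (by fun_prop)] at this
    simpa [integral_id_gaussianReal] using this
  all_goals rw [hk]; assumption

section

variable {d : ℕ}

local notation "𝔼" => EuclideanSpace ℝ (Fin d)

lemma stdGaussian_map_inner (w : 𝔼) :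
    (stdGaussian 𝔼).map (fun g => inner ℝ g w) = gaussianReal 0 (‖w‖₊ ^ 2) := by
  have h := IsGaussian.map_eq_gaussianReal (μ := stdGaussian 𝔼) (innerSL ℝ w)
  rw [variance_dual_stdGaussian, integral_strongDual_stdGaussian, innerSL_apply_norm] at h
  have h2 : (fun g : 𝔼 => inner ℝ g w) = (innerSL ℝ w) := by
    ext g; simp [real_inner_comm]
  rw [h2, h]
  congr 1
  ext; simp

lemma integrable_add_pow_gaussianReal (v : ℝ≥0) (a : ℝ) (k : ℕ) :
    Integrable (fun x => (a + x) ^ k) (gaussianReal 0 v) := by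
  have h : MemLp (fun x : ℝ => a + x) k (gaussianReal 0 v) :=
    (memLp_const a).add (memLp_id_gaussianReal k)
  have := h.integrable_norm_pow'
  refine this.mono' (by fun_prop) (ae_of_all _ fun x => ?_)
  simp

lemma integrable_pow_gaussianReal (v : ℝ≥0) (k : ℕ) :
    Integrable (fun x => x ^ k) (gaussianReal 0 v) := by
  simpa using integrable_add_pow_gaussianReal v 0 k

lemma integral_add_pow_gaussianReal (v : ℝ≥0) (a : ℝ) (k : ℕ) :
    ∫ x, (a + x) ^ k ∂gaussianReal 0 v =
      ∑ m ∈ Finset.range (k + 1), a ^ m * (∫ x, x ^ (k - m) ∂gaussianReal 0 v) * (k.choose m) := by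
  simp_rw [add_pow]
  rw [integral_finsetSum _ fun m _ =>
    ((integrable_pow_gaussianReal v (k - m)).const_mul _).mul_const _]
  refine Finset.sum_congr rfl fun m _ => ?_
  rw [integral_mul_const, integral_const_mul]

lemma integral_add_sq_gaussianReal (v : ℝ≥0) (a : ℝ) :
    ∫ x, (a + x) ^ 2 ∂gaussianReal 0 v = a ^ 2 + v := by
  obtain ⟨h1, h2, -⟩ := gaussianReal_moments v
  rw [integral_add_pow_gaussianReal]
  simp [Finset.sum_range_succ, h1, h2]
  ring

lemma integral_add_pow_four_gaussianReal (v : ℝ≥0) (a : ℝ) :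
    ∫ x, (a + x) ^ 4 ∂gaussianReal 0 v = a ^ 4 + 6 * a ^ 2 * v + 3 * v ^ 2 := by
  obtain ⟨h1, h2, h3, h4, -⟩ := gaussianReal_moments v
  rw [integral_add_pow_gaussianReal]
  simp [Finset.sum_range_succ, h1, h2, h3, h4, Nat.choose]
  ring

lemma integral_add_pow_six_gaussianReal (v : ℝ≥0) (a : ℝ) :
    ∫ x, (a + x) ^ 6 ∂gaussianReal 0 v =
      a ^ 6 + 15 * a ^ 4 * v + 45 * a ^ 2 * v ^ 2 + 15 * v ^ 3 := by
  obtain ⟨h1, h2, h3, h4, h5, h6⟩ := gaussianReal_moments v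
  rw [integral_add_pow_gaussianReal]
  simp [Finset.sum_range_succ, h1, h2, h3, h4, h5, h6, Nat.choose]
  ring

/-- The law of `⟨√β u + g, w⟩ / √β` for a standard Gaussian vector `g` is Gaussian, with mean
`⟨u, w⟩` and variance `‖w‖² / β`. -/
lemma map_inner_shift (β : ℝ) (hβ : 0 < β) (u w : 𝔼) :
    (stdGaussian 𝔼).map (fun g => inner ℝ (√β • u + g) w / √β) =
      (gaussianReal 0 (‖w‖₊ ^ 2 / β.toNNReal)).map (fun x => inner ℝ u w + x) := by
  have hs : √β ≠ 0 := (Real.sqrt_pos.2 hβ).ne'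
  have e : (fun g : 𝔼 => inner ℝ (√β • u + g) w / √β) =
      (fun x => inner ℝ u w + x) ∘ (fun g : 𝔼 => inner ℝ g ((√β)⁻¹ • w)) := by
    ext g
    simp only [Function.comp, inner_add_left, inner_smul_left, inner_smul_right]
    simp
    field_simp
  rw [e, ← Measure.map_map (by fun_prop) (by fun_prop), stdGaussian_map_inner]
  congr 2
  ext
  simp only [nnnorm_smul, NNReal.coe_pow, NNReal.coe_mul, coe_nnnorm, NNReal.coe_div,
    Real.coe_toNNReal _ hβ.le, norm_inv, Real.norm_eq_abs, abs_of_nonneg (Real.sqrt_nonneg β),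
    mul_pow, inv_pow, Real.sq_sqrt hβ.le]
  field_simp

lemma integral_shift_eq (β : ℝ) (hβ : 0 < β) (u w : 𝔼) (f : ℝ → ℝ) (hf : Measurable f) :
    ∫ g, f (inner ℝ (√β • u + g) w ^ 2 / β) ∂stdGaussian 𝔼 =
      ∫ x, f ((inner ℝ u w + x) ^ 2) ∂gaussianReal 0 (‖w‖₊ ^ 2 / β.toNNReal) := by
  have h := map_inner_shift β hβ u w
  have e : ∀ g : 𝔼, f (inner ℝ (√β • u + g) w ^ 2 / β) =
      (fun x => f (x ^ 2)) (inner ℝ (√β • u + g) w / √β) := fun g => by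
    simp only [div_pow, Real.sq_sqrt hβ.le]
  simp_rw [e]
  rw [← integral_map (φ := fun g : 𝔼 => inner ℝ (√β • u + g) w / √β)
    (f := fun x => f (x ^ 2)) (by fun_prop)
    (by exact (hf.comp (by fun_prop)).aestronglyMeasurable), h,
    integral_map (by fun_prop) (by exact (hf.comp (by fun_prop)).aestronglyMeasurable)]

lemma integrable_shift_iff (β : ℝ) (hβ : 0 < β) (u w : 𝔼) (f : ℝ → ℝ) (hf : Measurable f) :
    Integrable (fun g => f (inner ℝ (√β • u + g) w ^ 2 / β)) (stdGaussian 𝔼) ↔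
      Integrable (fun x => f ((inner ℝ u w + x) ^ 2))
        (gaussianReal 0 (‖w‖₊ ^ 2 / β.toNNReal)) := by
  have h := map_inner_shift β hβ u w
  have e : (fun g : 𝔼 => f (inner ℝ (√β • u + g) w ^ 2 / β)) =
      (fun x => f (x ^ 2)) ∘ (fun g => inner ℝ (√β • u + g) w / √β) := by
    ext g
    simp only [Function.comp, div_pow, Real.sq_sqrt hβ.le]
  rw [e, ← integrable_map_measure (by exact (hf.comp (by fun_prop)).aestronglyMeasurable)
    (by fun_prop), h, integrable_map_measure
    (by exact (hf.comp (by fun_prop)).aestronglyMeasurable) (by fun_prop)]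
  rfl

/-- The standard Gaussian law on `ℝ^d` has a density, which is the product of its one-dimensional
densities. -/
lemma pi_gaussianReal_eq_withDensity :
    Measure.pi (fun _ : Fin d => gaussianReal 0 1) =
      (volume : Measure (Fin d → ℝ)).withDensity
        (fun x => ENNReal.ofReal (∏ i, gaussianPDFReal 0 1 (x i))) := by
  refine Measure.pi_eq fun s hs => ?_
  rw [withDensity_apply _ (MeasurableSet.univ_pi hs), volume_pi, Measure.restrict_pi_pi,
    ← ofReal_integral_eq_lintegral_ofReal]
  · rw [integral_fintype_prod_eq_prod, ENNReal.ofReal_prod_of_nonneg]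
    · refine Finset.prod_congr rfl fun i _ => ?_
      rw [gaussianReal_apply_eq_integral _ one_ne_zero]
    · intro i _
      exact integral_nonneg fun x => gaussianPDFReal_nonneg _ _ _
  · exact Integrable.fintype_prod (f := fun _ => gaussianPDFReal 0 1)
      fun i => (integrable_gaussianPDFReal 0 1).restrict
  · exact ae_of_all _ fun x => Finset.prod_nonneg fun i _ => gaussianPDFReal_nonneg _ _ _

/-- The Cameron--Martin formula for the standard Gaussian law. -/
lemma lintegral_stdGaussian_shift (v : 𝔼) (F : 𝔼 → ℝ≥0∞) (hF : Measurable F) :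
    ∫⁻ g, F g ∂stdGaussian 𝔼 =
      ∫⁻ g, F (v + g) * ENNReal.ofReal (Real.exp (-inner ℝ v g - ‖v‖ ^ 2 / 2))
        ∂stdGaussian 𝔼 := by
  have hρ : Measurable fun x : Fin d → ℝ =>
      ENNReal.ofReal (∏ i, gaussianPDFReal 0 1 (x i)) := by fun_prop
  rw [← map_pi_eq_stdGaussian, lintegral_map hF (by fun_prop), lintegral_map (by fun_prop)
    (by fun_prop), pi_gaussianReal_eq_withDensity, lintegral_withDensity_eq_lintegral_mul _ hρ
    (by fun_prop), lintegral_withDensity_eq_lintegral_mul _ hρ (by fun_prop),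
    ← lintegral_add_left_eq_self _ (WithLp.ofLp v)]
  refine lintegral_congr fun x => ?_
  simp only [Pi.mul_apply]
  have h1 : (WithLp.toLp 2 (WithLp.ofLp v + x) : 𝔼) = v + WithLp.toLp 2 x := by
    ext i; simp
  rw [h1, mul_comm (F _), ← mul_assoc, ← ENNReal.ofReal_mul
    (Finset.prod_nonneg fun i _ => gaussianPDFReal_nonneg _ _ _)]
  congr 2
  have h2 : -inner ℝ v (WithLp.toLp 2 x : 𝔼) - ‖v‖ ^ 2 / 2 =
      ∑ i, (-(v i * x i) - v i ^ 2 / 2) := by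
    rw [EuclideanSpace.real_norm_sq_eq, PiLp.inner_apply, Finset.sum_sub_distrib,
      Finset.sum_neg_distrib, Finset.sum_div]
    simp [mul_comm]
  rw [h2, Real.exp_sum, ← Finset.prod_mul_distrib]
  refine Finset.prod_congr rfl fun i _ => ?_
  simp only [gaussianPDFReal, Pi.add_apply]
  have h3 : Real.exp (-(v i + x i - 0) ^ 2 / (2 * ((1 : ℝ≥0) : ℝ))) =
      Real.exp (-(x i - 0) ^ 2 / (2 * ((1 : ℝ≥0) : ℝ))) *
        Real.exp (-(v i * x i) - v i ^ 2 / 2) := by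
    rw [← Real.exp_add]
    congr 1
    simp
    ring
  refine Eq.trans ?_ (mul_assoc _ _ _).symm
  congr 1

/-! ### A PAC-Bayesian inequality with Gaussian perturbations -/

/-- Jensen's inequality for the exponential; the right hand side may be infinite. -/
lemma exp_integral_le_lintegral_exp {Ω : Type*} [MeasurableSpace Ω] (γ : Measure Ω)
    [IsProbabilityMeasure γ] {ψ : Ω → ℝ} (hψ : Integrable ψ γ) :
    ENNReal.ofReal (Real.exp (∫ x, ψ x ∂γ)) ≤ ∫⁻ x, ENNReal.ofReal (Real.exp (ψ x)) ∂γ := by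
  set m := ∫ x, ψ x ∂γ with hm
  by_cases hfin : ∫⁻ x, ENNReal.ofReal (Real.exp (ψ x)) ∂γ = ⊤
  · rw [hfin]; exact le_top
  have hint : Integrable (fun x => Real.exp (ψ x)) γ := by
    refine ⟨(Real.measurable_exp.comp_aemeasurable hψ.aemeasurable).aestronglyMeasurable, ?_⟩
    rw [hasFiniteIntegral_iff_ofReal (ae_of_all _ fun x => (Real.exp_pos _).le)]
    exact lt_top_iff_ne_top.2 hfin
  rw [← ofReal_integral_eq_lintegral_ofReal hint (ae_of_all _ fun x => (Real.exp_pos _).le)]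
  apply ENNReal.ofReal_le_ofReal
  have h1 : ∫ x, Real.exp m * (1 + (ψ x - m)) ∂γ = Real.exp m := by
    have hi : Integrable (fun x => ψ x - m) γ := hψ.sub (integrable_const _)
    rw [integral_const_mul, integral_add (integrable_const _) hi,
      integral_sub hψ (integrable_const _)]
    simp [← hm]
  rw [← h1]
  refine integral_mono
    (((integrable_const _).add (hψ.sub (integrable_const _))).const_mul _) hint fun x => ?_
  have := Real.add_one_le_exp (ψ x - m)
  calc Real.exp m * (1 + (ψ x - m)) ≤ Real.exp m * Real.exp (ψ x - m) :=
        mul_le_mul_of_nonneg_left (by linarith) (Real.exp_pos _).le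
    _ = Real.exp (ψ x) := by rw [← Real.exp_add]; congr 1; ring

lemma lintegral_pi_prod {Ω : Type*} [MeasurableSpace Ω] (ν : Measure Ω) [IsProbabilityMeasure ν]
    {n : ℕ} (f : Ω → ℝ≥0∞) (hf : Measurable f) :
    ∫⁻ z, ∏ i, f (z i) ∂(Measure.pi fun _ : Fin n => ν) = (∫⁻ x, f x ∂ν) ^ n := by
  have hind : iIndepFun (fun (i : Fin n) (z : Fin n → Ω) => f (z i))
      (Measure.pi fun _ : Fin n => ν) :=
    iIndepFun_pi (μ := fun _ : Fin n => ν) (X := fun _ => f) fun i => hf.aemeasurable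
  rw [lintegral_prod_eq_prod_lintegral_of_indepFun _ _ hind (fun i => by fun_prop)]
  have : ∀ i : Fin n, ∫⁻ z, f (z i) ∂(Measure.pi fun _ : Fin n => ν) = ∫⁻ x, f x ∂ν := fun i =>
    (measurePreserving_eval (fun _ : Fin n => ν) i).lintegral_comp hf
  simp [this]

/-- The PAC-Bayesian inequality, for the prior `N(0, I)` and the posteriors `N(v, I)`, `v ∈ ℝ^d`.
The event does not depend on `v`: the exponential moment is averaged over the prior, the prior is
shifted by the Cameron--Martin formula, and Jensen's inequality is applied to the posterior. -/
lemma pacBayes_gaussian {Ω : Type*} [MeasurableSpace Ω] (ν : Measure Ω) [IsProbabilityMeasure ν]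
    (n : ℕ) (Φ : 𝔼 → Ω → ℝ) (hΦ : Measurable (Function.uncurry Φ)) (c : 𝔼 → ℝ)
    (hc : Measurable c)
    (hexp : ∀ g, ∫⁻ z, ENNReal.ofReal (Real.exp (Φ g z)) ∂ν ≤ ENNReal.ofReal (Real.exp (c g)))
    (δ : ℝ) (hδ : 0 < δ) :
    ∃ B : Set (Fin n → Ω), MeasurableSet B ∧
      (Measure.pi fun _ : Fin n => ν) Bᶜ ≤ ENNReal.ofReal δ ∧
      ∀ z ∈ B, ∀ v : 𝔼, (∀ i, Integrable (fun g => Φ (v + g) (z i)) (stdGaussian 𝔼)) →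
        Integrable (fun g => c (v + g)) (stdGaussian 𝔼) →
        ∑ i, ∫ g, Φ (v + g) (z i) ∂stdGaussian 𝔼 ≤
          n * ∫ g, c (v + g) ∂stdGaussian 𝔼 + ‖v‖ ^ 2 / 2 + Real.log δ⁻¹ := by
  set Q := Measure.pi fun _ : Fin n => ν with hQ
  let H : 𝔼 → (Fin n → Ω) → ℝ := fun g z => ∑ i, (Φ g (z i) - c g)
  have hHm : Measurable (Function.uncurry H) := by
    refine Finset.measurable_sum _ fun i _ => ?_
    refine Measurable.sub ?_ (hc.comp measurable_fst)
    exact hΦ.comp (measurable_fst.prodMk ((measurable_pi_apply i).comp measurable_snd))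
  let F : (Fin n → Ω) → ℝ≥0∞ := fun z => ∫⁻ g, ENNReal.ofReal (Real.exp (H g z)) ∂stdGaussian 𝔼
  have hF : Measurable F := by
    have : Measurable (fun p : (Fin n → Ω) × 𝔼 => ENNReal.ofReal (Real.exp (H p.2 p.1))) :=
      ENNReal.measurable_ofReal.comp (Real.measurable_exp.comp (hHm.comp measurable_swap))
    exact this.lintegral_prod_right'
  have hF1 : ∫⁻ z, F z ∂Q ≤ 1 := by
    simp only [F]
    rw [lintegral_lintegral_swap]
    · have : ∀ g, ∫⁻ z, ENNReal.ofReal (Real.exp (H g z)) ∂Q ≤ 1 := by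
        intro g
        have e : ∀ z : Fin n → Ω, ENNReal.ofReal (Real.exp (H g z)) =
            ∏ i, (fun x => ENNReal.ofReal (Real.exp (Φ g x - c g))) (z i) := by
          intro z
          simp only [H]
          rw [Real.exp_sum, ENNReal.ofReal_prod_of_nonneg fun i _ => (Real.exp_pos _).le]
        simp_rw [e]
        have hm : Measurable (fun x => ENNReal.ofReal (Real.exp (Φ g x - c g))) := by
          have : Measurable (Φ g) := hΦ.comp measurable_prodMk_left
          fun_prop
        rw [lintegral_pi_prod ν _ hm]
        refine pow_le_one' ?_ n
        have e2 : ∀ x, ENNReal.ofReal (Real.exp (Φ g x - c g)) =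
            ENNReal.ofReal (Real.exp (Φ g x)) * ENNReal.ofReal (Real.exp (-c g)) := by
          intro x
          rw [← ENNReal.ofReal_mul (Real.exp_pos _).le, ← Real.exp_add]
          rfl
        simp_rw [e2]
        rw [lintegral_mul_const' _ _ ENNReal.ofReal_ne_top]
        refine (mul_le_mul_left (hexp g) _).trans ?_
        rw [← ENNReal.ofReal_mul (Real.exp_pos _).le, ← Real.exp_add]
        simp
      calc _ ≤ ∫⁻ _ : 𝔼, 1 ∂stdGaussian 𝔼 := lintegral_mono this
        _ = 1 := by simp
    · exact (ENNReal.measurable_ofReal.comp (Real.measurable_exp.comp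
        (hHm.comp measurable_swap))).aemeasurable
  refine ⟨{z | F z ≤ ENNReal.ofReal δ⁻¹}, measurableSet_le hF measurable_const, ?_, ?_⟩
  · have hsub : {z | F z ≤ ENNReal.ofReal δ⁻¹}ᶜ ⊆ {z | ENNReal.ofReal δ⁻¹ ≤ F z} := by
      intro z hz
      simp only [Set.mem_compl_iff, Set.mem_ofPred_eq, not_le] at hz ⊢
      exact hz.le
    have hpos : ENNReal.ofReal δ⁻¹ ≠ 0 := by simp [hδ]
    calc Q _ ≤ Q {z | ENNReal.ofReal δ⁻¹ ≤ F z} := measure_mono hsub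
      _ ≤ (∫⁻ z, F z ∂Q) / ENNReal.ofReal δ⁻¹ :=
        meas_ge_le_lintegral_div hF.aemeasurable hpos ENNReal.ofReal_ne_top
      _ ≤ 1 / ENNReal.ofReal δ⁻¹ := by gcongr
      _ = ENNReal.ofReal δ := by
        rw [ENNReal.ofReal_inv_of_pos hδ, one_div, inv_inv]
  · intro z hz v hΦi hci
    have hz' : F z ≤ ENNReal.ofReal δ⁻¹ := hz
    have hHi : Integrable (fun g => H (v + g) z) (stdGaussian 𝔼) :=
      integrable_finsetSum _ fun i _ => (hΦi i).sub hci
    have hin : Integrable (fun g : 𝔼 => inner ℝ v g) (stdGaussian 𝔼) :=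
      IsGaussian.integrable_dual (stdGaussian 𝔼) (innerSL ℝ v)
    have hin0 : ∫ g : 𝔼, inner ℝ v g ∂stdGaussian 𝔼 = 0 :=
      integral_strongDual_stdGaussian (innerSL ℝ v)
    have hin' : Integrable (fun g : 𝔼 => -inner ℝ v g) (stdGaussian 𝔼) := hin.neg
    have hin2 : Integrable (fun g : 𝔼 => -inner ℝ v g - ‖v‖ ^ 2 / 2) (stdGaussian 𝔼) :=
      hin'.sub (integrable_const _)
    have hψ : Integrable (fun g : 𝔼 => H (v + g) z + (-inner ℝ v g - ‖v‖ ^ 2 / 2))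
        (stdGaussian 𝔼) := hHi.add hin2
    have hJ := exp_integral_le_lintegral_exp (stdGaussian 𝔼) hψ
    have hshift : F z = ∫⁻ g : 𝔼, ENNReal.ofReal
        (Real.exp (H (v + g) z + (-inner ℝ v g - ‖v‖ ^ 2 / 2))) ∂stdGaussian 𝔼 := by
      simp only [F]
      rw [lintegral_stdGaussian_shift v]
      · refine lintegral_congr fun g => ?_
        rw [← ENNReal.ofReal_mul (Real.exp_pos _).le, ← Real.exp_add]
      · exact ENNReal.measurable_ofReal.comp (Real.measurable_exp.comp
          (hHm.comp measurable_prodMk_right))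
    rw [← hshift] at hJ
    have h2 := (ENNReal.ofReal_le_ofReal_iff (by positivity)).1 (hJ.trans hz')
    have h3 := Real.log_le_log (Real.exp_pos _) h2
    rw [Real.log_exp, integral_add hHi hin2, integral_sub hin' (integrable_const _), integral_neg,
      hin0] at h3
    simp only [H] at h3
    have hsub : ∀ i, Integrable (fun g => Φ (v + g) (z i) - c (v + g)) (stdGaussian 𝔼) :=
      fun i => (hΦi i).sub hci
    rw [integral_finsetSum _ fun i _ => hsub i] at h3
    have h4 : ∀ i, ∫ g, (Φ (v + g) (z i) - c (v + g)) ∂stdGaussian 𝔼 =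
        ∫ g, Φ (v + g) (z i) ∂stdGaussian 𝔼 - ∫ g, c (v + g) ∂stdGaussian 𝔼 :=
      fun i => integral_sub (hΦi i) hci
    simp_rw [h4] at h3
    rw [Finset.sum_sub_distrib] at h3
    simp at h3
    simp only [Real.log_inv]
    linarith

/-- The squared projection of `w` on `g / √β`, recentered so that it has mean `⟨u, w⟩² - 1` when
`g ~ N(√β u, I)`. -/
noncomputable def centeredSq (β : ℝ) (g w : 𝔼) : ℝ := inner ℝ g w ^ 2 / β - 1 - ‖w‖ ^ 2 / β

lemma integral_centeredSq {β : ℝ} (hβ : 0 < β) (u w : 𝔼) :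
    ∫ g, centeredSq β (√β • u + g) w ∂stdGaussian 𝔼 = inner ℝ u w ^ 2 - 1 := by
  have h := integral_shift_eq β hβ u w (fun x => x - 1 - ‖w‖ ^ 2 / β) (by fun_prop)
  simp only [centeredSq]
  have hi : Integrable (fun x => (inner ℝ u w + x) ^ 2 - 1)
      (gaussianReal 0 (‖w‖₊ ^ 2 / β.toNNReal)) :=
    (integrable_add_pow_gaussianReal _ _ 2).sub (integrable_const _)
  rw [h, integral_sub hi (integrable_const _), integral_sub (integrable_add_pow_gaussianReal _ _ 2)
    (integrable_const _), integral_add_sq_gaussianReal]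
  simp [Real.coe_toNNReal _ hβ.le]
  ring

lemma integrable_centeredSq_pow {β : ℝ} (hβ : 0 < β) (u w : 𝔼) (k : ℕ) :
    Integrable (fun g => centeredSq β (√β • u + g) w ^ k) (stdGaussian 𝔼) := by
  have h := (integrable_shift_iff β hβ u w (fun x => (x - 1 - ‖w‖ ^ 2 / β) ^ k) (by fun_prop)).2 ?_
  · exact h
  · have e : ∀ x : ℝ, ((inner ℝ u w + x) ^ 2 - 1 - ‖w‖ ^ 2 / β) ^ k =
        ∑ m ∈ Finset.range (k + 1), (inner ℝ u w + x) ^ (2 * m) *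
          (- 1 - ‖w‖ ^ 2 / β) ^ (k - m) * (k.choose m) := by
      intro x
      rw [show (inner ℝ u w + x) ^ 2 - 1 - ‖w‖ ^ 2 / β =
        (inner ℝ u w + x) ^ 2 + (- 1 - ‖w‖ ^ 2 / β) by ring, add_pow]
      simp_rw [pow_mul]
    simp_rw [e]
    exact integrable_finsetSum _ fun m _ =>
      ((integrable_add_pow_gaussianReal _ _ _).mul_const _).mul_const _

lemma integral_centeredSq_sq {β : ℝ} (hβ : 0 < β) (u w : 𝔼) :
    ∫ g, centeredSq β (√β • u + g) w ^ 2 ∂stdGaussian 𝔼 =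
      (inner ℝ u w ^ 2 - 1) ^ 2 + 4 * inner ℝ u w ^ 2 * (‖w‖ ^ 2 / β) +
        2 * (‖w‖ ^ 2 / β) ^ 2 := by
  have h := integral_shift_eq β hβ u w (fun x => (x - 1 - ‖w‖ ^ 2 / β) ^ 2) (by fun_prop)
  simp only [centeredSq]
  rw [h]
  set a := inner ℝ u w
  set b := ‖w‖ ^ 2 / β with hb
  have hbv : (((‖w‖₊ ^ 2 / β.toNNReal : ℝ≥0)) : ℝ) = b := by
    simp [Real.coe_toNNReal _ hβ.le, hb]
  have e : ∀ x : ℝ, ((a + x) ^ 2 - 1 - b) ^ 2 =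
      (a + x) ^ 4 - (2 * (1 + b)) * (a + x) ^ 2 + (1 + b) ^ 2 := fun x => by ring
  simp_rw [e]
  have hi : Integrable (fun x => (a + x) ^ 4 - (2 * (1 + b)) * (a + x) ^ 2)
      (gaussianReal 0 (‖w‖₊ ^ 2 / β.toNNReal)) := (integrable_add_pow_gaussianReal _ _ 4).sub
    ((integrable_add_pow_gaussianReal _ _ 2).const_mul _)
  rw [integral_add hi (integrable_const _), integral_sub (integrable_add_pow_gaussianReal _ _ 4)
    ((integrable_add_pow_gaussianReal _ _ 2).const_mul _), integral_const_mul,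
    integral_add_pow_four_gaussianReal, integral_add_sq_gaussianReal, hbv]
  simp
  ring

lemma abs_centeredSq_le {β : ℝ} (hβ : 0 < β) (g w : 𝔼) :
    |centeredSq β g w| ≤ 1 + (‖g‖ ^ 2 + 1) / β * ‖w‖ ^ 2 := by
  have h1 : inner ℝ g w ^ 2 ≤ ‖g‖ ^ 2 * ‖w‖ ^ 2 := by
    rw [← mul_pow]
    exact sq_le_sq.2 ((abs_real_inner_le_norm g w).trans (le_abs_self _))
  have h2 : inner ℝ g w ^ 2 / β ≤ ‖g‖ ^ 2 / β * ‖w‖ ^ 2 := by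
    rw [div_mul_eq_mul_div]; gcongr
  have h3 : 0 ≤ inner ℝ g w ^ 2 / β := by positivity
  have h4 : (‖g‖ ^ 2 + 1) / β * ‖w‖ ^ 2 = ‖g‖ ^ 2 / β * ‖w‖ ^ 2 + ‖w‖ ^ 2 / β := by ring
  have h5 : 0 ≤ ‖g‖ ^ 2 / β * ‖w‖ ^ 2 := by positivity
  have h6 : 0 ≤ ‖w‖ ^ 2 / β := by positivity
  rw [h4, abs_le]
  unfold centeredSq
  constructor <;> linarith

lemma abs_le_one_add_sq (x : ℝ) : |x| ≤ 1 + x ^ 2 := by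
  nlinarith [sq_nonneg (|x| - 1), sq_abs x, abs_nonneg x]

section

variable {Ω : Type*} [MeasurableSpace Ω] {ν : Measure Ω} {W : Ω → EuclideanSpace ℝ (Fin d)}

lemma integrable_norm_sq_of_four [IsFiniteMeasure ν] (hW : Measurable W)
    (hW4 : Integrable (fun z => ‖W z‖ ^ 4) ν) :
    Integrable (fun z => ‖W z‖ ^ 2) ν := by
  refine ((integrable_const (1 : ℝ)).add hW4).mono' (by fun_prop) (ae_of_all _ fun z => ?_)
  have := abs_le_one_add_sq (‖W z‖ ^ 2)
  simpa [← pow_mul] using this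

lemma integrable_inner_sq (hW : Measurable W) (hW2 : Integrable (fun z => ‖W z‖ ^ 2) ν) (u : 𝔼) :
    Integrable (fun z => inner ℝ u (W z) ^ 2) ν := by
  refine (hW2.const_mul (‖u‖ ^ 2)).mono' (by fun_prop) (ae_of_all _ fun z => ?_)
  rw [Real.norm_eq_abs, abs_of_nonneg (sq_nonneg _), ← mul_pow]
  exact sq_le_sq.2 ((abs_real_inner_le_norm _ _).trans (le_abs_self _))

lemma integrable_inner_four (hW : Measurable W) (hW4 : Integrable (fun z => ‖W z‖ ^ 4) ν) (u : 𝔼) :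
    Integrable (fun z => inner ℝ u (W z) ^ 4) ν := by
  refine (hW4.const_mul (‖u‖ ^ 4)).mono' (by fun_prop) (ae_of_all _ fun z => ?_)
  rw [Real.norm_eq_abs, abs_of_nonneg (by positivity), ← mul_pow, ← Even.pow_abs (by decide)]
  exact pow_le_pow_left₀ (abs_nonneg _) (abs_real_inner_le_norm _ _) 4

lemma integrable_inner_sq_mul (hW : Measurable W) (hW4 : Integrable (fun z => ‖W z‖ ^ 4) ν)
    (u : 𝔼) : Integrable (fun z => inner ℝ u (W z) ^ 2 * ‖W z‖ ^ 2) ν := by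
  refine (hW4.const_mul (‖u‖ ^ 2)).mono' (by fun_prop) (ae_of_all _ fun z => ?_)
  rw [Real.norm_eq_abs, abs_of_nonneg (by positivity),
    show ‖u‖ ^ 2 * ‖W z‖ ^ 4 = (‖u‖ * ‖W z‖) ^ 2 * ‖W z‖ ^ 2 by ring]
  refine mul_le_mul_of_nonneg_right ?_ (sq_nonneg _)
  exact sq_le_sq.2 ((abs_real_inner_le_norm u (W z)).trans (le_abs_self _))

/-- The second moment of `centeredSq` after averaging over the Gaussian perturbation. -/
noncomputable def averagedSq (β : ℝ) (u w : 𝔼) : ℝ :=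
  (inner ℝ u w ^ 2 - 1) ^ 2 + 4 * inner ℝ u w ^ 2 * (‖w‖ ^ 2 / β) + 2 * (‖w‖ ^ 2 / β) ^ 2

lemma integrable_averagedSq [IsFiniteMeasure ν] (hW : Measurable W)
    (hW4 : Integrable (fun z => ‖W z‖ ^ 4) ν) (β : ℝ)
    (u : 𝔼) : Integrable (fun z => averagedSq β u (W z)) ν := by
  have e : ∀ z, averagedSq β u (W z) = inner ℝ u (W z) ^ 4 - 2 * inner ℝ u (W z) ^ 2 + 1 +
      4 / β * (inner ℝ u (W z) ^ 2 * ‖W z‖ ^ 2) + 2 / β ^ 2 * ‖W z‖ ^ 4 := by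
    intro z; unfold averagedSq; ring
  simp_rw [e]
  have h1 := integrable_inner_four hW hW4 u
  have h2 := integrable_inner_sq hW (integrable_norm_sq_of_four hW hW4) u
  have h3 := integrable_inner_sq_mul hW hW4 u
  exact ((((h1.sub (h2.const_mul 2)).add (integrable_const _)).add (h3.const_mul _)).add
    (hW4.const_mul _))

lemma measurable_centeredSq_comp (hW : Measurable W) (β : ℝ) :
    Measurable (fun p : EuclideanSpace ℝ (Fin d) × Ω => centeredSq β p.1 (W p.2)) := by
  have hW' : Measurable (fun p : EuclideanSpace ℝ (Fin d) × Ω => W p.2) := hW.comp measurable_snd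
  unfold centeredSq
  fun_prop

lemma integrable_centeredSq_sq_right [IsFiniteMeasure ν] (hW : Measurable W)
    (hW4 : Integrable (fun z => ‖W z‖ ^ 4) ν) {β : ℝ} (hβ : 0 < β)
    (g : EuclideanSpace ℝ (Fin d)) : Integrable (fun z => centeredSq β g (W z) ^ 2) ν := by
  refine (((integrable_const (2 : ℝ)).add
    (hW4.const_mul (2 * ((‖g‖ ^ 2 + 1) / β) ^ 2)))).mono'
    (((measurable_centeredSq_comp hW β).comp measurable_prodMk_left).pow_const
      2).aestronglyMeasurable (ae_of_all _ fun z => ?_)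
  have h1 := abs_centeredSq_le hβ g (W z)
  have h2 : centeredSq β g (W z) ^ 2 ≤ (1 + (‖g‖ ^ 2 + 1) / β * ‖W z‖ ^ 2) ^ 2 := by
    rw [← sq_abs]; exact pow_le_pow_left₀ (abs_nonneg _) h1 2
  rw [Real.norm_eq_abs, abs_of_nonneg (sq_nonneg _)]
  simp only [Pi.add_apply]
  have h3 := sq_nonneg (1 - (‖g‖ ^ 2 + 1) / β * ‖W z‖ ^ 2)
  calc _ ≤ _ := h2
    _ ≤ 2 + 2 * ((‖g‖ ^ 2 + 1) / β * ‖W z‖ ^ 2) ^ 2 := by linarith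
    _ = _ := by ring

lemma integrable_of_integrable_sq {α : Type*} [MeasurableSpace α] {μ : Measure α}
    [IsFiniteMeasure μ] {f : α → ℝ} (hf : AEStronglyMeasurable f μ)
    (h : Integrable (fun x => f x ^ 2) μ) : Integrable f μ :=
  ((integrable_const (1 : ℝ)).add h).mono' hf (ae_of_all _ fun _ => abs_le_one_add_sq _)

lemma measurable_shift_left (v : EuclideanSpace ℝ (Fin d)) :
    Measurable (fun p : EuclideanSpace ℝ (Fin d) × Ω =>
      ((v + p.1, p.2) : EuclideanSpace ℝ (Fin d) × Ω)) := by fun_prop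

/-- Square integrability jointly in the perturbation and in the observation. -/
lemma integrable_centeredSq_sq_prod [IsFiniteMeasure ν] (hW : Measurable W)
    (hW4 : Integrable (fun z => ‖W z‖ ^ 4) ν) {β : ℝ} (hβ : 0 < β)
    (u : EuclideanSpace ℝ (Fin d)) :
    Integrable (fun p : EuclideanSpace ℝ (Fin d) × Ω =>
      centeredSq β (√β • u + p.1) (W p.2) ^ 2)
      ((stdGaussian (EuclideanSpace ℝ (Fin d))).prod ν) := by
  have hm : Measurable (fun p : EuclideanSpace ℝ (Fin d) × Ω =>
      centeredSq β (√β • u + p.1) (W p.2) ^ 2) :=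
    ((measurable_centeredSq_comp hW β).comp (measurable_shift_left (√β • u))).pow_const 2
  rw [integrable_prod_iff' hm.aestronglyMeasurable]
  refine ⟨ae_of_all _ fun z => integrable_centeredSq_pow hβ u (W z) 2, ?_⟩
  have e : ∀ z, ∫ g, ‖centeredSq β (√β • u + g) (W z) ^ 2‖
      ∂stdGaussian (EuclideanSpace ℝ (Fin d)) = averagedSq β u (W z) := by
    intro z
    rw [averagedSq, ← integral_centeredSq_sq hβ]
    simp
  simp_rw [e]
  exact integrable_averagedSq hW hW4 β u

/-- The Gaussian average of the expectation of a quadratic polynomial in `centeredSq`. -/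
lemma integral_integral_centeredSq [IsFiniteMeasure ν] (hW : Measurable W)
    (hW4 : Integrable (fun z => ‖W z‖ ^ 4) ν) {β : ℝ} (hβ : 0 < β) (α η : ℝ) {r : Ω → ℝ}
    (hr : Integrable r ν) (u : EuclideanSpace ℝ (Fin d)) :
    Integrable (fun g => ∫ z, (α * centeredSq β (√β • u + g) (W z) +
      η * centeredSq β (√β • u + g) (W z) ^ 2 + r z) ∂ν)
      (stdGaussian (EuclideanSpace ℝ (Fin d))) ∧
    ∫ g, ∫ z, (α * centeredSq β (√β • u + g) (W z) +
      η * centeredSq β (√β • u + g) (W z) ^ 2 + r z) ∂ν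
        ∂stdGaussian (EuclideanSpace ℝ (Fin d)) =
      ∫ z, (α * (inner ℝ u (W z) ^ 2 - 1) + η * averagedSq β u (W z) + r z) ∂ν := by
  have hJ2 := integrable_centeredSq_sq_prod hW hW4 hβ u
  have hJ1 : Integrable (fun p : EuclideanSpace ℝ (Fin d) × Ω =>
      centeredSq β (√β • u + p.1) (W p.2))
      ((stdGaussian (EuclideanSpace ℝ (Fin d))).prod ν) :=
    integrable_of_integrable_sq ((measurable_centeredSq_comp hW β).comp
      (measurable_shift_left _)).aestronglyMeasurable hJ2
  have hJ : Integrable (Function.uncurry fun (g : EuclideanSpace ℝ (Fin d)) (z : Ω) =>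
      α * centeredSq β (√β • u + g) (W z) + η * centeredSq β (√β • u + g) (W z) ^ 2 + r z)
      ((stdGaussian (EuclideanSpace ℝ (Fin d))).prod ν) :=
    ((hJ1.const_mul α).add (hJ2.const_mul η)).add (hr.comp_snd _)
  refine ⟨hJ.integral_prod_left, ?_⟩
  rw [integral_integral_swap hJ]
  refine integral_congr_ae (ae_of_all _ fun z => ?_)
  have i1 : Integrable (fun g => α * centeredSq β (√β • u + g) (W z))
      (stdGaussian (EuclideanSpace ℝ (Fin d))) := by
    simpa using (integrable_centeredSq_pow hβ u (W z) 1).const_mul α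
  have i2 := (integrable_centeredSq_pow hβ u (W z) 2).const_mul η
  have i3 : Integrable (fun g => α * centeredSq β (√β • u + g) (W z) +
      η * centeredSq β (√β • u + g) (W z) ^ 2) (stdGaussian (EuclideanSpace ℝ (Fin d))) :=
    i1.add i2
  simp only
  rw [integral_add i3 (integrable_const _), integral_add i1 i2, integral_const_mul,
    integral_const_mul, integral_centeredSq hβ, integral_centeredSq_sq hβ, averagedSq]
  simp

/-- The PAC-Bayesian inequality for a functional `Φ` whose exponential is bounded by a quadratic
polynomial in `centeredSq`. The Gaussian average of this polynomial is explicit. -/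
lemma pacBayes_centeredSq [IsProbabilityMeasure ν] (n : ℕ) (hW : Measurable W)
    (hW4 : Integrable (fun z => ‖W z‖ ^ 4) ν)
    {β : ℝ} (hβ : 0 < β) (α η : ℝ) {r : Ω → ℝ} (hr : Integrable r ν) (hrm : Measurable r)
    (Φ : EuclideanSpace ℝ (Fin d) → Ω → ℝ) (hΦ : Measurable (Function.uncurry Φ))
    (hexp : ∀ g z, Real.exp (Φ g z) ≤
      1 + (α * centeredSq β g (W z) + η * centeredSq β g (W z) ^ 2 + r z))
    {δ : ℝ} (hδ : 0 < δ) :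
    ∃ B : Set (Fin n → Ω), MeasurableSet B ∧
      (Measure.pi fun _ : Fin n => ν) Bᶜ ≤ ENNReal.ofReal δ ∧
      ∀ z ∈ B, ∀ u : EuclideanSpace ℝ (Fin d), ‖u‖ = 1 →
        (∀ i, Integrable (fun g => Φ (√β • u + g) (z i))
          (stdGaussian (EuclideanSpace ℝ (Fin d)))) →
        ∑ i, ∫ g, Φ (√β • u + g) (z i) ∂stdGaussian (EuclideanSpace ℝ (Fin d)) ≤
          n * ∫ z, (α * (inner ℝ u (W z) ^ 2 - 1) + η * averagedSq β u (W z) + r z) ∂ν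
            + β / 2 + Real.log δ⁻¹ := by
  have hTm := measurable_centeredSq_comp hW β
  have hqm : Measurable (Function.uncurry fun (g : EuclideanSpace ℝ (Fin d)) (z : Ω) =>
      α * centeredSq β g (W z) + η * centeredSq β g (W z) ^ 2 + r z) :=
    ((hTm.const_mul α).add ((hTm.pow_const 2).const_mul η)).add (hrm.comp measurable_snd)
  have hq : ∀ g : EuclideanSpace ℝ (Fin d), Integrable (fun z =>
      α * centeredSq β g (W z) + η * centeredSq β g (W z) ^ 2 + r z) ν := fun g =>
    have h2 := integrable_centeredSq_sq_right hW hW4 hβ g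
    (((integrable_of_integrable_sq
      (hTm.comp measurable_prodMk_left).aestronglyMeasurable h2).const_mul α).add
      (h2.const_mul η)).add hr
  have hcm : Measurable fun g : EuclideanSpace ℝ (Fin d) => ∫ z,
      (α * centeredSq β g (W z) + η * centeredSq β g (W z) ^ 2 + r z) ∂ν :=
    hqm.stronglyMeasurable.integral_prod_right.measurable
  have hexp' : ∀ g : EuclideanSpace ℝ (Fin d), ∫⁻ z, ENNReal.ofReal (Real.exp (Φ g z)) ∂ν ≤
      ENNReal.ofReal (Real.exp (∫ z,
        (α * centeredSq β g (W z) + η * centeredSq β g (W z) ^ 2 + r z) ∂ν)) := by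
    intro g
    refine (lintegral_mono fun z => ENNReal.ofReal_le_ofReal (hexp g z)).trans ?_
    have hq1 : Integrable (fun z =>
        1 + (α * centeredSq β g (W z) + η * centeredSq β g (W z) ^ 2 + r z)) ν :=
      (integrable_const _).add (hq g)
    rw [← ofReal_integral_eq_lintegral_ofReal hq1
      (ae_of_all _ fun z => (Real.exp_pos _).le.trans (hexp g z)),
      integral_add (integrable_const _) (hq g)]
    apply ENNReal.ofReal_le_ofReal
    rw [integral_const, probReal_univ, one_smul, add_comm]
    exact Real.add_one_le_exp _
  obtain ⟨B, hB, hBδ, hBz⟩ := pacBayes_gaussian ν n Φ hΦ _ hcm hexp' δ hδ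
  refine ⟨B, hB, hBδ, fun z hz u hu hΦi => ?_⟩
  obtain ⟨hci, hcI⟩ := integral_integral_centeredSq hW hW4 hβ α η hr u
  have hmain := hBz z hz (√β • u) hΦi hci
  rwa [hcI, norm_smul, hu, Real.norm_eq_abs, abs_of_nonneg (Real.sqrt_nonneg _), mul_one,
    Real.sq_sqrt hβ.le] at hmain

end

end

/-! ### Random vectors with a bounded kurtosis -/

section

variable {d : ℕ} {Ω : Type*}

open Classical in
/-- The vector `W`, replaced by `0` where its squared norm exceeds `R`. -/
noncomputable def normTruncate (W : Ω → EuclideanSpace ℝ (Fin d)) (R : ℝ) (z : Ω) :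
    EuclideanSpace ℝ (Fin d) := if ‖W z‖ ^ 2 ≤ R then W z else 0

lemma normTruncate_cases (W : Ω → EuclideanSpace ℝ (Fin d)) (R : ℝ) (z : Ω) :
    (‖W z‖ ^ 2 ≤ R ∧ normTruncate W R z = W z) ∨ (R < ‖W z‖ ^ 2 ∧ normTruncate W R z = 0) := by
  by_cases hz : ‖W z‖ ^ 2 ≤ R
  · exact Or.inl ⟨hz, if_pos hz⟩
  · exact Or.inr ⟨not_le.1 hz, if_neg hz⟩

lemma norm_normTruncate_sq_le (W : Ω → EuclideanSpace ℝ (Fin d)) {R : ℝ} (hR : 0 ≤ R) (z : Ω) :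
    ‖normTruncate W R z‖ ^ 2 ≤ R := by
  rcases normTruncate_cases W R z with ⟨h, e⟩ | ⟨-, e⟩ <;> rw [e]
  · exact h
  · simpa using hR

lemma inner_normTruncate_pow_le (W : Ω → EuclideanSpace ℝ (Fin d)) (R : ℝ)
    (u : EuclideanSpace ℝ (Fin d)) (z : Ω) {m : ℕ} (hm : Even m)
    (hm0 : m ≠ 0) : inner ℝ u (normTruncate W R z) ^ m ≤ inner ℝ u (W z) ^ m := by
  rcases normTruncate_cases W R z with ⟨-, e⟩ | ⟨-, e⟩ <;> rw [e]
  rw [inner_zero_right, zero_pow hm0]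
  exact hm.pow_nonneg _

end

section

variable {d : ℕ} {Ω : Type*} [MeasurableSpace Ω]

/-- The random vector `W` has a Gram matrix dominated by the identity, and a kurtosis at most `k`
relatively to the identity. -/
structure MomentBound (ν : Measure Ω) (W : Ω → EuclideanSpace ℝ (Fin d)) (k : ℝ) : Prop where
  measurable : Measurable W
  integrable : Integrable (fun z => ‖W z‖ ^ 4) ν
  sq_le : ∀ u, ∫ z, inner ℝ u (W z) ^ 2 ∂ν ≤ ‖u‖ ^ 2
  four_le : ∀ u, ∫ z, inner ℝ u (W z) ^ 4 ∂ν ≤ k * ‖u‖ ^ 4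

lemma norm_sq_eq_sum_inner (w : EuclideanSpace ℝ (Fin d)) :
    ‖w‖ ^ 2 = ∑ i, inner ℝ (EuclideanSpace.single i (1 : ℝ)) w ^ 2 := by
  rw [EuclideanSpace.real_norm_sq_eq]
  refine Finset.sum_congr rfl fun i _ => ?_
  rw [EuclideanSpace.inner_single_left]
  simp

variable {ν : Measure Ω} {W : Ω → EuclideanSpace ℝ (Fin d)} {k : ℝ}

lemma MomentBound.integrable_sq [IsFiniteMeasure ν] (h : MomentBound ν W k) :
    Integrable (fun z => ‖W z‖ ^ 2) ν :=
  integrable_norm_sq_of_four h.measurable h.integrable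

lemma MomentBound.norm_sq_le [IsFiniteMeasure ν] (h : MomentBound ν W k) :
    ∫ z, ‖W z‖ ^ 2 ∂ν ≤ d := by
  simp_rw [norm_sq_eq_sum_inner (W _)]
  rw [integral_finsetSum _ fun i _ => integrable_inner_sq h.measurable h.integrable_sq _]
  calc _ ≤ ∑ _i : Fin d, (1 : ℝ) := Finset.sum_le_sum fun i _ => by
        simpa using h.sq_le (EuclideanSpace.single i (1 : ℝ))
    _ = d := by simp

lemma integrable_inner_sq_mul_inner_sq (h : MomentBound ν W k) (u v : EuclideanSpace ℝ (Fin d)) :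
    Integrable (fun z => inner ℝ u (W z) ^ 2 * inner ℝ v (W z) ^ 2) ν := by
  refine ((integrable_inner_four h.measurable h.integrable u).add
    (integrable_inner_four h.measurable h.integrable v)).mono'
    (by have := h.measurable; fun_prop) (ae_of_all _ fun z => ?_)
  rw [Real.norm_eq_abs, abs_of_nonneg (by positivity)]
  simp only [Pi.add_apply]
  nlinarith [sq_nonneg (inner ℝ u (W z) ^ 2 - inner ℝ v (W z) ^ 2),
    sq_nonneg (inner ℝ u (W z) ^ 2), sq_nonneg (inner ℝ v (W z) ^ 2)]

lemma MomentBound.inner_sq_mul_le (h : MomentBound ν W k) {u v : EuclideanSpace ℝ (Fin d)}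
    (hu : ‖u‖ = 1) (hv : ‖v‖ = 1) :
    ∫ z, inner ℝ u (W z) ^ 2 * inner ℝ v (W z) ^ 2 ∂ν ≤ k := by
  have hi1 := integrable_inner_four h.measurable h.integrable u
  have hi2 := integrable_inner_four h.measurable h.integrable v
  calc _ ≤ ∫ z, (1 / 2 * inner ℝ u (W z) ^ 4 + 1 / 2 * inner ℝ v (W z) ^ 4) ∂ν := by
        refine integral_mono (integrable_inner_sq_mul_inner_sq h u v)
          ((hi1.const_mul _).add (hi2.const_mul _)) fun z => ?_
        simp only
        nlinarith [sq_nonneg (inner ℝ u (W z) ^ 2 - inner ℝ v (W z) ^ 2)]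
    _ ≤ k := by
        rw [integral_add (hi1.const_mul _) (hi2.const_mul _), integral_const_mul,
          integral_const_mul]
        have h1 := h.four_le u
        have h2 := h.four_le v
        rw [hu] at h1
        rw [hv] at h2
        linarith

lemma MomentBound.inner_sq_mul_norm_sq_le (h : MomentBound ν W k)
    {u : EuclideanSpace ℝ (Fin d)} (hu : ‖u‖ = 1) :
    ∫ z, inner ℝ u (W z) ^ 2 * ‖W z‖ ^ 2 ∂ν ≤ k * d := by
  simp_rw [norm_sq_eq_sum_inner (W _), Finset.mul_sum]
  rw [integral_finsetSum _ fun i _ => integrable_inner_sq_mul_inner_sq h _ _]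
  calc _ ≤ ∑ _i : Fin d, k := Finset.sum_le_sum fun i _ => h.inner_sq_mul_le hu (by simp)
    _ = k * d := by simp [mul_comm]

lemma MomentBound.norm_four_le (h : MomentBound ν W k) :
    ∫ z, ‖W z‖ ^ 4 ∂ν ≤ k * d ^ 2 := by
  have e : ∀ z, ‖W z‖ ^ 4 =
      ∑ i, inner ℝ (EuclideanSpace.single i (1 : ℝ)) (W z) ^ 2 * ‖W z‖ ^ 2 := by
    intro z
    rw [← Finset.sum_mul, ← norm_sq_eq_sum_inner]
    ring
  simp_rw [e]
  rw [integral_finsetSum _ fun i _ => integrable_inner_sq_mul h.measurable h.integrable _]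
  calc _ ≤ ∑ _i : Fin d, k * d := Finset.sum_le_sum fun i _ =>
        h.inner_sq_mul_norm_sq_le (by simp)
    _ = k * d ^ 2 := by simp; ring

lemma MomentBound.averagedSq_le [IsProbabilityMeasure ν] (h : MomentBound ν W k) {β : ℝ}
    (hβ : 0 < β) {u : EuclideanSpace ℝ (Fin d)} (hu : ‖u‖ = 1) :
    ∫ z, averagedSq β u (W z) ∂ν ≤
      k - 1 + 2 * (1 - ∫ z, inner ℝ u (W z) ^ 2 ∂ν) + 4 * k * d / β + 2 * k * d ^ 2 / β ^ 2 := by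
  have e : ∀ z, averagedSq β u (W z) = inner ℝ u (W z) ^ 4 - 2 * inner ℝ u (W z) ^ 2 + 1 +
      4 / β * (inner ℝ u (W z) ^ 2 * ‖W z‖ ^ 2) + 2 / β ^ 2 * ‖W z‖ ^ 4 := by
    intro z; unfold averagedSq; ring
  simp_rw [e]
  have h1 := integrable_inner_four h.measurable h.integrable u
  have h2 := (integrable_inner_sq h.measurable h.integrable_sq u).const_mul 2
  have h3 := (integrable_inner_sq_mul h.measurable h.integrable u).const_mul (4 / β)
  have h4 := h.integrable.const_mul (2 / β ^ 2)
  have h12 : Integrable (fun z => inner ℝ u (W z) ^ 4 - 2 * inner ℝ u (W z) ^ 2) ν := h1.sub h2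
  have h121 : Integrable (fun z => inner ℝ u (W z) ^ 4 - 2 * inner ℝ u (W z) ^ 2 + 1) ν :=
    h12.add (integrable_const _)
  have h123 : Integrable (fun z => inner ℝ u (W z) ^ 4 - 2 * inner ℝ u (W z) ^ 2 + 1 +
      4 / β * (inner ℝ u (W z) ^ 2 * ‖W z‖ ^ 2)) ν := h121.add h3
  rw [integral_add h123 h4, integral_add h121 h3, integral_add h12 (integrable_const _),
    integral_sub h1 h2, integral_const_mul, integral_const_mul, integral_const_mul]
  have b1 := h.four_le u
  rw [hu] at b1
  have b3 : 4 / β * ∫ z, inner ℝ u (W z) ^ 2 * ‖W z‖ ^ 2 ∂ν ≤ 4 / β * (k * d) :=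
    mul_le_mul_of_nonneg_left (h.inner_sq_mul_norm_sq_le hu) (by positivity)
  have b4 : 2 / β ^ 2 * ∫ z, ‖W z‖ ^ 4 ∂ν ≤ 2 / β ^ 2 * (k * d ^ 2) :=
    mul_le_mul_of_nonneg_left h.norm_four_le (by positivity)
  have e3 : 4 / β * (k * d) = 4 * k * d / β := by ring
  have e4 : 2 / β ^ 2 * (k * d ^ 2) = 2 * k * d ^ 2 / β ^ 2 := by ring
  rw [e3] at b3
  rw [e4] at b4
  simp
  linarith

/-! ### The upper bound for the empirical quadratic form -/

/-- The Gaussian average of the logarithmic influence function is close to its argument. -/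
lemma integral_log_quad_ge {β : ℝ} (hβ : 18 ≤ β) {l : ℝ} (hl : 0 < l)
    (u w : EuclideanSpace ℝ (Fin d)) (hu : ‖u‖ = 1) :
    Integrable (fun g => Real.log (1 + l * centeredSq β (√β • u + g) w +
        (l * centeredSq β (√β • u + g) w) ^ 2 / 2)) (stdGaussian (EuclideanSpace ℝ (Fin d))) ∧
    l * (inner ℝ u w ^ 2 - 1) - min ((l * ‖w‖ ^ 2) ^ 2) ((l * ‖w‖ ^ 2) ^ 3) / 3 ≤
      ∫ g, Real.log (1 + l * centeredSq β (√β • u + g) w +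
        (l * centeredSq β (√β • u + g) w) ^ 2 / 2)
          ∂stdGaussian (EuclideanSpace ℝ (Fin d)) := by
  have hβ0 : 0 < β := by linarith
  set γ := stdGaussian (EuclideanSpace ℝ (Fin d))
  have hT1 : Integrable (fun g => centeredSq β (√β • u + g) w) γ := by
    simpa using integrable_centeredSq_pow hβ0 u w 1
  have hT2 := integrable_centeredSq_pow hβ0 u w 2
  have hTm : Measurable (fun g : EuclideanSpace ℝ (Fin d) => centeredSq β (√β • u + g) w) := by
    unfold centeredSq; fun_prop
  have hL : Integrable (fun g => Real.log (1 + l * centeredSq β (√β • u + g) w +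
        (l * centeredSq β (√β • u + g) w) ^ 2 / 2)) γ := by
    refine (((integrable_const (1 : ℝ)).add ((hT1.const_mul l).abs)).add
      (hT2.const_mul (l ^ 2))).mono'
      (Real.measurable_log.comp (by fun_prop)).aestronglyMeasurable (ae_of_all _ fun g => ?_)
    have := abs_log_quad_le (l * centeredSq β (√β • u + g) w)
    simp only [Pi.add_apply, Real.norm_eq_abs]
    rwa [← mul_pow]
  refine ⟨hL, ?_⟩
  -- the fourth and sixth moments of the perturbed projection
  set Y := l * ‖w‖ ^ 2 with hY
  have hY0 : 0 ≤ Y := by positivity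
  have hpw : ∀ g, ∀ m : ℕ, l ^ m * (inner ℝ (√β • u + g) w ^ 2 / β) ^ m =
      (l * (inner ℝ (√β • u + g) w ^ 2 / β)) ^ m := fun g m => by rw [mul_pow]
  have ha : inner ℝ u w ^ 2 ≤ ‖w‖ ^ 2 := by
    have := abs_real_inner_le_norm u w
    rw [hu, one_mul] at this
    exact sq_le_sq.2 (this.trans (le_abs_self _))
  have hbv : (((‖w‖₊ ^ 2 / β.toNNReal : ℝ≥0)) : ℝ) = ‖w‖ ^ 2 / β := by
    simp [Real.coe_toNNReal _ hβ0.le]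
  have hb18 : ‖w‖ ^ 2 / β ≤ ‖w‖ ^ 2 / 18 := by gcongr
  have hb0 : 0 ≤ ‖w‖ ^ 2 / β := by positivity
  have hI : ∀ m : ℕ, Integrable (fun g => (l * (inner ℝ (√β • u + g) w ^ 2 / β)) ^ m) γ := by
    intro m
    simp_rw [← hpw]
    refine Integrable.const_mul ?_ _
    refine (integrable_shift_iff β hβ0 u w (fun x => x ^ m) (by fun_prop)).2 ?_
    simp_rw [← pow_mul]
    exact integrable_add_pow_gaussianReal _ _ _
  have hM2 : ∫ g, (l * (inner ℝ (√β • u + g) w ^ 2 / β)) ^ 2 ∂γ ≤ 2 * Y ^ 2 := by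
    simp_rw [← hpw]
    rw [integral_const_mul, integral_shift_eq β hβ0 u w (fun x => x ^ 2) (by fun_prop)]
    simp_rw [← pow_mul]
    rw [integral_add_pow_four_gaussianReal, hbv]
    set a := inner ℝ u w ^ 2
    have ha0 : 0 ≤ a := sq_nonneg _
    set U := ‖w‖ ^ 2
    set b := U / β
    have : inner ℝ u w ^ 4 + 6 * a * b + 3 * b ^ 2 ≤ 2 * U ^ 2 := by
      have e : inner ℝ u w ^ 4 = a ^ 2 := by simp only [a]; ring
      rw [e]
      have h1 : a ^ 2 ≤ U ^ 2 := pow_le_pow_left₀ ha0 ha 2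
      have h2 : a * b ≤ U * (U / 18) := mul_le_mul ha hb18 hb0 (ha0.trans ha)
      have h3 : b ^ 2 ≤ (U / 18) ^ 2 := pow_le_pow_left₀ hb0 hb18 2
      nlinarith
    calc _ ≤ l ^ 2 * (2 * U ^ 2) := by gcongr
      _ = _ := by rw [hY]; ring
  have hM3 : ∫ g, (l * (inner ℝ (√β • u + g) w ^ 2 / β)) ^ 3 ∂γ ≤ 2 * Y ^ 3 := by
    simp_rw [← hpw]
    rw [integral_const_mul, integral_shift_eq β hβ0 u w (fun x => x ^ 3) (by fun_prop)]
    simp_rw [← pow_mul]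
    rw [integral_add_pow_six_gaussianReal, hbv]
    set a := inner ℝ u w ^ 2
    have ha0 : 0 ≤ a := sq_nonneg _
    set U := ‖w‖ ^ 2
    have hU0 : 0 ≤ U := ha0.trans ha
    set b := U / β
    have : inner ℝ u w ^ 6 + 15 * inner ℝ u w ^ 4 * b + 45 * a * b ^ 2 + 15 * b ^ 3 ≤
        2 * U ^ 3 := by
      have e : inner ℝ u w ^ 4 = a ^ 2 := by simp only [a]; ring
      have e' : inner ℝ u w ^ 6 = a ^ 3 := by simp only [a]; ring
      rw [e, e']
      have h0 : a ^ 3 ≤ U ^ 3 := pow_le_pow_left₀ ha0 ha 3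
      have h1 : a ^ 2 ≤ U ^ 2 := pow_le_pow_left₀ ha0 ha 2
      have h2 : a ^ 2 * b ≤ U ^ 2 * (U / 18) := mul_le_mul h1 hb18 hb0 (by positivity)
      have h3 : b ^ 2 ≤ (U / 18) ^ 2 := pow_le_pow_left₀ hb0 hb18 2
      have h4 : a * b ^ 2 ≤ U * (U / 18) ^ 2 := mul_le_mul ha h3 (by positivity) hU0
      have h5 : b ^ 3 ≤ (U / 18) ^ 3 := pow_le_pow_left₀ hb0 hb18 3
      have h6 : 0 ≤ U ^ 3 := by positivity
      nlinarith
    calc _ ≤ l ^ 3 * (2 * U ^ 3) := by gcongr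
      _ = _ := by rw [hY]; ring
  have hpt : ∀ m : ℕ, m = 2 ∨ m = 3 → ∀ g, l * centeredSq β (√β • u + g) w -
      (l * (inner ℝ (√β • u + g) w ^ 2 / β)) ^ m / 6 ≤
      Real.log (1 + l * centeredSq β (√β • u + g) w +
        (l * centeredSq β (√β • u + g) w) ^ 2 / 2) := by
    intro m hm g
    have hle : l * centeredSq β (√β • u + g) w ≤ l * (inner ℝ (√β • u + g) w ^ 2 / β) := by
      apply mul_le_mul_of_nonneg_left _ hl.le
      unfold centeredSq
      linarith
    set x := l * centeredSq β (√β • u + g) w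
    have hq0 : 0 ≤ l * (inner ℝ (√β • u + g) w ^ 2 / β) := by positivity
    rcases le_total x 0 with hx | hx
    · have := sub_log_quad_nonpos hx
      have h2 := pow_nonneg hq0 m
      linarith
    · have h1 : x - Real.log (1 + x + x ^ 2 / 2) ≤ x ^ m / 6 := by
        rcases hm with rfl | rfl
        · exact sub_log_quad_le_sq hx
        · exact sub_log_quad_le_cube hx
      have h2 := pow_le_pow_left₀ hx hle m
      linarith
  have hint : ∀ m : ℕ, m = 2 ∨ m = 3 → l * (inner ℝ u w ^ 2 - 1) - Y ^ m / 3 ≤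
      ∫ g, Real.log (1 + l * centeredSq β (√β • u + g) w +
        (l * centeredSq β (√β • u + g) w) ^ 2 / 2) ∂γ := by
    intro m hm
    have h1 : ∫ g, (l * centeredSq β (√β • u + g) w -
      (l * (inner ℝ (√β • u + g) w ^ 2 / β)) ^ m / 6) ∂γ ≤ _ :=
      integral_mono ((hT1.const_mul l).sub ((hI m).div_const 6)) hL (hpt m hm)
    rw [integral_sub (hT1.const_mul l) ((hI m).div_const 6), integral_const_mul,
      integral_centeredSq hβ0, integral_div] at h1
    have h2 : ∫ g, (l * (inner ℝ (√β • u + g) w ^ 2 / β)) ^ m ∂γ ≤ 2 * Y ^ m := by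
      rcases hm with rfl | rfl
      · exact hM2
      · exact hM3
    linarith
  have h2 := hint 2 (Or.inl rfl)
  have h3 := hint 3 (Or.inr rfl)
  rcases le_total (Y ^ 2) (Y ^ 3) with h | h
  · rwa [min_eq_left h]
  · rwa [min_eq_right h]

/-- Relations between the confidence level `ε`, the inverse temperature `l = √(2 L / ((k - 1) n))`,
where `L = log(ε⁻¹) + 0.73 d`, and the dimension scale `s = √(k d / n)`. -/
structure Scales (d n : ℕ) (k ε l s : ℝ) : Prop where
  one_le_d : 1 ≤ d
  one_le_n : 1 ≤ n
  one_lt_k : 1 < k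
  eps_pos : 0 < ε
  eps_le : ε ≤ 1
  l_pos : 0 < l
  s_pos : 0 < s
  s_sq : s ^ 2 * n = k * d
  l_sq : (k - 1) * l ^ 2 * n = 2 * confTerm d ε

lemma Scales.confTerm_ge {n : ℕ} {ε l s : ℝ} (h : Scales d n k ε l s) :
    0.73 * (d : ℝ) ≤ confTerm d ε := by
  have : 0 ≤ Real.log ε⁻¹ := Real.log_nonneg (by
    rw [one_le_inv₀ h.eps_pos]; exact h.eps_le)
  unfold confTerm; linarith

/-- The term `0.73 d` in the definition of `L` makes `n l s` at least of the order of `d`. -/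
lemma Scales.dim_le {n : ℕ} {ε l s : ℝ} (h : Scales d n k ε l s) :
    1.208 * (d : ℝ) ≤ n * l * s := by
  have h1 := h.confTerm_ge
  have h2 := h.l_sq
  have h3 := h.s_sq
  have hd : (1 : ℝ) ≤ d := by exact_mod_cast h.one_le_d
  have hn : (1 : ℝ) ≤ n := by exact_mod_cast h.one_le_n
  have hl := h.l_pos
  have hs := h.s_pos
  have hnl : 0 ≤ l ^ 2 * n := by positivity
  have h4 : 1.46 * (d : ℝ) ^ 2 ≤ (n * l * s) ^ 2 := by
    have e : (n * l * s) ^ 2 = l ^ 2 * n * (s ^ 2 * n) := by ring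
    rw [e, h3]
    nlinarith
  refine le_of_sq_le_sq ?_ (by positivity)
  nlinarith

lemma log_four_le : Real.log 4 ≤ 1.3863 := by
  have : Real.log 4 = 2 * Real.log 2 := by
    rw [show (4 : ℝ) = 2 ^ 2 by norm_num, Real.log_pow]; norm_num
  have := Real.log_two_lt_d9
  linarith

lemma log_inv_quarter {d : ℕ} {ε : ℝ} (hε : 0 < ε) :
    Real.log (ε / 4)⁻¹ = confTerm d ε - 0.73 * d + Real.log 4 := by
  rw [inv_div, div_eq_mul_inv, Real.log_mul (by norm_num) (by positivity)]
  unfold confTerm; ring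

/-- Upper bound for the empirical quadratic form, uniformly on the unit sphere. The last term
accounts for the heavy tails of `W`. -/
lemma empirical_upper [IsProbabilityMeasure ν] (h : MomentBound ν W k) {n : ℕ} {ε l s : ℝ}
    (hs : Scales d n k ε l s) :
    ∃ B : Set (Fin n → Ω), MeasurableSet B ∧
      (Measure.pi fun _ : Fin n => ν) Bᶜ ≤ ENNReal.ofReal (ε / 4) ∧
      ∀ z ∈ B, ∀ u : EuclideanSpace ℝ (Fin d), ‖u‖ = 1 → ∫ z, inner ℝ u (W z) ^ 2 ∂ν = 1 →
        (∑ i, inner ℝ u (W (z i)) ^ 2) / n ≤ 1 + (k - 1) * l + 9 * s +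
          (∑ i, min ((l * ‖W (z i)‖ ^ 2) ^ 2) ((l * ‖W (z i)‖ ^ 2) ^ 3)) / (3 * l * n) := by
  have hl := hs.l_pos
  have hs0 := hs.s_pos
  have hε := hs.eps_pos
  have hd : (1 : ℝ) ≤ d := by exact_mod_cast hs.one_le_d
  have hn : (1 : ℝ) ≤ n := by exact_mod_cast hs.one_le_n
  have hk := hs.one_lt_k
  set v := n * l * s with hv
  have hdim : 1.208 * (d : ℝ) ≤ v := hs.dim_le
  have hv0 : 0 < v := by positivity
  -- the perturbation `N(√β u, I)` with `β = 16 n l s` balances the entropy `β / 2` and the variance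
  have hβ : 18 ≤ 16 * v := by linarith
  have hβ0 : 0 < 16 * v := by linarith
  have hTm := measurable_centeredSq_comp h.measurable (16 * v)
  obtain ⟨B, hB, hBδ, hBz⟩ := pacBayes_centeredSq (ν := ν) n h.measurable h.integrable hβ0 l
    (l ^ 2 / 2) (r := fun _ => 0) (integrable_zero _ _ _) measurable_const
    (fun g z => Real.log (1 + l * centeredSq (16 * v) g (W z) +
        (l * centeredSq (16 * v) g (W z)) ^ 2 / 2))
    (by
      have : Measurable fun p : EuclideanSpace ℝ (Fin d) × Ω =>
        1 + l * centeredSq (16 * v) p.1 (W p.2) + (l * centeredSq (16 * v) p.1 (W p.2)) ^ 2 / 2 :=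
        ((hTm.const_mul l).const_add 1).add (((hTm.const_mul l).pow_const 2).div_const 2)
      exact this.log)
    (fun g z => by
      rw [Real.exp_log (log_quad_pos _)]
      apply le_of_eq; ring) (δ := ε / 4) (by positivity)
  refine ⟨B, hB, hBδ, fun z hz u hu hu1 => ?_⟩
  have hmain := hBz z hz u hu fun i => (integral_log_quad_ge hβ hl u (W (z i)) hu).1
  have hlow := Finset.sum_le_sum fun i (_ : i ∈ Finset.univ) =>
    (integral_log_quad_ge hβ hl u (W (z i)) hu).2
  have hcost : ∫ z, (l * (inner ℝ u (W z) ^ 2 - 1) + l ^ 2 / 2 * averagedSq (16 * v) u (W z) + 0) ∂ν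
      ≤ l ^ 2 / 2 * (k - 1 + 4 * k * d / (16 * v) + 2 * k * d ^ 2 / (16 * v) ^ 2) := by
    have i1 := integrable_inner_sq h.measurable h.integrable_sq u
    have i2 : Integrable (fun z => l * (inner ℝ u (W z) ^ 2 - 1)) ν :=
      (i1.sub (integrable_const _)).const_mul l
    have i3 := (integrable_averagedSq h.measurable h.integrable (16 * v) u).const_mul (l ^ 2 / 2)
    simp_rw [add_zero]
    rw [integral_add i2 i3, integral_const_mul, integral_const_mul,
      integral_sub i1 (integrable_const _), hu1]
    have := h.averagedSq_le hβ0 hu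
    rw [hu1] at this
    simp only [integral_const, probReal_univ, one_smul, sub_self, mul_zero, add_zero,
      zero_add] at this ⊢
    exact mul_le_mul_of_nonneg_left this (by positivity)
  rw [log_inv_quarter (d := d) hε] at hmain
  -- all the terms, in units of `n l`
  have hvsq : l ^ 2 * n * (k * d) = v * v := by rw [← hs.s_sq, hv]; ring
  have e1 : n * (l ^ 2 / 2 * (k - 1 + 4 * k * d / (16 * v) + 2 * k * d ^ 2 / (16 * v) ^ 2)) =
      confTerm d ε + v / 8 + d / 256 := by
    have : n * (l ^ 2 / 2 * (k - 1 + 4 * k * d / (16 * v) + 2 * k * d ^ 2 / (16 * v) ^ 2)) =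
      (k - 1) * l ^ 2 * n / 2 + (l ^ 2 * n * (k * d)) * (1 / (8 * v)) +
        (l ^ 2 * n * (k * d)) * (d / (256 * (v * v))) := by
      field_simp
      ring
    rw [this, hvsq, hs.l_sq]
    field_simp
  have hcost' := mul_le_mul_of_nonneg_left hcost (show (0 : ℝ) ≤ n by linarith)
  rw [e1] at hcost'
  rw [Finset.sum_sub_distrib, ← Finset.mul_sum, Finset.sum_sub_distrib, ← Finset.sum_div] at hlow
  simp only [Finset.sum_const, Finset.card_univ, Fintype.card_fin, nsmul_eq_mul, mul_one] at hlow
  set M := ∑ i, min ((l * ‖W (z i)‖ ^ 2) ^ 2) ((l * ‖W (z i)‖ ^ 2) ^ 3)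
  set N := ∑ i, inner ℝ u (W (z i)) ^ 2
  have hl4 := log_four_le
  have hfin : l * (N - n) - M / 3 ≤ 2 * confTerm d ε + 9 * v := by
    linarith
  rw [← hs.l_sq] at hfin
  have e2 : (N : ℝ) / n - 1 - M / (3 * l * n) = (l * (N - n) - M / 3) / (l * n) := by
    field_simp
  have e3 : (k - 1) * l + 9 * s = ((k - 1) * l ^ 2 * n + 9 * v) / (l * n) := by
    rw [hv]; field_simp
  have : (l * (N - n) - M / 3) / (l * n) ≤ ((k - 1) * l ^ 2 * n + 9 * v) / (l * n) := by
    gcongr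
  linarith

/-! ### The lower bound for the empirical quadratic form -/

lemma MomentBound.truncate [IsFiniteMeasure ν] (h : MomentBound ν W k) (R : ℝ) :
    MomentBound ν (normTruncate W R) k := by
  have hm : Measurable (normTruncate W R) :=
    Measurable.ite (measurableSet_le (by have := h.measurable; fun_prop) measurable_const)
      h.measurable measurable_const
  have hi : Integrable (fun z => ‖normTruncate W R z‖ ^ 4) ν := by
    refine h.integrable.mono' (by fun_prop) (ae_of_all _ fun z => ?_)
    rw [Real.norm_eq_abs, abs_of_nonneg (by positivity)]
    rcases normTruncate_cases W R z with ⟨-, e⟩ | ⟨-, e⟩ <;> rw [e]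
    simp
  refine ⟨hm, hi, fun u => ?_, fun u => ?_⟩
  · exact (integral_mono (integrable_inner_sq hm (integrable_norm_sq_of_four hm hi) u)
      (integrable_inner_sq h.measurable h.integrable_sq u)
      fun z => inner_normTruncate_pow_le W R u z even_two two_ne_zero).trans (h.sq_le u)
  · exact (integral_mono (integrable_inner_four hm hi u)
      (integrable_inner_four h.measurable h.integrable u)
      fun z => inner_normTruncate_pow_le W R u z (by decide) (by norm_num)).trans (h.four_le u)

lemma MomentBound.integral_truncate_ge [IsFiniteMeasure ν] (h : MomentBound ν W k) {R : ℝ}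
    (hR : 0 < R) {u : EuclideanSpace ℝ (Fin d)} (hu : ‖u‖ = 1) :
    ∫ z, inner ℝ u (W z) ^ 2 ∂ν - k * d / R ≤
      ∫ z, inner ℝ u (normTruncate W R z) ^ 2 ∂ν := by
  have h1 := integrable_inner_sq h.measurable h.integrable_sq u
  have h2 := (integrable_inner_sq_mul h.measurable h.integrable u).div_const R
  have h3 := integrable_inner_sq (h.truncate R).measurable (h.truncate R).integrable_sq u
  have h4 : ∫ z, (inner ℝ u (W z) ^ 2 - inner ℝ u (W z) ^ 2 * ‖W z‖ ^ 2 / R) ∂ν ≤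
      ∫ z, inner ℝ u (normTruncate W R z) ^ 2 ∂ν := by
    refine integral_mono (h1.sub h2) h3 fun z => ?_
    simp only
    rcases normTruncate_cases W R z with ⟨-, e⟩ | ⟨hz, e⟩ <;> rw [e]
    · have : 0 ≤ inner ℝ u (W z) ^ 2 * ‖W z‖ ^ 2 / R := by positivity
      linarith
    · rw [inner_zero_right, zero_pow two_ne_zero, mul_div_assoc]
      have : 1 ≤ ‖W z‖ ^ 2 / R := by rw [le_div_iff₀ hR]; linarith
      nlinarith [sq_nonneg (inner ℝ u (W z))]
  rw [integral_sub h1 h2, integral_div] at h4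
  have h5 := h.inner_sq_mul_norm_sq_le hu
  have : (∫ z, inner ℝ u (W z) ^ 2 * ‖W z‖ ^ 2 ∂ν) / R ≤ k * d / R := by gcongr
  linarith

/-- The exponential moment used for the lower bound: the variable `-l T` is bounded above when the
norm of `w` is bounded, and the cubic remainder only involves the norm of `w`. -/
lemma exp_neg_centeredSq_le {β l e : ℝ} (hβ : 0 < β) (hl : 0 < l) (g w : EuclideanSpace ℝ (Fin d))
    (he : l * (‖w‖ ^ 2 / β) ≤ e) (hle : l + e ≤ 2) :
    Real.exp (-l * centeredSq β g w) ≤ 1 + ((-l) * centeredSq β g w +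
      (l ^ 2 * (1 / 2 + 0.3 * l)) * centeredSq β g w ^ 2 +
        0.3 * (2 * l ^ 3 * (‖w‖ ^ 2 / β) + 2 * e * l ^ 2 * (‖w‖ ^ 2 / β) ^ 2)) := by
  set b := ‖w‖ ^ 2 / β with hb
  have hb0 : 0 ≤ b := by positivity
  set T := centeredSq β g w with hT
  have hTle : -l * T ≤ l * (1 + b) := by
    have : 0 ≤ inner ℝ g w ^ 2 / β := by positivity
    simp only [hT, centeredSq]
    nlinarith
  have h1 := exp_le_quad_add_cube (y := -l * T) (by nlinarith)
  set y := max (-l * T) 0 with hy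
  have hy0 : 0 ≤ y := le_max_right _ _
  have hy1 : y ≤ l * (1 + b) := max_le hTle (by positivity)
  have hysq : y ^ 2 ≤ (l * T) ^ 2 := by
    rw [hy]
    rcases le_total (-l * T) 0 with h | h
    · rw [max_eq_right h]; nlinarith [sq_nonneg (l * T)]
    · rw [max_eq_left h]; nlinarith
  have hcube : y ^ 3 ≤ l * (l * T) ^ 2 + (2 * l ^ 3 * b + 2 * e * l ^ 2 * b ^ 2) := by
    have s1 : y ^ 3 ≤ y ^ 2 * (l * (1 + b)) := by
      have : y ^ 3 = y ^ 2 * y := by ring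
      rw [this]; exact mul_le_mul_of_nonneg_left hy1 (sq_nonneg _)
    have s2 : y ^ 2 * l ≤ (l * T) ^ 2 * l := mul_le_mul_of_nonneg_right hysq hl.le
    have s3 : y ^ 2 * (l * b) ≤ (l * (1 + b)) ^ 2 * (l * b) :=
      mul_le_mul_of_nonneg_right (pow_le_pow_left₀ hy0 hy1 2) (by positivity)
    have s4 : (l * (1 + b)) ^ 2 * (l * b) ≤ 2 * l ^ 3 * b + 2 * e * l ^ 2 * b ^ 2 := by
      have t1 : (1 + b) ^ 2 ≤ 2 + 2 * b ^ 2 := by nlinarith [sq_nonneg (1 - b)]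
      have t2 : (l * (1 + b)) ^ 2 * (l * b) = l ^ 3 * b * (1 + b) ^ 2 := by ring
      have t3 : l ^ 3 * b * (1 + b) ^ 2 ≤ l ^ 3 * b * (2 + 2 * b ^ 2) :=
        mul_le_mul_of_nonneg_left t1 (by positivity)
      have t4 : (l * b) * (2 * l ^ 2 * b ^ 2) ≤ e * (2 * l ^ 2 * b ^ 2) :=
        mul_le_mul_of_nonneg_right he (by positivity)
      nlinarith
    nlinarith
  nlinarith

/-- Expectation of the quadratic polynomial used for the lower bound. -/
lemma MomentBound.integral_lower_le [IsProbabilityMeasure ν] {V : Ω → EuclideanSpace ℝ (Fin d)}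
    (hm : MomentBound ν V k) {β l e ρ : ℝ} (hβ : 0 < β) (hl : 0 < l) (he : 0 ≤ e)
    {u : EuclideanSpace ℝ (Fin d)} (hu : ‖u‖ = 1)
    (htr : 1 - ρ ≤ ∫ z, inner ℝ u (V z) ^ 2 ∂ν) :
    Integrable (fun z => 0.3 * (2 * l ^ 3 * (‖V z‖ ^ 2 / β) +
        2 * e * l ^ 2 * (‖V z‖ ^ 2 / β) ^ 2)) ν ∧
    ∫ z, (-l * (inner ℝ u (V z) ^ 2 - 1) +
      l ^ 2 * (1 / 2 + 0.3 * l) * averagedSq β u (V z) +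
      0.3 * (2 * l ^ 3 * (‖V z‖ ^ 2 / β) + 2 * e * l ^ 2 * (‖V z‖ ^ 2 / β) ^ 2)) ∂ν ≤
      l * ρ + l ^ 2 * (1 / 2 + 0.3 * l) * (k - 1 + 2 * ρ +
        4 * k * d / β + 2 * k * d ^ 2 / β ^ 2) +
      0.3 * (2 * l ^ 3 * (d / β) + 2 * e * l ^ 2 * (k * d ^ 2 / β ^ 2)) := by
  have i1 := integrable_inner_sq hm.measurable hm.integrable_sq u
  have i2 : Integrable (fun z => -l * (inner ℝ u (V z) ^ 2 - 1)) ν :=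
    (i1.sub (integrable_const _)).const_mul (-l)
  have i3 := (integrable_averagedSq hm.measurable hm.integrable β u).const_mul
    (l ^ 2 * (1 / 2 + 0.3 * l))
  have i4 : Integrable (fun z => -l * (inner ℝ u (V z) ^ 2 - 1) +
    l ^ 2 * (1 / 2 + 0.3 * l) * averagedSq β u (V z)) ν := i2.add i3
  have i5 := (hm.integrable_sq.div_const β).const_mul (2 * l ^ 3)
  have i6 : Integrable (fun z => 2 * e * l ^ 2 * (‖V z‖ ^ 2 / β) ^ 2) ν := by
    simp_rw [div_pow, ← pow_mul]
    exact (hm.integrable.div_const (β ^ 2)).const_mul (2 * e * l ^ 2)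
  have i7 : Integrable (fun z => 0.3 * (2 * l ^ 3 * (‖V z‖ ^ 2 / β) +
      2 * e * l ^ 2 * (‖V z‖ ^ 2 / β) ^ 2)) ν := (i5.add i6).const_mul 0.3
  refine ⟨i7, ?_⟩
  rw [integral_add i4 i7, integral_add i2 i3, integral_const_mul, integral_const_mul,
    integral_sub i1 (integrable_const _), integral_const_mul, integral_add i5 i6,
    integral_const_mul, integral_const_mul, integral_div]
  have e6 : ∫ z, (‖V z‖ ^ 2 / β) ^ 2 ∂ν = (∫ z, ‖V z‖ ^ 4 ∂ν) / β ^ 2 := by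
    simp_rw [div_pow, ← pow_mul]
    rw [integral_div]
  rw [e6]
  have b1 := hm.averagedSq_le hβ hu
  have b2 := hm.norm_sq_le
  have b3 := hm.norm_four_le
  simp only [integral_const, probReal_univ, one_smul]
  refine add_le_add (add_le_add ?_ ?_) ?_
  · nlinarith
  · refine mul_le_mul_of_nonneg_left ?_ (by positivity)
    linarith
  · refine mul_le_mul_of_nonneg_left (add_le_add ?_ ?_) (by norm_num)
    · exact mul_le_mul_of_nonneg_left (div_le_div_of_nonneg_right b2 hβ.le) (by positivity)
    · exact mul_le_mul_of_nonneg_left (div_le_div_of_nonneg_right b3 (by positivity))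
        (by positivity)

/-- The cost of the lower bound, in units of `n l`. -/
lemma Scales.lower_cost_le {n : ℕ} {ε l s : ℝ} (hs : Scales d n k ε l s) {v R : ℝ}
    (hv : v = n * l * s) (hR : R = 2 * n * s) :
    n * (l * (k * d / R) + l ^ 2 * (1 / 2 + 0.3 * l) * (k - 1 + 2 * (k * d / R) +
        4 * k * d / (8 * v) + 2 * k * d ^ 2 / (8 * v) ^ 2) +
      0.3 * (2 * l ^ 3 * (d / (8 * v)) + 2 * (1 / 4) * l ^ 2 * (k * d ^ 2 / (8 * v) ^ 2))) ≤
      v / 2 + (1 / 2 + 0.3 * l) * (2 * confTerm d ε + l * v + v / 2 + d / 32) +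
        0.3 * (l * v / 4 + d / 128) := by
  have hl := hs.l_pos
  have hs0 := hs.s_pos
  have hd : (1 : ℝ) ≤ d := by exact_mod_cast hs.one_le_d
  have hn : (1 : ℝ) ≤ n := by exact_mod_cast hs.one_le_n
  have hk := hs.one_lt_k
  have hv0 : 0 < v := by rw [hv]; positivity
  have hR0 : 0 < R := by rw [hR]; positivity
  have hvsq : l ^ 2 * n * (k * d) = v * v := by rw [← hs.s_sq, hv]; ring
  have hlv : l * (k * d / R) * n = v / 2 := by
    rw [hR, hv, ← hs.s_sq]; field_simp
  have f1 : n * (l ^ 2 * (k * d / R)) = l * v / 2 := by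
    calc n * (l ^ 2 * (k * d / R)) = l * (l * (k * d / R) * n) := by ring
      _ = _ := by rw [hlv]; ring
  have f2 : n * (l ^ 2 * (4 * k * d / (8 * v))) = v / 2 := by
    have : n * (l ^ 2 * (4 * k * d / (8 * v))) = (l ^ 2 * n * (k * d)) / (2 * v) := by
      field_simp; ring
    rw [this, hvsq]; field_simp
  have f3 : n * (l ^ 2 * (2 * k * d ^ 2 / (8 * v) ^ 2)) = d / 32 := by
    have : n * (l ^ 2 * (2 * k * d ^ 2 / (8 * v) ^ 2)) =
        (l ^ 2 * n * (k * d)) * (d / (32 * (v * v))) := by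
      field_simp; ring
    rw [this, hvsq]; field_simp
  have f4 : n * (2 * l ^ 3 * (d / (8 * v))) ≤ l * v / 4 := by
    have e : n * (2 * l ^ 3 * (d / (8 * v))) = l / (4 * v) * (l ^ 2 * n * d) := by
      field_simp; ring
    have : l ^ 2 * n * d ≤ v * v := by
      rw [← hvsq]
      have : (d : ℝ) ≤ k * d := by nlinarith
      gcongr
    calc _ = l / (4 * v) * (l ^ 2 * n * d) := e
      _ ≤ l / (4 * v) * (v * v) := by gcongr
      _ = _ := by field_simp
  have f5 : n * (2 * (1 / 4) * l ^ 2 * (k * d ^ 2 / (8 * v) ^ 2)) = d / 128 := by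
    have : n * (2 * (1 / 4) * l ^ 2 * (k * d ^ 2 / (8 * v) ^ 2)) =
        (l ^ 2 * n * (k * d)) * (d / (128 * (v * v))) := by
      field_simp; norm_num
    rw [this, hvsq]; field_simp
  have f6 := hs.l_sq
  have e : n * (l * (k * d / R) + l ^ 2 * (1 / 2 + 0.3 * l) * (k - 1 + 2 * (k * d / R) +
      4 * k * d / (8 * v) + 2 * k * d ^ 2 / (8 * v) ^ 2) +
    0.3 * (2 * l ^ 3 * (d / (8 * v)) + 2 * (1 / 4) * l ^ 2 * (k * d ^ 2 / (8 * v) ^ 2))) =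
    l * (k * d / R) * n + (1 / 2 + 0.3 * l) * ((k - 1) * l ^ 2 * n +
      2 * (n * (l ^ 2 * (k * d / R))) + n * (l ^ 2 * (4 * k * d / (8 * v))) +
      n * (l ^ 2 * (2 * k * d ^ 2 / (8 * v) ^ 2))) +
    0.3 * (n * (2 * l ^ 3 * (d / (8 * v))) +
      n * (2 * (1 / 4) * l ^ 2 * (k * d ^ 2 / (8 * v) ^ 2))) := by ring
  rw [e, hlv, f1, f2, f3, f5, f6]
  have : 2 * (l * v / 2) = l * v := by ring
  rw [this]
  linarith

/-- Lower bound for the empirical quadratic form, uniformly on the unit sphere. -/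
lemma empirical_lower [IsProbabilityMeasure ν] (h : MomentBound ν W k) {n : ℕ} {ε l s : ℝ}
    (hs : Scales d n k ε l s) (hl3 : l ^ 2 < 3) :
    ∃ B : Set (Fin n → Ω), MeasurableSet B ∧
      (Measure.pi fun _ : Fin n => ν) Bᶜ ≤ ENNReal.ofReal (ε / 4) ∧
      ∀ z ∈ B, ∀ u : EuclideanSpace ℝ (Fin d), ‖u‖ = 1 → ∫ z, inner ℝ u (W z) ^ 2 ∂ν = 1 →
        1 - ((k - 1) * l + 0.3 * l * ((k - 1) * l) + 8 * s) ≤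
          (∑ i, inner ℝ u (W (z i)) ^ 2) / n := by
  have hl := hs.l_pos
  have hs0 := hs.s_pos
  have hε := hs.eps_pos
  have hd : (1 : ℝ) ≤ d := by exact_mod_cast hs.one_le_d
  have hn : (1 : ℝ) ≤ n := by exact_mod_cast hs.one_le_n
  have hk := hs.one_lt_k
  set v := n * l * s with hv
  have hdim : 1.208 * (d : ℝ) ≤ v := hs.dim_le
  have hv0 : 0 < v := by positivity
  have hl2 : l ≤ 1.7321 := by nlinarith
  -- with `β = 8 n l s` and the truncation level `R = 2 n s` for the squared norm, the exponent
  -- stays below `l + l R / β = l + 1/4`, and the truncation costs `k d / R = s / 2`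
  have hβ0 : 0 < 8 * v := by linarith
  set R := 2 * n * s with hR
  have hR0 : 0 < R := by positivity
  set V := normTruncate W R with hV
  have hm : MomentBound ν V k := h.truncate R
  have hVm := hm.measurable
  have hTm := measurable_centeredSq_comp hVm (8 * v)
  have he : ∀ z, l * (‖V z‖ ^ 2 / (8 * v)) ≤ 1 / 4 := by
    intro z
    have := norm_normTruncate_sq_le W hR0.le z
    calc l * (‖V z‖ ^ 2 / (8 * v)) ≤ l * (R / (8 * v)) := by gcongr
      _ = 1 / 4 := by rw [hR, hv]; field_simp; norm_num
  obtain ⟨u₀, hu₀⟩ : ∃ u : EuclideanSpace ℝ (Fin d), ‖u‖ = 1 :=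
    ⟨EuclideanSpace.single ⟨0, hs.one_le_d⟩ 1, by simp⟩
  have hr := (hm.integral_lower_le hβ0 hl (e := 1 / 4) (by norm_num) hu₀
    (ρ := 1 - ∫ z, inner ℝ u₀ (V z) ^ 2 ∂ν) (by simp)).1
  obtain ⟨B, hB, hBδ, hBz⟩ := pacBayes_centeredSq (ν := ν) n hm.measurable hm.integrable hβ0 (-l)
    (l ^ 2 * (1 / 2 + 0.3 * l)) hr (by fun_prop)
    (fun g z => -l * centeredSq (8 * v) g (V z)) (hTm.const_mul (-l))
    (fun g z => exp_neg_centeredSq_le hβ0 hl g (V z) (he z) (by linarith))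
    (δ := ε / 4) (by positivity)
  refine ⟨B, hB, hBδ, fun z hz u hu hu1 => ?_⟩
  have hmain := hBz z hz u hu fun i => by
    simpa using (integrable_centeredSq_pow hβ0 u (V (z i)) 1).const_mul (-l)
  simp_rw [integral_const_mul, integral_centeredSq hβ0] at hmain
  rw [← Finset.mul_sum, Finset.sum_sub_distrib] at hmain
  simp only [Finset.sum_const, Finset.card_univ, Fintype.card_fin, nsmul_eq_mul, mul_one] at hmain
  have htr := h.integral_truncate_ge hR0 hu
  rw [hu1, ← hV] at htr
  have hcost := (hm.integral_lower_le hβ0 hl (e := 1 / 4) (by norm_num) hu htr).2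
  have hcost' := mul_le_mul_of_nonneg_left hcost (show (0 : ℝ) ≤ n by linarith)
  rw [log_inv_quarter (d := d) hε] at hmain
  have hsum := hs.lower_cost_le hv hR
  have f6 := hs.l_sq
  set L := confTerm d ε
  have hl4 := log_four_le
  have hLd := hs.confTerm_ge
  set N := ∑ i, inner ℝ u (V (z i)) ^ 2
  have hlv2 : l * v ≤ 1.7321 * v := by gcongr
  have hllv : l * (l * v) ≤ 1.7321 * (1.7321 * v) := by gcongr
  have hld : l * d ≤ 1.7321 * d := by gcongr
  have hfin : -l * (N - n) ≤ 2 * L + 0.6 * l * L + 8 * v := by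
    have : (1 / 2 + 0.3 * l) * (2 * L + l * v + v / 2 + d / 32) =
      L + 0.6 * l * L + 0.65 * (l * v) + v / 4 + d / 64 + 0.3 * (l * (l * v)) +
        0.3 / 32 * (l * d) := by ring
    linarith
  have hN : N ≤ ∑ i, inner ℝ u (W (z i)) ^ 2 :=
    Finset.sum_le_sum fun i _ => inner_normTruncate_pow_le W R u (z i) even_two two_ne_zero
  have hN2 : N / n ≤ (∑ i, inner ℝ u (W (z i)) ^ 2) / n := by gcongr
  refine le_trans ?_ hN2
  have e2 : 1 - N / n = (-l * (N - n)) / (l * n) := by field_simp; ring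
  have e3 : (k - 1) * l + 0.3 * l * ((k - 1) * l) + 8 * s =
      (2 * L + 0.6 * l * L + 8 * v) / (l * n) := by
    have : 2 * L + 0.6 * l * L + 8 * v =
      (k - 1) * l ^ 2 * n + 0.3 * l * ((k - 1) * l ^ 2 * n) + 8 * v := by rw [f6]; ring
    rw [this, hv]; field_simp
  have : (-l * (N - n)) / (l * n) ≤ (2 * L + 0.6 * l * L + 8 * v) / (l * n) := by gcongr
  linarith

end

/-! ### A one-sided deviation inequality for means of nonnegative variables -/

section

variable {Ω : Type*} [MeasurableSpace Ω] {ν : Measure Ω} [IsProbabilityMeasure ν]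

lemma integral_eval_pi {n : ℕ} (f : Ω → ℝ) (hf : Measurable f) (i : Fin n) :
    ∫ z, f (z i) ∂(Measure.pi fun _ : Fin n => ν) = ∫ x, f x ∂ν := by
  have h := (measurePreserving_eval (fun _ : Fin n => ν) i)
  have h2 := integral_map (μ := Measure.pi fun _ : Fin n => ν) h.measurable.aemeasurable
    (f := f) hf.aestronglyMeasurable
  rw [h.map_eq] at h2
  exact h2.symm

lemma integrable_eval_pi {n : ℕ} {f : Ω → ℝ} (hf : Integrable f ν) (i : Fin n) :
    Integrable (fun z => f (z i)) (Measure.pi fun _ : Fin n => ν) :=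
  integrable_comp_eval hf

lemma integral_sum_sub_sq_le {n : ℕ} {g : Ω → ℝ} (hg : Measurable g) (hg2 : MemLp g 2 ν) :
    Integrable (fun z => (∑ i, (g (z i) - ∫ x, g x ∂ν)) ^ 2) (Measure.pi fun _ : Fin n => ν) ∧
    ∫ z, (∑ i, (g (z i) - ∫ x, g x ∂ν)) ^ 2 ∂(Measure.pi fun _ : Fin n => ν) ≤
      n * ∫ x, g x ^ 2 ∂ν := by
  set Q := Measure.pi fun _ : Fin n => ν
  have hmp : ∀ i : Fin n, MeasurePreserving (fun z : Fin n → Ω => z i) Q ν :=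
    fun i => measurePreserving_eval (fun _ : Fin n => ν) i
  have hL : ∀ i : Fin n, MemLp (fun z : Fin n → Ω => g (z i)) 2 Q :=
    fun i => hg2.comp_measurePreserving (hmp i)
  have hind : iIndepFun (fun (i : Fin n) (z : Fin n → Ω) => g (z i)) Q :=
    iIndepFun_pi (μ := fun _ : Fin n => ν) (X := fun _ => g) fun i => hg.aemeasurable
  have hvar := IndepFun.variance_sum (s := Finset.univ) (fun i _ => hL i)
    (fun i _ j _ hij => hind.indepFun hij)
  have hS : MemLp (∑ i, fun z : Fin n → Ω => g (z i)) 2 Q := memLp_finsetSum' _ fun i _ => hL i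
  have hmean : ∫ z, (∑ i, fun z : Fin n → Ω => g (z i)) z ∂Q = n * ∫ x, g x ∂ν := by
    simp only [Finset.sum_apply]
    rw [integral_finsetSum _ fun i _ => (hL i).integrable (by norm_num)]
    simp_rw [Q, integral_eval_pi g hg]
    simp
  have hvi : ∀ i : Fin n, Var[fun z : Fin n → Ω => g (z i); Q] ≤ ∫ x, g x ^ 2 ∂ν := by
    intro i
    refine (variance_le_expectation_sq (hL i).aestronglyMeasurable).trans (le_of_eq ?_)
    exact integral_eval_pi (ν := ν) (fun x => g x ^ 2) (by fun_prop) i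
  have e : ∀ z : Fin n → Ω, ∑ i, (g (z i) - ∫ x, g x ∂ν) =
      (∑ i, fun z : Fin n → Ω => g (z i)) z - n * ∫ x, g x ∂ν := by
    intro z; simp [Finset.sum_sub_distrib]
  simp_rw [e]
  constructor
  · exact (hS.sub (memLp_const _)).integrable_sq
  · rw [← hmean, ← variance_eq_integral hS.aemeasurable, hvar]
    calc _ ≤ ∑ _i : Fin n, ∫ x, g x ^ 2 ∂ν := Finset.sum_le_sum fun i _ => hvi i
      _ = _ := by simp

/-- A function which is quadratic near `0`, then linear with slope `q`, lies below the power `q`: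
its linear part is tangent to the power at `1`. -/
lemma quad_linear_le_rpow {q x : ℝ} (hq1 : 1 < q) (hq2 : q ≤ 2) (hx : 0 ≤ x) :
    q ^ 2 / (4 * (q - 1)) * min x (2 * (q - 1) / q) ^ 2 + q * (x - min x (2 * (q - 1) / q)) ≤
      x ^ q := by
  have hq0 : 0 < q - 1 := by linarith
  set a := 2 * (q - 1) / q with ha
  have ha0 : 0 < a := by positivity
  have hca : q ^ 2 / (4 * (q - 1)) * a ^ 2 = q - 1 := by
    rw [ha]; field_simp; ring
  have hqa : q * a = 2 * (q - 1) := by rw [ha]; field_simp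
  have hB : ∀ y : ℝ, 0 ≤ y → q * y - (q - 1) ≤ y ^ q := by
    intro y hy
    have := one_add_mul_self_le_rpow_one_add (s := y - 1) (by linarith) hq1.le
    rw [add_sub_cancel] at this
    linarith
  rcases le_total x a with h | h
  · rw [min_eq_left h, sub_self, mul_zero, add_zero]
    have h1 := hB a ha0.le
    have h2 : q - 1 ≤ a ^ q := by linarith
    have h3 : (x / a) ^ (2 : ℝ) ≤ (x / a) ^ q := by
      rcases hx.eq_or_lt with rfl | hx0
      · simp [Real.zero_rpow (by linarith : q ≠ 0)]
      · exact Real.rpow_le_rpow_of_exponent_ge (by positivity) ((div_le_one ha0).2 h) hq2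
    have h4 : q ^ 2 / (4 * (q - 1)) * x ^ 2 = (q - 1) * (x / a) ^ (2 : ℝ) := by
      have e : x ^ 2 = a ^ 2 * (x / a) ^ 2 := by field_simp
      rw [Real.rpow_two, e, ← mul_assoc, hca]
    rw [h4]
    calc (q - 1) * (x / a) ^ (2 : ℝ) ≤ a ^ q * (x / a) ^ q :=
          mul_le_mul h2 h3 (by positivity) (by positivity)
      _ = x ^ q := by
          rw [← Real.mul_rpow ha0.le (by positivity)]; congr 1; field_simp
  · rw [min_eq_right h, hca]
    have := hB x hx
    linarith

lemma one_le_quad_add_linear {q A B : ℝ} (hq1 : 1 < q) (hB : 0 ≤ B) (h : 1 ≤ A + B) :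
    1 ≤ q ^ 2 / (4 * (q - 1)) * A ^ 2 + q * B := by
  have hq0 : 0 < q - 1 := by linarith
  have hc : 0 < q ^ 2 / (4 * (q - 1)) := by positivity
  rcases le_total 1 B with h1 | h1
  · nlinarith [mul_nonneg hc.le (sq_nonneg A)]
  · have h2 : (1 - B) ^ 2 ≤ A ^ 2 := pow_le_pow_left₀ (by linarith) (by linarith) 2
    have h3 : q ^ 2 / (4 * (q - 1)) * (1 - B) ^ 2 + q * B - 1 =
        (q * (1 - B) - 2 * (q - 1)) ^ 2 / (4 * (q - 1)) := by
      field_simp; ring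
    have h4 : 0 ≤ (q * (1 - B) - 2 * (q - 1)) ^ 2 / (4 * (q - 1)) := by positivity
    have := mul_le_mul_of_nonneg_left h2 hc.le
    linarith

lemma integrable_of_rpow {f : Ω → ℝ} (hf0 : ∀ x, 0 ≤ f x) (hf : Measurable f) {q : ℝ}
    (hq1 : 1 ≤ q) (hfq : Integrable (fun x => f x ^ q) ν) : Integrable f ν := by
  refine ((integrable_const (1 : ℝ)).add hfq).mono' hf.aestronglyMeasurable
    (ae_of_all _ fun x => ?_)
  rw [Real.norm_eq_abs, abs_of_nonneg (hf0 x)]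
  simp only [Pi.add_apply]
  rcases le_total (f x) 1 with h | h
  · linarith [Real.rpow_nonneg (hf0 x) q]
  · linarith [Real.self_le_rpow_of_one_le h hq1]

/-- The normalized form of the deviation inequality. The truncation level and the weights are those
for which the function bounding the two parts is dominated by `x ^ q`, with tangency. -/
lemma measure_sum_sub_ge_le {n : ℕ} {f : Ω → ℝ} (hf0 : ∀ x, 0 ≤ f x) (hf : Measurable f) {q : ℝ}
    (hq1 : 1 ≤ q) (hq2 : q ≤ 2) (hfq : Integrable (fun x => f x ^ q) ν) :
    (Measure.pi fun _ : Fin n => ν).real {z | 1 ≤ ∑ i, (f (z i) - ∫ x, f x ∂ν)} ≤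
      n * ∫ x, f x ^ q ∂ν := by
  set Q := Measure.pi fun _ : Fin n => ν
  have hfi := integrable_of_rpow hf0 hf hq1 hfq
  have key : ∀ Y : (Fin n → Ω) → ℝ, Integrable Y Q → (∀ z, 0 ≤ Y z) →
      (∀ z, 1 ≤ ∑ i, (f (z i) - ∫ x, f x ∂ν) → 1 ≤ Y z) →
      Q.real {z | 1 ≤ ∑ i, (f (z i) - ∫ x, f x ∂ν)} ≤ ∫ z, Y z ∂Q := by
    intro Y hY hY0 hY1
    have := mul_meas_ge_le_integral_of_nonneg (ae_of_all _ hY0) hY 1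
    rw [one_mul] at this
    refine le_trans ?_ this
    exact measureReal_mono (fun z hz => hY1 z hz)
  rcases hq1.eq_or_lt with rfl | hq1'
  · have hint : Integrable (fun z : Fin n → Ω => ∑ i, f (z i)) Q :=
      integrable_finsetSum _ fun i _ => integrable_eval_pi hfi i
    refine (key (fun z => ∑ i, f (z i)) hint (fun z => Finset.sum_nonneg fun i _ => hf0 _)
      fun z hz => hz.trans ?_).trans (le_of_eq ?_)
    · refine Finset.sum_le_sum fun i _ => ?_
      have : 0 ≤ ∫ x, f x ∂ν := integral_nonneg hf0
      linarith
    · rw [integral_finsetSum _ fun i _ => integrable_eval_pi hfi i]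
      simp_rw [Real.rpow_one]
      rw [Finset.sum_congr rfl fun i _ => integral_eval_pi (ν := ν) f hf i]
      simp
  · have hq0 : 0 < q - 1 := by linarith
    set a := 2 * (q - 1) / q with ha
    have ha0 : 0 < a := by positivity
    set c := q ^ 2 / (4 * (q - 1)) with hc
    have hc0 : 0 < c := by positivity
    let g : Ω → ℝ := fun x => min (f x) a
    have hg : Measurable g := hf.min measurable_const
    have hg0 : ∀ x, 0 ≤ g x := fun x => le_min (hf0 x) ha0.le
    have hgL : MemLp g 2 ν := MemLp.of_bound hg.aestronglyMeasurable a (ae_of_all _ fun x => by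
      rw [Real.norm_eq_abs, abs_of_nonneg (hg0 x)]; exact min_le_right _ _)
    have hgi : Integrable g ν := hgL.integrable (by norm_num)
    have hh : Measurable (fun x => f x - g x) := hf.sub hg
    have hhi : Integrable (fun x => f x - g x) ν := hfi.sub hgi
    have hh0 : ∀ x, 0 ≤ f x - g x := fun x => sub_nonneg.2 (min_le_left _ _)
    obtain ⟨hA, hA'⟩ := integral_sum_sub_sq_le (n := n) hg hgL
    have hB : Integrable (fun z : Fin n → Ω => ∑ i, (f (z i) - g (z i))) Q :=
      integrable_finsetSum _ fun i _ => integrable_eval_pi hhi i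
    have hY : Integrable (fun z : Fin n → Ω => c * (∑ i, (g (z i) - ∫ x, g x ∂ν)) ^ 2 +
        q * ∑ i, (f (z i) - g (z i))) Q := (hA.const_mul c).add (hB.const_mul q)
    refine (key _ hY (fun z => ?_) fun z hz => ?_).trans ?_
    · have : 0 ≤ ∑ i, (f (z i) - g (z i)) := Finset.sum_nonneg fun i _ => hh0 _
      positivity
    · refine one_le_quad_add_linear hq1' (Finset.sum_nonneg fun i _ => hh0 _) (hz.trans ?_)
      rw [← Finset.sum_add_distrib]
      refine Finset.sum_le_sum fun i _ => ?_
      have : ∫ x, g x ∂ν ≤ ∫ x, f x ∂ν := integral_mono hgi hfi fun x => min_le_left _ _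
      linarith
    · rw [integral_add (hA.const_mul c) (hB.const_mul q), integral_const_mul, integral_const_mul,
        integral_finsetSum _ fun i _ => integrable_eval_pi hhi i]
      simp_rw [integral_eval_pi _ hh]
      simp only [Finset.sum_const, Finset.card_univ, Fintype.card_fin, nsmul_eq_mul]
      have h2 : ∫ x, (c * g x ^ 2 + q * (f x - g x)) ∂ν ≤ ∫ x, f x ^ q ∂ν :=
        integral_mono ((hgL.integrable_sq.const_mul c).add (hhi.const_mul q)) hfq
          fun x => quad_linear_le_rpow hq1' hq2 (hf0 x)
      rw [integral_add (hgL.integrable_sq.const_mul c) (hhi.const_mul q), integral_const_mul,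
        integral_const_mul] at h2
      have h3 := mul_le_mul_of_nonneg_left h2 (Nat.cast_nonneg (α := ℝ) n)
      have h4 := mul_le_mul_of_nonneg_left hA' hc0.le
      linarith

/-- One-sided deviations of the empirical mean of a nonnegative variable with a finite moment of
order `q ∈ [1, 2]`. -/
lemma mean_deviation {n : ℕ} (hn : 1 ≤ n) {f : Ω → ℝ} (hf0 : ∀ x, 0 ≤ f x) (hf : Measurable f)
    {q : ℝ} (hq1 : 1 ≤ q) (hq2 : q ≤ 2) (hfq : Integrable (fun x => f x ^ q) ν) {ε : ℝ}
    (hε : 0 < ε) :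
    ∃ B : Set (Fin n → Ω), MeasurableSet B ∧
      (Measure.pi fun _ : Fin n => ν) Bᶜ ≤ ENNReal.ofReal ε ∧
      ∀ z ∈ B, (∑ i, f (z i)) / n ≤ ∫ x, f x ∂ν +
        (∫ x, f x ^ q ∂ν) ^ (1 / q) / (ε ^ (1 / q) * (n : ℝ) ^ (1 - 1 / q)) := by
  set Q := Measure.pi fun _ : Fin n => ν
  have hn0 : (0 : ℝ) < n := by exact_mod_cast hn
  have hq0 : 0 < q := by linarith
  set mq := ∫ x, f x ^ q ∂ν with hmq
  have hmq0 : 0 ≤ mq := integral_nonneg fun x => Real.rpow_nonneg (hf0 x) q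
  refine ⟨{z | (∑ i, f (z i)) / n ≤ ∫ x, f x ∂ν +
        mq ^ (1 / q) / (ε ^ (1 / q) * (n : ℝ) ^ (1 - 1 / q))}, measurableSet_le
        (by fun_prop) measurable_const, ?_, fun z hz => hz⟩
  rcases hmq0.eq_or_lt with h0 | hpos
  · have hae : (fun x => f x ^ q) =ᵐ[ν] 0 :=
      (integral_eq_zero_iff_of_nonneg (fun x => Real.rpow_nonneg (hf0 x) q) hfq).1 h0.symm
    have hae2 : ∀ᵐ x ∂ν, f x = 0 := by
      filter_upwards [hae] with x hx
      exact (Real.rpow_eq_zero (hf0 x) hq0.ne').1 hx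
    have hall : ∀ᵐ z ∂Q, ∀ i, f (z i) = 0 := by
      rw [ae_all_iff]
      intro i
      exact (measurePreserving_eval (fun _ : Fin n => ν) i).quasiMeasurePreserving.ae hae2
    have : Q {z | (∑ i, f (z i)) / n ≤ ∫ x, f x ∂ν +
        mq ^ (1 / q) / (ε ^ (1 / q) * (n : ℝ) ^ (1 - 1 / q))}ᶜ = 0 := by
      rw [← mem_ae_iff]
      filter_upwards [hall] with z hz
      have h1 : 0 ≤ ∫ x, f x ∂ν := integral_nonneg hf0
      have h2 : 0 ≤ mq ^ (1 / q) / (ε ^ (1 / q) * (n : ℝ) ^ (1 - 1 / q)) := by positivity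
      simp only [hz]
      simp
      simp at h2
      linarith
    rw [this]; exact zero_le
  · set t := mq ^ (1 / q) / (ε ^ (1 / q) * (n : ℝ) ^ (1 - 1 / q)) with ht
    have ht0 : 0 < t := by positivity
    have htq : (n * t) ^ q = n * mq / ε := by
      rw [ht, Real.mul_rpow hn0.le (by positivity), Real.div_rpow (by positivity) (by positivity),
        Real.mul_rpow (by positivity) (by positivity), ← Real.rpow_mul hmq0, ← Real.rpow_mul hε.le,
        ← Real.rpow_mul hn0.le, one_div_mul_cancel hq0.ne', Real.rpow_one, Real.rpow_one]
      have e1 : (1 - 1 / q) * q = q - 1 := by field_simp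
      rw [e1, Real.rpow_sub_one hn0.ne']
      have : (n : ℝ) ^ q ≠ 0 := by positivity
      field_simp
    have hscale : ∀ x, (f x / (n * t)) ^ q = f x ^ q / (n * t) ^ q :=
      fun x => Real.div_rpow (hf0 x) (by positivity) q
    have hmain := measure_sum_sub_ge_le (ν := ν) (n := n) (f := fun x => f x / (n * t))
      (fun x => div_nonneg (hf0 x) (by positivity)) (by fun_prop) hq1 hq2
      (by simp_rw [hscale]; exact hfq.div_const _)
    simp_rw [hscale] at hmain
    rw [integral_div, integral_div, htq, ← hmq] at hmain
    have e2 : n * (mq / (n * mq / ε)) = ε := by field_simp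
    rw [e2] at hmain
    rw [← ofReal_measureReal]
    apply ENNReal.ofReal_le_ofReal
    refine le_trans (measureReal_mono ?_) hmain
    intro z hz
    simp only [Set.mem_compl_iff, Set.mem_ofPred_eq, not_le] at hz ⊢
    rw [lt_div_iff₀ hn0] at hz
    have e3 : ∑ i, (f (z i) / (n * t) - (∫ x, f x ∂ν) / (n * t)) =
        ((∑ i, f (z i)) - n * ∫ x, f x ∂ν) / (n * t) := by
      rw [Finset.sum_sub_distrib, ← Finset.sum_div]
      simp
      ring
    rw [e3, le_div_iff₀ (by positivity)]
    linarith

end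

/-! ### Second and fourth moments of sums of centered vectors -/

section

variable {d : ℕ} {Ω : Type*} [MeasurableSpace Ω] {ν : Measure Ω} [IsProbabilityMeasure ν]
  {V : Ω → EuclideanSpace ℝ (Fin d)}

lemma measurePreserving_cons (n : ℕ) :
    MeasurePreserving (fun p : Ω × (Fin n → Ω) => (Fin.cons p.1 p.2 : Fin (n + 1) → Ω))
      (ν.prod (Measure.pi fun _ : Fin n => ν)) (Measure.pi fun _ : Fin (n + 1) => ν) := by
  have := (measurePreserving_piFinSuccAbove (fun _ : Fin (n + 1) => ν) 0).symm
  simpa [MeasurableEquiv.piFinSuccAbove_symm_apply, Fin.insertNthEquiv] using this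

lemma norm_add_pow_four_le (x y : EuclideanSpace ℝ (Fin d)) :
    ‖x + y‖ ^ 4 ≤ ‖x‖ ^ 4 + ‖y‖ ^ 4 + 6 * (‖x‖ ^ 2 * ‖y‖ ^ 2) +
      4 * (‖x‖ ^ 2 * inner ℝ x y) + 4 * (inner ℝ x y * ‖y‖ ^ 2) := by
  have h1 : ‖x + y‖ ^ 2 = ‖x‖ ^ 2 + 2 * inner ℝ x y + ‖y‖ ^ 2 := norm_add_sq_real x y
  have h2 : inner ℝ x y ^ 2 ≤ ‖x‖ ^ 2 * ‖y‖ ^ 2 := by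
    rw [← mul_pow]; exact sq_le_sq.2 ((abs_real_inner_le_norm _ _).trans (le_abs_self _))
  have h3 : ‖x + y‖ ^ 4 = (‖x + y‖ ^ 2) ^ 2 := by ring
  rw [h3, h1]
  nlinarith

/-- Moments of a sum of independent copies of a centered random vector. -/
lemma moments_sum (hV : Measurable V) (hV4 : Integrable (fun x => ‖V x‖ ^ 4) ν)
    (hV0 : ∀ u, ∫ x, inner ℝ u (V x) ∂ν = 0) (n : ℕ) :
    Integrable (fun z => ‖∑ i, V (z i)‖ ^ 4) (Measure.pi fun _ : Fin n => ν) ∧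
    (∀ u, ∫ z, inner ℝ u (∑ i, V (z i)) ∂(Measure.pi fun _ : Fin n => ν) = 0) ∧
    ∫ z, ‖∑ i, V (z i)‖ ^ 2 ∂(Measure.pi fun _ : Fin n => ν) = n * ∫ x, ‖V x‖ ^ 2 ∂ν ∧
    ∫ z, ‖∑ i, V (z i)‖ ^ 4 ∂(Measure.pi fun _ : Fin n => ν) ≤
      n * ∫ x, ‖V x‖ ^ 4 ∂ν + 3 * n * (n - 1) * (∫ x, ‖V x‖ ^ 2 ∂ν) ^ 2 := by
  have hV2 := integrable_norm_sq_of_four hV hV4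
  have hV1 : ∀ u, Integrable (fun x => inner ℝ u (V x)) ν := fun u =>
    integrable_of_integrable_sq (by fun_prop) (integrable_inner_sq hV hV2 u)
  induction n with
  | zero => simp
  | succ n ih =>
    obtain ⟨i4, m1, m2, m4⟩ := ih
    set Q := Measure.pi fun _ : Fin n => ν
    let S : (Fin n → Ω) → EuclideanSpace ℝ (Fin d) := fun z => ∑ i, V (z i)
    have hS : Measurable S := by fun_prop
    have i2 : Integrable (fun z => ‖S z‖ ^ 2) Q := integrable_norm_sq_of_four hS i4
    have i1 : ∀ u, Integrable (fun z => inner ℝ u (S z)) Q := fun u =>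
      integrable_of_integrable_sq (by fun_prop) (integrable_inner_sq hS i2 u)
    have htr : ∀ φ : EuclideanSpace ℝ (Fin d) → ℝ, Measurable φ →
        (∫ z, φ (∑ i, V (z i)) ∂(Measure.pi fun _ : Fin (n + 1) => ν) =
          ∫ p : Ω × (Fin n → Ω), φ (V p.1 + S p.2) ∂(ν.prod Q)) ∧
        (Integrable (fun p : Ω × (Fin n → Ω) => φ (V p.1 + S p.2)) (ν.prod Q) →
          Integrable (fun z => φ (∑ i, V (z i))) (Measure.pi fun _ : Fin (n + 1) => ν)) := by
      intro φ hφ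
      have hmp := measurePreserving_cons (ν := ν) n
      have hm : Measurable (fun z : Fin (n + 1) → Ω => φ (∑ i, V (z i))) := by fun_prop
      constructor
      · rw [← hmp.map_eq, integral_map hmp.measurable.aemeasurable hm.aestronglyMeasurable]
        simp [S, Fin.sum_univ_succ]
        rfl
      · intro hi
        rw [← hmp.integrable_comp hm.aestronglyMeasurable]
        refine hi.congr (ae_of_all _ fun p => ?_)
        simp [S, Fin.sum_univ_succ]
    -- integrability on the product space
    have j4x : Integrable (fun p : Ω × (Fin n → Ω) => ‖V p.1‖ ^ 4) (ν.prod Q) := hV4.comp_fst _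
    have j4y : Integrable (fun p : Ω × (Fin n → Ω) => ‖S p.2‖ ^ 4) (ν.prod Q) := i4.comp_snd _
    have j2x : Integrable (fun p : Ω × (Fin n → Ω) => ‖V p.1‖ ^ 2) (ν.prod Q) := hV2.comp_fst _
    have j2y : Integrable (fun p : Ω × (Fin n → Ω) => ‖S p.2‖ ^ 2) (ν.prod Q) := i2.comp_snd _
    have j22 : Integrable (fun p : Ω × (Fin n → Ω) => ‖V p.1‖ ^ 2 * ‖S p.2‖ ^ 2) (ν.prod Q) :=
      hV2.mul_prod i2
    have hVf : Measurable (fun p : Ω × (Fin n → Ω) => V p.1) := hV.comp measurable_fst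
    have hSf : Measurable (fun p : Ω × (Fin n → Ω) => S p.2) := hS.comp measurable_snd
    have jin : Integrable (fun p : Ω × (Fin n → Ω) => inner ℝ (V p.1) (S p.2)) (ν.prod Q) := by
      refine (j2x.add j2y).mono' (by fun_prop) (ae_of_all _ fun p => ?_)
      have := abs_real_inner_le_norm (V p.1) (S p.2)
      rw [Real.norm_eq_abs]
      simp only [Pi.add_apply]
      nlinarith [sq_nonneg (‖V p.1‖ - ‖S p.2‖), norm_nonneg (V p.1), norm_nonneg (S p.2)]
    have jxxi : Integrable (fun p : Ω × (Fin n → Ω) => ‖V p.1‖ ^ 2 * inner ℝ (V p.1) (S p.2))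
        (ν.prod Q) := by
      refine (j4x.add j22).mono' (by fun_prop) (ae_of_all _ fun p => ?_)
      have := abs_real_inner_le_norm (V p.1) (S p.2)
      rw [Real.norm_eq_abs, abs_mul, abs_of_nonneg (sq_nonneg ‖V p.1‖)]
      simp only [Pi.add_apply]
      calc ‖V p.1‖ ^ 2 * |inner ℝ (V p.1) (S p.2)| ≤ ‖V p.1‖ ^ 2 * (‖V p.1‖ * ‖S p.2‖) := by gcongr
        _ ≤ ‖V p.1‖ ^ 2 * (‖V p.1‖ ^ 2 + ‖S p.2‖ ^ 2) := by
          gcongr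
          nlinarith [sq_nonneg (‖V p.1‖ - ‖S p.2‖), norm_nonneg (V p.1), norm_nonneg (S p.2)]
        _ = _ := by ring
    have jiyy : Integrable (fun p : Ω × (Fin n → Ω) => inner ℝ (V p.1) (S p.2) * ‖S p.2‖ ^ 2)
        (ν.prod Q) := by
      refine (j4y.add j22).mono' (by fun_prop) (ae_of_all _ fun p => ?_)
      have := abs_real_inner_le_norm (V p.1) (S p.2)
      rw [Real.norm_eq_abs, abs_mul, abs_of_nonneg (sq_nonneg ‖S p.2‖)]
      simp only [Pi.add_apply]
      calc |inner ℝ (V p.1) (S p.2)| * ‖S p.2‖ ^ 2 ≤ (‖V p.1‖ * ‖S p.2‖) * ‖S p.2‖ ^ 2 := by gcongr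
        _ ≤ (‖V p.1‖ ^ 2 + ‖S p.2‖ ^ 2) * ‖S p.2‖ ^ 2 := by
          gcongr
          nlinarith [sq_nonneg (‖V p.1‖ - ‖S p.2‖), norm_nonneg (V p.1), norm_nonneg (S p.2)]
        _ = _ := by ring
    -- the odd terms vanish
    have zin : ∫ p : Ω × (Fin n → Ω), inner ℝ (V p.1) (S p.2) ∂(ν.prod Q) = 0 := by
      rw [integral_prod _ jin]
      simp_rw [S, m1]
      simp
    have zxxi : ∫ p : Ω × (Fin n → Ω), ‖V p.1‖ ^ 2 * inner ℝ (V p.1) (S p.2) ∂(ν.prod Q) = 0 := by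
      rw [integral_prod _ jxxi]
      simp_rw [integral_const_mul, S, m1]
      simp
    have ziyy : ∫ p : Ω × (Fin n → Ω), inner ℝ (V p.1) (S p.2) * ‖S p.2‖ ^ 2 ∂(ν.prod Q) = 0 := by
      rw [integral_prod_symm _ jiyy]
      have : ∀ y, ∫ x, inner ℝ (V x) (S y) * ‖S y‖ ^ 2 ∂ν = 0 := by
        intro y
        rw [integral_mul_const]
        simp_rw [real_inner_comm (S y)]
        rw [hV0, zero_mul]
      simp_rw [this]
      simp
    have e22 : ∫ p : Ω × (Fin n → Ω), ‖V p.1‖ ^ 2 * ‖S p.2‖ ^ 2 ∂(ν.prod Q) =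
        (∫ x, ‖V x‖ ^ 2 ∂ν) * (n * ∫ x, ‖V x‖ ^ 2 ∂ν) := by
      rw [integral_prod_mul (fun x => ‖V x‖ ^ 2) (fun y => ‖S y‖ ^ 2), m2]
    have e4x : ∫ p : Ω × (Fin n → Ω), ‖V p.1‖ ^ 4 ∂(ν.prod Q) = ∫ x, ‖V x‖ ^ 4 ∂ν := by
      rw [integral_fun_fst (fun x => ‖V x‖ ^ 4)]; simp
    have e2x : ∫ p : Ω × (Fin n → Ω), ‖V p.1‖ ^ 2 ∂(ν.prod Q) = ∫ x, ‖V x‖ ^ 2 ∂ν := by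
      rw [integral_fun_fst (fun x => ‖V x‖ ^ 2)]; simp
    have e4y : ∫ p : Ω × (Fin n → Ω), ‖S p.2‖ ^ 4 ∂(ν.prod Q) = ∫ z, ‖S z‖ ^ 4 ∂Q := by
      rw [integral_fun_snd (fun y => ‖S y‖ ^ 4)]; simp
    have e2y : ∫ p : Ω × (Fin n → Ω), ‖S p.2‖ ^ 2 ∂(ν.prod Q) = ∫ z, ‖S z‖ ^ 2 ∂Q := by
      rw [integral_fun_snd (fun y => ‖S y‖ ^ 2)]; simp
    have k1 : Integrable (fun p : Ω × (Fin n → Ω) => ‖V p.1‖ ^ 4 + ‖S p.2‖ ^ 4) (ν.prod Q) :=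
      j4x.add j4y
    have k2 : Integrable (fun p : Ω × (Fin n → Ω) => ‖V p.1‖ ^ 4 + ‖S p.2‖ ^ 4 +
      6 * (‖V p.1‖ ^ 2 * ‖S p.2‖ ^ 2)) (ν.prod Q) := k1.add (j22.const_mul 6)
    have k3 : Integrable (fun p : Ω × (Fin n → Ω) => ‖V p.1‖ ^ 4 + ‖S p.2‖ ^ 4 +
      6 * (‖V p.1‖ ^ 2 * ‖S p.2‖ ^ 2) + 4 * (‖V p.1‖ ^ 2 * inner ℝ (V p.1) (S p.2)))
      (ν.prod Q) := k2.add (jxxi.const_mul 4)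
    have k4 : Integrable (fun p : Ω × (Fin n → Ω) => ‖V p.1‖ ^ 4 + ‖S p.2‖ ^ 4 +
      6 * (‖V p.1‖ ^ 2 * ‖S p.2‖ ^ 2) + 4 * (‖V p.1‖ ^ 2 * inner ℝ (V p.1) (S p.2)) +
      4 * (inner ℝ (V p.1) (S p.2) * ‖S p.2‖ ^ 2)) (ν.prod Q) := k3.add (jiyy.const_mul 4)
    have k5 : Integrable (fun p : Ω × (Fin n → Ω) => ‖V p.1 + S p.2‖ ^ 4) (ν.prod Q) := by
      refine k4.mono' (by fun_prop) (ae_of_all _ fun p => ?_)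
      rw [Real.norm_eq_abs, abs_of_nonneg (by positivity)]
      exact norm_add_pow_four_le _ _
    refine ⟨(htr (fun y => ‖y‖ ^ 4) (by fun_prop)).2 k5, fun u => ?_, ?_, ?_⟩
    · rw [(htr (fun y => inner ℝ u y) (by fun_prop)).1]
      simp_rw [inner_add_right]
      have a1 : Integrable (fun p : Ω × (Fin n → Ω) => inner ℝ u (V p.1)) (ν.prod Q) :=
        (hV1 u).comp_fst _
      have a2 : Integrable (fun p : Ω × (Fin n → Ω) => inner ℝ u (S p.2)) (ν.prod Q) :=
        (i1 u).comp_snd _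
      rw [integral_add a1 a2, integral_fun_fst (fun x => inner ℝ u (V x)),
        integral_fun_snd (fun y => inner ℝ u (S y)), hV0, m1]
      simp
    · rw [(htr (fun y => ‖y‖ ^ 2) (by fun_prop)).1]
      simp_rw [norm_add_sq_real]
      have a1 : Integrable (fun p : Ω × (Fin n → Ω) => ‖V p.1‖ ^ 2 +
        2 * inner ℝ (V p.1) (S p.2)) (ν.prod Q) := j2x.add (jin.const_mul 2)
      rw [integral_add a1 j2y, integral_add j2x (jin.const_mul 2), integral_const_mul, zin, e2x,
        e2y, m2]
      push_cast
      ring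
    · rw [(htr (fun y => ‖y‖ ^ 4) (by fun_prop)).1]
      refine (integral_mono k5 k4 fun p => norm_add_pow_four_le _ _).trans ?_
      rw [integral_add k3 (jiyy.const_mul 4), integral_add k2 (jxxi.const_mul 4),
        integral_add k1 (j22.const_mul 6), integral_add j4x j4y, integral_const_mul,
        integral_const_mul, integral_const_mul, ziyy, zxxi, e22, e4x, e4y]
      push_cast
      linarith

end

/-! ### The whitening map and the square root of the Gram matrix -/

section

variable {d : ℕ} {ν : Measure (EuclideanSpace ℝ (Fin d) × ℝ)}

/-- The matrix `U diag(f) Uᵀ`, where `U` is the orthogonal matrix that diagonalizes the Gram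
matrix in the definition of `gramInvSqrt`. -/
noncomputable def gramConj (ν : Measure (EuclideanSpace ℝ (Fin d) × ℝ)) (f : Fin d → ℝ) :
    Matrix (Fin d) (Fin d) ℝ :=
  ((gram_isHermitian ν).eigenvectorUnitary : Matrix (Fin d) (Fin d) ℝ) * Matrix.diagonal f *
    star ((gram_isHermitian ν).eigenvectorUnitary : Matrix (Fin d) (Fin d) ℝ)

lemma gramConj_mul (f g : Fin d → ℝ) :
    gramConj ν f * gramConj ν g = gramConj ν (fun i => f i * g i) := by
  unfold gramConj
  set U := ((gram_isHermitian ν).eigenvectorUnitary : Matrix (Fin d) (Fin d) ℝ) with hU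
  have h : star U * U = 1 := Unitary.coe_star_mul_self _
  calc U * Matrix.diagonal f * star U * (U * Matrix.diagonal g * star U)
      = U * Matrix.diagonal f * (star U * U) * Matrix.diagonal g * star U := by
        simp only [Matrix.mul_assoc]
    _ = U * (Matrix.diagonal f * Matrix.diagonal g) * star U := by
        rw [h, Matrix.mul_one]; simp only [Matrix.mul_assoc]
    _ = _ := by rw [Matrix.diagonal_mul_diagonal]

lemma gramConj_isHermitian (f : Fin d → ℝ) : (gramConj ν f).IsHermitian := by
  unfold gramConj
  rw [Matrix.star_eq_conjTranspose]
  exact Matrix.isHermitian_mul_mul_conjTranspose _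
    (Matrix.isHermitian_diagonal_of_self_adjoint _ (by ext i; simp))

lemma gramConj_eigenvalues : gramConj ν (gram_isHermitian ν).eigenvalues = gram ν := by
  have h := (gram_isHermitian ν).spectral_theorem
  rw [Unitary.conjStarAlgAut_apply] at h
  exact h.symm

/-- The whitening map `x ↦ G^{-1/2} x`. -/
noncomputable def whiten (ν : Measure (EuclideanSpace ℝ (Fin d) × ℝ)) :
    EuclideanSpace ℝ (Fin d) →ₗ[ℝ] EuclideanSpace ℝ (Fin d) :=
  Matrix.toEuclideanLin (gramInvSqrt ν)

/-- The square root `G^{1/2}` of the Gram matrix, as a linear map. -/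
noncomputable def gramSqrt (ν : Measure (EuclideanSpace ℝ (Fin d) × ℝ)) :
    EuclideanSpace ℝ (Fin d) →ₗ[ℝ] EuclideanSpace ℝ (Fin d) :=
  Matrix.toEuclideanLin (gramConj ν fun i => √((gram_isHermitian ν).eigenvalues i))

lemma whiten_eq : whiten ν = Matrix.toEuclideanLin (gramConj ν fun i =>
    if 0 < (gram_isHermitian ν).eigenvalues i
      then (√((gram_isHermitian ν).eigenvalues i))⁻¹ else 0) := rfl

lemma toEuclideanLin_mul_apply (A B : Matrix (Fin d) (Fin d) ℝ) (x : EuclideanSpace ℝ (Fin d)) :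
    Matrix.toEuclideanLin A (Matrix.toEuclideanLin B x) = Matrix.toEuclideanLin (A * B) x := by
  simp [Matrix.toLpLin_apply, Matrix.mulVec_mulVec]

lemma inner_toEuclideanLin {A : Matrix (Fin d) (Fin d) ℝ} (hA : A.IsHermitian)
    (x y : EuclideanSpace ℝ (Fin d)) :
    inner ℝ (Matrix.toEuclideanLin A x) y = inner ℝ x (Matrix.toEuclideanLin A y) :=
  (Matrix.isSymmetric_toEuclideanLin_iff.2 hA) x y

lemma inner_whiten (x y : EuclideanSpace ℝ (Fin d)) :
    inner ℝ (whiten ν x) y = inner ℝ x (whiten ν y) :=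
  inner_toEuclideanLin (gramConj_isHermitian _) x y

lemma inner_gramSqrt (x y : EuclideanSpace ℝ (Fin d)) :
    inner ℝ (gramSqrt ν x) y = inner ℝ x (gramSqrt ν y) :=
  inner_toEuclideanLin (gramConj_isHermitian _) x y

lemma gramSqrt_whiten_whiten (x : EuclideanSpace ℝ (Fin d)) :
    gramSqrt ν (whiten ν (whiten ν x)) = whiten ν x := by
  simp only [whiten_eq, gramSqrt, toEuclideanLin_mul_apply, gramConj_mul]
  congr 3
  ext i
  split_ifs with h
  · have := Real.sqrt_ne_zero'.2 h
    field_simp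
  · simp

lemma whiten_gramSqrt_comm (x : EuclideanSpace ℝ (Fin d)) :
    whiten ν (gramSqrt ν x) = gramSqrt ν (whiten ν x) := by
  simp only [whiten_eq, gramSqrt, toEuclideanLin_mul_apply, gramConj_mul]
  congr 3
  ext i
  ring

lemma gramSqrt_gramSqrt_whiten (x : EuclideanSpace ℝ (Fin d)) :
    gramSqrt ν (gramSqrt ν (whiten ν x)) = gramSqrt ν x := by
  simp only [whiten_eq, gramSqrt, toEuclideanLin_mul_apply, gramConj_mul]
  congr 3
  ext i
  split_ifs with h
  · have := Real.sqrt_ne_zero'.2 h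
    field_simp
  · simp [Real.sqrt_eq_zero'.2 (not_lt.1 h)]

/-- `G^{1/2} G^{-1/2}` is an orthogonal projection. -/
lemma norm_gramSqrt_whiten_le (u : EuclideanSpace ℝ (Fin d)) :
    ‖gramSqrt ν (whiten ν u)‖ ≤ ‖u‖ := by
  set w := gramSqrt ν (whiten ν u) with hw
  have h : ‖w‖ * ‖w‖ ≤ ‖u‖ * ‖w‖ := by
    calc ‖w‖ * ‖w‖ = inner ℝ w w := (real_inner_self_eq_norm_mul_norm w).symm
      _ = inner ℝ u (whiten ν (gramSqrt ν w)) := by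
        conv_lhs => rw [hw]
        rw [inner_gramSqrt, inner_whiten]
      _ = inner ℝ u w := by
        rw [hw, gramSqrt_gramSqrt_whiten, whiten_gramSqrt_comm]
      _ ≤ ‖u‖ * ‖w‖ := real_inner_le_norm u w
  rcases (norm_nonneg w).eq_or_lt with h0 | h0
  · rw [← h0]; exact norm_nonneg u
  · exact le_of_mul_le_mul_right h h0

lemma measurable_whiten : Measurable (whiten ν) :=
  (LinearMap.continuous_of_finiteDimensional _).measurable

lemma measurable_gramSqrt : Measurable (gramSqrt ν) :=
  (LinearMap.continuous_of_finiteDimensional _).measurable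

lemma memLp_inner_fst (h : MemLp (fun z : EuclideanSpace ℝ (Fin d) × ℝ => z.1) 2 ν)
    (u : EuclideanSpace ℝ (Fin d)) : MemLp (fun z => (inner ℝ u z.1 : ℝ)) 2 ν :=
  MemLp.const_inner u h

lemma integral_inner_mul_inner (h : MemLp (fun z : EuclideanSpace ℝ (Fin d) × ℝ => z.1) 2 ν)
    (u v : EuclideanSpace ℝ (Fin d)) :
    ∫ z, inner ℝ u z.1 * inner ℝ v z.1 ∂ν = inner ℝ u (Matrix.toEuclideanLin (gram ν) v) := by
  have hc : ∀ i, MemLp (fun z : EuclideanSpace ℝ (Fin d) × ℝ => z.1 i) 2 ν := by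
    intro i
    have := memLp_inner_fst h (EuclideanSpace.single i 1)
    simpa [EuclideanSpace.inner_single_left] using this
  have hij : ∀ i j, Integrable (fun z : EuclideanSpace ℝ (Fin d) × ℝ =>
      u i * v j * (z.1 i * z.1 j)) ν :=
    fun i j => ((hc i).integrable_mul (hc j)).const_mul _
  have e : ∀ z : EuclideanSpace ℝ (Fin d) × ℝ, inner ℝ u z.1 * inner ℝ v z.1 =
      ∑ i, ∑ j, u i * v j * (z.1 i * z.1 j) := by
    intro z
    simp only [PiLp.inner_apply, RCLike.inner_apply, conj_trivial]
    rw [Finset.sum_mul_sum]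
    refine Finset.sum_congr rfl fun i _ => Finset.sum_congr rfl fun j _ => by ring
  simp_rw [e]
  rw [integral_finsetSum _ fun i _ => integrable_finsetSum _ fun j _ => hij i j]
  simp_rw [fun i => integral_finsetSum (μ := ν) Finset.univ (fun j _ => hij i j),
    integral_const_mul]
  simp only [PiLp.inner_apply, RCLike.inner_apply, conj_trivial, Matrix.toLpLin_apply,
    Matrix.mulVec, dotProduct, gram, Matrix.of_apply, Finset.sum_mul]
  refine Finset.sum_congr rfl fun i _ => Finset.sum_congr rfl fun j _ => by ring

lemma gram_eigenvalues_nonneg (h : MemLp (fun z : EuclideanSpace ℝ (Fin d) × ℝ => z.1) 2 ν)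
    (i : Fin d) : 0 ≤ (gram_isHermitian ν).eigenvalues i := by
  have hp : (gram ν).PosSemidef := by
    rw [Matrix.posSemidef_iff_dotProduct_mulVec]
    refine ⟨gram_isHermitian ν, fun x => ?_⟩
    have := integral_inner_mul_inner h (WithLp.toLp 2 x) (WithLp.toLp 2 x)
    have h0 : 0 ≤ ∫ z, inner ℝ (WithLp.toLp 2 x) z.1 * inner ℝ (WithLp.toLp 2 x) z.1 ∂ν :=
      integral_nonneg fun z => mul_self_nonneg _
    rw [this] at h0
    simpa [Matrix.toLpLin_apply, EuclideanSpace.inner_eq_star_dotProduct, dotProduct_comm] using h0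
  exact hp.eigenvalues_nonneg i

lemma integral_inner_mul_inner_eq (h : MemLp (fun z : EuclideanSpace ℝ (Fin d) × ℝ => z.1) 2 ν)
    (u v : EuclideanSpace ℝ (Fin d)) :
    ∫ z, inner ℝ u z.1 * inner ℝ v z.1 ∂ν = inner ℝ (gramSqrt ν u) (gramSqrt ν v) := by
  rw [integral_inner_mul_inner h, inner_gramSqrt]
  congr 1
  simp only [gramSqrt, toEuclideanLin_mul_apply, gramConj_mul]
  congr 2
  refine gramConj_eigenvalues.symm.trans ?_
  congr 1
  ext i
  rw [Real.mul_self_sqrt (gram_eigenvalues_nonneg h i)]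

lemma integral_inner_sq_eq (h : MemLp (fun z : EuclideanSpace ℝ (Fin d) × ℝ => z.1) 2 ν)
    (u : EuclideanSpace ℝ (Fin d)) :
    ∫ z, inner ℝ u z.1 ^ 2 ∂ν = ‖gramSqrt ν u‖ ^ 2 := by
  simp_rw [pow_two]
  rw [integral_inner_mul_inner_eq h, real_inner_self_eq_norm_mul_norm]

lemma integral_inner_whiten_sq (h : MemLp (fun z : EuclideanSpace ℝ (Fin d) × ℝ => z.1) 2 ν)
    (u : EuclideanSpace ℝ (Fin d)) :
    ∫ z, inner ℝ u (whiten ν z.1) ^ 2 ∂ν = ‖gramSqrt ν (whiten ν u)‖ ^ 2 := by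
  simp_rw [← inner_whiten]
  exact integral_inner_sq_eq h _

/-- Almost surely, `X` belongs to the range of the Gram matrix. -/
lemma ae_gramSqrt_whiten (h : MemLp (fun z : EuclideanSpace ℝ (Fin d) × ℝ => z.1) 2 ν) :
    ∀ᵐ z ∂ν, gramSqrt ν (whiten ν z.1) = z.1 := by
  have h1 : ∀ i : Fin d, ∀ᵐ z ∂ν, inner ℝ (EuclideanSpace.single i (1 : ℝ))
      (z.1 - gramSqrt ν (whiten ν z.1)) = 0 := by
    intro i
    set e : EuclideanSpace ℝ (Fin d) := EuclideanSpace.single i (1 : ℝ)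
    have h2 := integral_inner_sq_eq h (e - gramSqrt ν (whiten ν e))
    rw [map_sub, gramSqrt_gramSqrt_whiten, sub_self, norm_zero, zero_pow two_ne_zero,
      integral_eq_zero_iff_of_nonneg (fun z => sq_nonneg _)
        (memLp_inner_fst h _).integrable_sq] at h2
    filter_upwards [h2] with z hz
    have hz' := pow_eq_zero_iff two_ne_zero |>.1 hz
    rw [inner_sub_left, inner_gramSqrt, inner_whiten, whiten_gramSqrt_comm] at hz'
    rw [inner_sub_right, hz']
  rw [← ae_all_iff] at h1
  filter_upwards [h1] with z hz
  have : z.1 - gramSqrt ν (whiten ν z.1) = 0 := by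
    ext i
    simpa [EuclideanSpace.inner_single_left] using hz i
  exact (sub_eq_zero.1 this).symm

/-! ### The law of the whitened vector -/

lemma integral_inner_four_le (h2 : MemLp (fun z : EuclideanSpace ℝ (Fin d) × ℝ => z.1) 2 ν)
    (hk : kurtosis ν < ⊤) (θ : EuclideanSpace ℝ (Fin d))
    (h4 : Integrable (fun z => inner ℝ θ z.1 ^ 4) ν) :
    ∫ z, inner ℝ θ z.1 ^ 4 ∂ν ≤ kappa ν * (∫ z, inner ℝ θ z.1 ^ 2 ∂ν) ^ 2 := by
  have i2 := (memLp_inner_fst h2 θ).integrable_sq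
  set a := ∫ z, inner ℝ θ z.1 ^ 2 ∂ν with ha
  have ha0 : 0 ≤ a := integral_nonneg fun z => sq_nonneg _
  rcases ha0.eq_or_lt with h0 | hpos
  · have := (integral_eq_zero_iff_of_nonneg (fun z => sq_nonneg _) i2).1 h0.symm
    have h4 : ∫ z, inner ℝ θ z.1 ^ 4 ∂ν = 0 := by
      rw [integral_eq_zero_of_ae]
      filter_upwards [this] with z hz
      have hz' : inner ℝ θ z.1 = 0 := pow_eq_zero_iff two_ne_zero |>.1 hz
      simp [hz']
    rw [h4, ← h0]; simp
  · have hs : 0 < √a := Real.sqrt_pos.2 hpos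
    set η := (√a)⁻¹ • θ with hη
    have e : ∀ z : EuclideanSpace ℝ (Fin d) × ℝ, inner ℝ η z.1 = (√a)⁻¹ * inner ℝ θ z.1 := by
      intro z; rw [hη, real_inner_smul_left]
    have hsq : √a ^ 2 = a := Real.sq_sqrt ha0
    have hη2 : ∫⁻ z, ENNReal.ofReal ((inner ℝ η z.1) ^ 2) ∂ν ≤ 1 := by
      simp_rw [e, mul_pow]
      rw [← ofReal_integral_eq_lintegral_ofReal (i2.const_mul _)
        (ae_of_all _ fun z => by positivity), integral_const_mul, ← ha, inv_pow, hsq,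
        inv_mul_cancel₀ hpos.ne', ENNReal.ofReal_one]
    have hη4 : ∫⁻ z, ENNReal.ofReal ((inner ℝ η z.1) ^ 4) ∂ν ≤ kurtosis ν :=
      le_iSup₂_of_le η hη2 le_rfl
    simp_rw [e, mul_pow] at hη4
    rw [← ofReal_integral_eq_lintegral_ofReal (h4.const_mul _)
        (ae_of_all _ fun z => by positivity), integral_const_mul,
        ENNReal.ofReal_le_iff_le_toReal hk.ne] at hη4
    have h5 : (√a)⁻¹ ^ 4 = (a ^ 2)⁻¹ := by
      rw [inv_pow, show √a ^ 4 = (√a ^ 2) ^ 2 by ring, hsq]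
    rw [h5, inv_mul_le_iff₀ (by positivity)] at hη4
    unfold kappa
    linarith

/-- The noise `Y - ⟨θ⋆, X⟩` times the whitened vector. Its mean is `0`, by the normal equations. -/
noncomputable def score (ν : Measure (EuclideanSpace ℝ (Fin d) × ℝ))
    (θs : EuclideanSpace ℝ (Fin d)) (z : EuclideanSpace ℝ (Fin d) × ℝ) :
    EuclideanSpace ℝ (Fin d) :=
  (z.2 - inner ℝ θs z.1) • whiten ν z.1

lemma measurable_score {θs : EuclideanSpace ℝ (Fin d)} : Measurable (score ν θs) := by
  have h : Measurable fun z : EuclideanSpace ℝ (Fin d) × ℝ => z.2 - inner ℝ θs z.1 := by fun_prop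
  exact h.smul (measurable_whiten.comp measurable_fst)

lemma norm_score_pow (θs : EuclideanSpace ℝ (Fin d)) (z : EuclideanSpace ℝ (Fin d) × ℝ) {m : ℕ}
    (hm : Even m) :
    ‖score ν θs z‖ ^ m = (z.2 - inner ℝ θs z.1) ^ m * whitenedNorm ν z.1 ^ m := by
  rw [score, norm_smul, mul_pow, Real.norm_eq_abs, hm.pow_abs]
  rfl

/-- A quadratic polynomial that is nonnegative and vanishes at `0` has no linear term. -/
lemma eq_zero_of_forall_quad_nonneg {a b : ℝ} (h : ∀ t : ℝ, 0 ≤ t ^ 2 * a - 2 * t * b) :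
    b = 0 := by
  have ha : 0 ≤ a := by have h1 := h 1; have h2 := h (-1); linarith
  have h1 := h (b / (a + 1))
  have e : (b / (a + 1)) ^ 2 * a - 2 * (b / (a + 1)) * b =
      -(b ^ 2 * (a + 2) / (a + 1) ^ 2) := by
    field_simp; ring
  rw [e] at h1
  have h2 : 0 ≤ b ^ 2 * (a + 2) / (a + 1) ^ 2 := by positivity
  have h3 : b ^ 2 * (a + 2) / (a + 1) ^ 2 = 0 := by linarith
  rw [div_eq_zero_iff] at h3
  rcases h3 with h3 | h3
  · have := (mul_eq_zero.1 h3).resolve_right (by linarith)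
    exact pow_eq_zero_iff two_ne_zero |>.1 this
  · nlinarith [pow_eq_zero_iff two_ne_zero |>.1 h3]

namespace Assumptions

variable {θs : EuclideanSpace ℝ (Fin d)} {p q : ℝ}

lemma memLp_noise (h : Assumptions ν θs p q) (θ : EuclideanSpace ℝ (Fin d)) :
    MemLp (fun z => z.2 - inner ℝ θ z.1) 2 ν :=
  h.memLp_snd.sub (memLp_inner_fst h.memLp_fst θ)

lemma risk_sub (h : Assumptions ν θs p q) (v : EuclideanSpace ℝ (Fin d)) :
    risk ν (θs + v) - risk ν θs = ∫ z, inner ℝ v z.1 ^ 2 ∂ν -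
      2 * ∫ z, (z.2 - inner ℝ θs z.1) * inner ℝ v z.1 ∂ν := by
  have i1 := (memLp_inner_fst h.memLp_fst v).integrable_sq
  have i2 : Integrable (fun z => (z.2 - inner ℝ θs z.1) * inner ℝ v z.1) ν :=
    (h.memLp_noise θs).integrable_mul (memLp_inner_fst h.memLp_fst v)
  unfold risk
  rw [← integral_sub (h.memLp_noise _).integrable_sq (h.memLp_noise _).integrable_sq,
    ← integral_const_mul, ← integral_sub i1 (i2.const_mul 2)]
  refine integral_congr_ae (ae_of_all _ fun z => ?_)
  simp only [inner_add_left]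
  ring

/-- The normal equations. -/
lemma integral_noise_mul_inner (h : Assumptions ν θs p q) (v : EuclideanSpace ℝ (Fin d)) :
    ∫ z, (z.2 - inner ℝ θs z.1) * inner ℝ v z.1 ∂ν = 0 := by
  refine eq_zero_of_forall_quad_nonneg (a := ∫ z, inner ℝ v z.1 ^ 2 ∂ν) fun t => ?_
  have h1 := h.risk_sub (t • v)
  have h2 := h.isArgmin (θs + t • v)
  simp_rw [real_inner_smul_left, mul_pow] at h1
  rw [integral_const_mul] at h1
  have e : ∫ z, (z.2 - inner ℝ θs z.1) * (t * inner ℝ v z.1) ∂ν =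
      t * ∫ z, (z.2 - inner ℝ θs z.1) * inner ℝ v z.1 ∂ν := by
    rw [← integral_const_mul]; congr 1; ext z; ring
  rw [e] at h1
  linarith

lemma excess_eq (h : Assumptions ν θs p q) (θ : EuclideanSpace ℝ (Fin d)) :
    excess ν θs θ = ‖gramSqrt ν (θ - θs)‖ ^ 2 := by
  have h1 := h.risk_sub (θ - θs)
  rw [h.integral_noise_mul_inner, add_sub_cancel, integral_inner_sq_eq h.memLp_fst] at h1
  unfold excess
  linarith

lemma score_centered (h : Assumptions ν θs p q) (u : EuclideanSpace ℝ (Fin d)) :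
    ∫ z, inner ℝ u (score ν θs z) ∂ν = 0 := by
  rw [← h.integral_noise_mul_inner (whiten ν u)]
  simp_rw [score, real_inner_smul_right, inner_whiten]

lemma integral_score_sq : ∫ z, ‖score ν θs z‖ ^ 2 ∂ν = rateConst ν θs := by
  simp_rw [norm_score_pow θs _ even_two]
  rfl

lemma integrable_score_four (h : Assumptions ν θs p q) :
    Integrable (fun z => ‖score ν θs z‖ ^ 4) ν := by
  simp_rw [norm_score_pow θs _ (by decide : Even 4)]
  exact h.integrable_kappa'

lemma integral_score_four (h : Assumptions ν θs p q) :
    ∫ z, ‖score ν θs z‖ ^ 4 ∂ν = kappa' ν θs * rateConst ν θs ^ 2 := by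
  have := h.rateConst_pos
  unfold kappa'
  rw [div_mul_cancel₀ _ (by positivity)]
  simp_rw [norm_score_pow θs _ (by decide : Even 4)]

lemma one_le_kappa' [IsProbabilityMeasure ν] (h : Assumptions ν θs p q) : 1 ≤ kappa' ν θs := by
  have h4 := h.integrable_score_four
  have h2 : Integrable (fun z => ‖score ν θs z‖ ^ 2) ν :=
    integrable_norm_sq_of_four measurable_score h4
  have hC := h.rateConst_pos
  have h0 : 0 ≤ ∫ z, (‖score ν θs z‖ ^ 2 - rateConst ν θs) ^ 2 ∂ν :=
    integral_nonneg fun z => sq_nonneg _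
  have e : ∀ z, (‖score ν θs z‖ ^ 2 - rateConst ν θs) ^ 2 = ‖score ν θs z‖ ^ 4 -
      2 * rateConst ν θs * ‖score ν θs z‖ ^ 2 + rateConst ν θs ^ 2 := fun z => by ring
  have i1 : Integrable (fun z => ‖score ν θs z‖ ^ 4 -
      2 * rateConst ν θs * ‖score ν θs z‖ ^ 2) ν := h4.sub (h2.const_mul _)
  simp_rw [e] at h0
  rw [integral_add i1 (integrable_const _), integral_sub h4 (h2.const_mul _), integral_const_mul,
    integral_score_sq, h.integral_score_four, integral_const, probReal_univ, one_smul] at h0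
  have : rateConst ν θs ^ 2 * 1 ≤ rateConst ν θs ^ 2 * kappa' ν θs := by linarith
  exact le_of_mul_le_mul_left this (by positivity)

lemma exists_whiten_ne_zero (h : Assumptions ν θs p q) :
    ∃ x : EuclideanSpace ℝ (Fin d), whiten ν x ≠ 0 := by
  by_contra! hc
  have h0 := h.rateConst_pos
  have : rateConst ν θs = 0 := by
    rw [← integral_score_sq]
    simp [score, hc]
  linarith

lemma one_le_dim (h : Assumptions ν θs p q) : 1 ≤ d := by
  obtain ⟨x, hx⟩ := h.exists_whiten_ne_zero
  rcases Nat.eq_zero_or_pos d with rfl | hd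
  · exact absurd (Subsingleton.elim _ _) hx
  · exact hd

lemma integrable_whiten_rpow [IsProbabilityMeasure ν] (h : Assumptions ν θs p q) {r : ℝ}
    (hr0 : 0 ≤ r) (hr : r ≤ 2 * q * (p + 1)) : Integrable (fun z => ‖whiten ν z.1‖ ^ r) ν := by
  refine ((integrable_const (1 : ℝ)).add h.integrable_moment).mono' ?_ (ae_of_all _ fun z => ?_)
  · exact (Measurable.pow_const (measurable_whiten.comp measurable_fst).norm r).aestronglyMeasurable
  · rw [Real.norm_eq_abs, abs_of_nonneg (by positivity)]
    simp only [Pi.add_apply]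
    change ‖whiten ν z.1‖ ^ r ≤ 1 + ‖whiten ν z.1‖ ^ (2 * q * (p + 1))
    have hn : 0 ≤ ‖whiten ν z.1‖ := norm_nonneg _
    rcases le_total ‖whiten ν z.1‖ 1 with h1 | h1
    · have := Real.rpow_le_one hn h1 hr0
      have := Real.rpow_nonneg hn (2 * q * (p + 1))
      linarith
    · have := Real.rpow_le_rpow_of_exponent_le h1 hr
      linarith

lemma integrable_whiten_four [IsProbabilityMeasure ν] (h : Assumptions ν θs p q) :
    Integrable (fun z => ‖whiten ν z.1‖ ^ 4) ν := by
  have := h.integrable_whiten_rpow (r := (4 : ℕ)) (by norm_num) (by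
    have := h.one_le_p; have := h.one_le_q; push_cast; nlinarith)
  simpa only [Real.rpow_natCast] using this

lemma momentBound [IsProbabilityMeasure ν] (h : Assumptions ν θs p q) {k : ℝ}
    (hk : kappa ν ≤ k) : MomentBound ν (fun z => whiten ν z.1) k := by
  have hm : Measurable (fun z : EuclideanSpace ℝ (Fin d) × ℝ => whiten ν z.1) :=
    measurable_whiten.comp measurable_fst
  have h2 : ∀ u, ∫ z, inner ℝ u (whiten ν z.1) ^ 2 ∂ν ≤ ‖u‖ ^ 2 := fun u => by
    rw [integral_inner_whiten_sq h.memLp_fst]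
    exact pow_le_pow_left₀ (norm_nonneg _) (norm_gramSqrt_whiten_le u) 2
  refine ⟨hm, h.integrable_whiten_four, h2, fun u => ?_⟩
  have h4 := integral_inner_four_le h.memLp_fst h.kurtosis_lt_top (whiten ν u) (by
    simp_rw [inner_whiten]
    exact integrable_inner_four hm h.integrable_whiten_four u)
  simp_rw [inner_whiten] at h4
  have hk0 : 0 ≤ kappa ν := ENNReal.toReal_nonneg
  calc ∫ z, inner ℝ u (whiten ν z.1) ^ 4 ∂ν
      ≤ kappa ν * (∫ z, inner ℝ u (whiten ν z.1) ^ 2 ∂ν) ^ 2 := h4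
    _ ≤ k * (‖u‖ ^ 2) ^ 2 := by
        have := h2 u
        have h3 : 0 ≤ ∫ z, inner ℝ u (whiten ν z.1) ^ 2 ∂ν := integral_nonneg fun z => sq_nonneg _
        have hk1 := hk0.trans hk
        gcongr
    _ = k * ‖u‖ ^ 4 := by ring

lemma one_le_kappa [IsProbabilityMeasure ν] (h : Assumptions ν θs p q) : 1 ≤ kappa ν := by
  obtain ⟨x, hx⟩ := h.exists_whiten_ne_zero
  set u := whiten ν x with hu
  have hm : Measurable (fun z : EuclideanSpace ℝ (Fin d) × ℝ => whiten ν z.1) :=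
    measurable_whiten.comp measurable_fst
  have hM := h.momentBound le_rfl
  have i4 := integrable_inner_four hm h.integrable_whiten_four u
  have i2 := integrable_inner_sq hm (integrable_norm_sq_of_four hm h.integrable_whiten_four) u
  have e2 : ∫ z, inner ℝ u (whiten ν z.1) ^ 2 ∂ν = ‖u‖ ^ 2 := by
    rw [integral_inner_whiten_sq h.memLp_fst, hu, gramSqrt_whiten_whiten]
  have h4 := hM.four_le u
  have hpos : 0 < ‖u‖ := norm_pos_iff.2 hx
  have h0 : 0 ≤ ∫ z, (inner ℝ u (whiten ν z.1) ^ 2 - ‖u‖ ^ 2) ^ 2 ∂ν :=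
    integral_nonneg fun z => sq_nonneg _
  have e : ∀ z : EuclideanSpace ℝ (Fin d) × ℝ, (inner ℝ u (whiten ν z.1) ^ 2 - ‖u‖ ^ 2) ^ 2 =
      inner ℝ u (whiten ν z.1) ^ 4 - 2 * ‖u‖ ^ 2 * inner ℝ u (whiten ν z.1) ^ 2 + ‖u‖ ^ 4 :=
    fun z => by ring
  have i1 : Integrable (fun z : EuclideanSpace ℝ (Fin d) × ℝ => inner ℝ u (whiten ν z.1) ^ 4 -
      2 * ‖u‖ ^ 2 * inner ℝ u (whiten ν z.1) ^ 2) ν := i4.sub (i2.const_mul _)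
  simp_rw [e] at h0
  rw [integral_add i1 (integrable_const _), integral_sub i4 (i2.const_mul _), integral_const_mul,
    e2, integral_const, probReal_univ, one_smul] at h0
  have : ‖u‖ ^ 4 * 1 ≤ ‖u‖ ^ 4 * kappa ν := by nlinarith
  exact le_of_mul_le_mul_left this (by positivity)

end Assumptions

/-! ### Empirical risk minimizers -/

/-- The empirical average of the score. -/
noncomputable def meanScore {n : ℕ} (ν : Measure (EuclideanSpace ℝ (Fin d) × ℝ))
    (θs : EuclideanSpace ℝ (Fin d)) (z : Fin n → EuclideanSpace ℝ (Fin d) × ℝ) :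
    EuclideanSpace ℝ (Fin d) :=
  (n : ℝ)⁻¹ • ∑ i, score ν θs (z i)

variable {n : ℕ} {θs θ : EuclideanSpace ℝ (Fin d)} {z : Fin n → EuclideanSpace ℝ (Fin d) × ℝ}

/-- The empirical normal equations. -/
lemma sum_inner_mul_inner_of_argmin
    (hθ : ∀ θ' : EuclideanSpace ℝ (Fin d), ∑ i, ((z i).2 - inner ℝ θ (z i).1) ^ 2 ≤
      ∑ i, ((z i).2 - inner ℝ θ' (z i).1) ^ 2) (v : EuclideanSpace ℝ (Fin d)) :
    ∑ i, inner ℝ (θ - θs) (z i).1 * inner ℝ v (z i).1 =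
      ∑ i, ((z i).2 - inner ℝ θs (z i).1) * inner ℝ v (z i).1 := by
  have h : ∑ i, ((z i).2 - inner ℝ θ (z i).1) * inner ℝ v (z i).1 = 0 := by
    refine eq_zero_of_forall_quad_nonneg (a := ∑ i, inner ℝ v (z i).1 ^ 2) fun t => ?_
    have h1 := hθ (θ + t • v)
    have e : ∑ i, ((z i).2 - inner ℝ (θ + t • v) (z i).1) ^ 2 =
        ∑ i, ((z i).2 - inner ℝ θ (z i).1) ^ 2 + (t ^ 2 * ∑ i, inner ℝ v (z i).1 ^ 2 -
          2 * t * ∑ i, ((z i).2 - inner ℝ θ (z i).1) * inner ℝ v (z i).1) := by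
      rw [Finset.mul_sum, Finset.mul_sum, ← Finset.sum_sub_distrib, ← Finset.sum_add_distrib]
      refine Finset.sum_congr rfl fun i _ => ?_
      rw [inner_add_left, real_inner_smul_left]
      ring
    linarith
  rw [← sub_eq_zero, ← Finset.sum_sub_distrib, ← neg_eq_zero, ← Finset.sum_neg_distrib, ← h]
  refine Finset.sum_congr rfl fun i _ => ?_
  rw [inner_sub_left]
  ring

/-- The empirical normal equations in whitened coordinates. -/
lemma whitened_normal_equations
    (hθ : ∀ θ' : EuclideanSpace ℝ (Fin d), ∑ i, ((z i).2 - inner ℝ θ (z i).1) ^ 2 ≤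
      ∑ i, ((z i).2 - inner ℝ θ' (z i).1) ^ 2)
    (hz : ∀ i, gramSqrt ν (whiten ν (z i).1) = (z i).1) (v : EuclideanSpace ℝ (Fin d)) :
    (∑ i, inner ℝ (gramSqrt ν (θ - θs)) (whiten ν (z i).1) *
      inner ℝ (gramSqrt ν v) (whiten ν (z i).1)) / n =
      inner ℝ (gramSqrt ν v) (meanScore ν θs z) := by
  have h1 := sum_inner_mul_inner_of_argmin (θs := θs) hθ v
  have e : ∀ (v : EuclideanSpace ℝ (Fin d)) i,
      inner ℝ (gramSqrt ν v) (whiten ν (z i).1) = inner ℝ v (z i).1 := by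
    intro v i
    rw [inner_gramSqrt, hz]
  simp_rw [e]
  rw [h1, meanScore, real_inner_smul_right, inner_sum, div_eq_inv_mul]
  congr 1
  refine Finset.sum_congr rfl fun i _ => ?_
  rw [score, real_inner_smul_right, e]

lemma gramSqrt_whiten_meanScore :
    gramSqrt ν (whiten ν (meanScore ν θs z)) = meanScore ν θs z := by
  simp only [meanScore, map_smul, map_sum, score, gramSqrt_whiten_whiten]

lemma empirical_form_le_of_unit (h2 : MemLp (fun z : EuclideanSpace ℝ (Fin d) × ℝ => z.1) 2 ν)
    {F : ℝ → ℝ → Prop} (hF : ∀ c x y, 0 < c → F x y → F (c * x) (c * y)) (hF0 : F 0 0) {a : ℝ}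
    (hu : ∀ u, ‖u‖ = 1 → ∫ z, inner ℝ u (whiten ν z.1) ^ 2 ∂ν = 1 →
      F a ((∑ i, inner ℝ u (whiten ν (z i).1) ^ 2) / n))
    {u : EuclideanSpace ℝ (Fin d)} (hS : gramSqrt ν (whiten ν u) = u) :
    F (‖u‖ ^ 2 * a) ((∑ i, inner ℝ u (whiten ν (z i).1) ^ 2) / n) := by
  rcases eq_or_ne u 0 with rfl | h0
  · simpa using hF0
  · have hp : 0 < ‖u‖ := norm_pos_iff.2 h0
    have h1 : ‖‖u‖⁻¹ • u‖ = 1 := by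
      rw [norm_smul, norm_inv, norm_norm, inv_mul_cancel₀ hp.ne']
    have h3 := hu (‖u‖⁻¹ • u) h1 (by
      rw [integral_inner_whiten_sq h2, map_smul, map_smul, hS, h1, one_pow])
    have h4 := hF (‖u‖ ^ 2) _ _ (by positivity) h3
    convert h4 using 1
    simp_rw [real_inner_smul_left, mul_pow]
    rw [← Finset.mul_sum]
    field_simp

/-- A lower bound for the empirical quadratic form gives an upper bound for the error of the
empirical risk minimizer. -/
lemma norm_le_of_form_ge (h2 : MemLp (fun z : EuclideanSpace ℝ (Fin d) × ℝ => z.1) 2 ν)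
    (hθ : ∀ θ' : EuclideanSpace ℝ (Fin d), ∑ i, ((z i).2 - inner ℝ θ (z i).1) ^ 2 ≤
      ∑ i, ((z i).2 - inner ℝ θ' (z i).1) ^ 2)
    (hz : ∀ i, gramSqrt ν (whiten ν (z i).1) = (z i).1) {a : ℝ}
    (hu : ∀ u, ‖u‖ = 1 → ∫ z, inner ℝ u (whiten ν z.1) ^ 2 ∂ν = 1 →
      a ≤ (∑ i, inner ℝ u (whiten ν (z i).1) ^ 2) / n) :
    a * ‖gramSqrt ν (θ - θs)‖ ≤ ‖meanScore ν θs z‖ := by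
  set w := gramSqrt ν (θ - θs) with hw
  have hS : gramSqrt ν (whiten ν w) = w := by
    rw [hw, whiten_gramSqrt_comm, gramSqrt_gramSqrt_whiten]
  have h1 := empirical_form_le_of_unit h2 (F := fun x y => x ≤ y)
    (fun c x y hc h => mul_le_mul_of_nonneg_left h hc.le) le_rfl hu hS
  have h3 := whitened_normal_equations (θs := θs) hθ hz (θ - θs)
  rw [← hw] at h3
  simp_rw [← pow_two] at h3
  rw [h3] at h1
  have h4 := real_inner_le_norm w (meanScore ν θs z)
  rcases (norm_nonneg w).eq_or_lt with h0 | h0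
  · rw [← h0, mul_zero]; exact norm_nonneg _
  · have : ‖w‖ * (a * ‖w‖) ≤ ‖w‖ * ‖meanScore ν θs z‖ := by nlinarith
    exact le_of_mul_le_mul_left this h0

/-- An upper bound for the empirical quadratic form gives a lower bound for the error of the
empirical risk minimizer. -/
lemma norm_ge_of_form_le (h2 : MemLp (fun z : EuclideanSpace ℝ (Fin d) × ℝ => z.1) 2 ν)
    (hθ : ∀ θ' : EuclideanSpace ℝ (Fin d), ∑ i, ((z i).2 - inner ℝ θ (z i).1) ^ 2 ≤
      ∑ i, ((z i).2 - inner ℝ θ' (z i).1) ^ 2)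
    (hz : ∀ i, gramSqrt ν (whiten ν (z i).1) = (z i).1) {b : ℝ} (hb : 0 ≤ b)
    (hu : ∀ u, ‖u‖ = 1 → ∫ z, inner ℝ u (whiten ν z.1) ^ 2 ∂ν = 1 →
      (∑ i, inner ℝ u (whiten ν (z i).1) ^ 2) / n ≤ b) :
    ‖meanScore ν θs z‖ ≤ b * ‖gramSqrt ν (θ - θs)‖ := by
  set w := gramSqrt ν (θ - θs) with hw
  set m := meanScore ν θs z with hm
  have hS : gramSqrt ν (whiten ν w) = w := by
    rw [hw, whiten_gramSqrt_comm, gramSqrt_gramSqrt_whiten]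
  have hS' : gramSqrt ν (whiten ν m) = m := gramSqrt_whiten_meanScore
  have hform : ∀ {u : EuclideanSpace ℝ (Fin d)}, gramSqrt ν (whiten ν u) = u →
      (∑ i, inner ℝ u (whiten ν (z i).1) ^ 2) / n ≤ ‖u‖ ^ 2 * b := fun hu' =>
    empirical_form_le_of_unit h2 (F := fun x y => y ≤ x)
      (fun c x y hc h => mul_le_mul_of_nonneg_left h hc.le) le_rfl hu hu'
  have h3 := whitened_normal_equations (θs := θs) hθ hz (whiten ν m)
  rw [← hw, hS', ← hm, real_inner_self_eq_norm_sq] at h3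
  have hcs := Finset.sum_mul_sq_le_sq_mul_sq Finset.univ
    (fun i => inner ℝ w (whiten ν (z i).1)) (fun i => inner ℝ m (whiten ν (z i).1))
  have h4 : (‖m‖ ^ 2) ^ 2 ≤ (‖w‖ ^ 2 * b) * (‖m‖ ^ 2 * b) := by
    calc (‖m‖ ^ 2) ^ 2 ≤ ((∑ i, inner ℝ w (whiten ν (z i).1) ^ 2) / n) *
          ((∑ i, inner ℝ m (whiten ν (z i).1) ^ 2) / n) := by
          rw [← h3, div_pow, div_mul_div_comm, ← pow_two (n : ℝ)]
          gcongr
      _ ≤ _ := mul_le_mul (hform hS) (hform hS')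
          (div_nonneg (Finset.sum_nonneg fun i _ => sq_nonneg _) n.cast_nonneg) (by positivity)
  rcases (norm_nonneg m).eq_or_lt with h0 | h0
  · rw [← h0]; positivity
  · have h5 : ‖m‖ ^ 2 * ‖m‖ ^ 2 ≤ ‖m‖ ^ 2 * (b * ‖w‖) ^ 2 := by nlinarith
    have h6 := le_of_mul_le_mul_left h5 (by positivity)
    exact le_of_sq_le_sq h6 (by positivity)

end

/-! ### The scales of the deviation bounds -/

section

/-- The inverse temperature `√(2 L / ((k - 1) n))`, where `L = log(ε⁻¹) + 0.73 d`. -/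
noncomputable def tempScale (k : ℝ) (d : ℕ) (ε : ℝ) (n : ℕ) : ℝ :=
  √(2 * confTerm d ε / ((k - 1) * n))

/-- The dimension scale `√(k d / n)`. -/
noncomputable def dimScale (k : ℝ) (d n : ℕ) : ℝ := √(k * d / n)

variable {k ε : ℝ} {d n : ℕ}

lemma confTerm_pos (hd : 1 ≤ d) (hε : 0 < ε) (hε1 : ε ≤ 1) : 0 < confTerm d ε := by
  have h1 : 0 ≤ Real.log ε⁻¹ := Real.log_nonneg ((one_le_inv₀ hε).2 hε1)
  have h2 : (1 : ℝ) ≤ d := by exact_mod_cast hd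
  unfold confTerm
  linarith

lemma SampleSizeCond.one_le (h : SampleSizeCond k d ε n) : 1 ≤ n := by
  have h1 : (0 : ℝ) < n := (sq_nonneg _).trans_lt h
  exact_mod_cast h1

lemma tempScale_mul (hk : 1 < k) :
    (k - 1) * tempScale k d ε n = √(2 * (k - 1) / n * confTerm d ε) := by
  have h : 0 < k - 1 := by linarith
  unfold tempScale
  have e : ∀ x : ℝ, (k - 1) * √x = √((k - 1) ^ 2 * x) := fun x => by
    rw [Real.sqrt_mul (sq_nonneg _), Real.sqrt_sq h.le]
  rw [e]
  congr 1
  rcases eq_or_ne (n : ℝ) 0 with h0 | h0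
  · simp [h0]
  · field_simp

lemma mu_eq (hk : 1 < k) :
    mu k d ε n = (k - 1) * tempScale k d ε n + 6.81 * √2 * dimScale k d n := by
  rw [mu, tempScale_mul hk, dimScale, mul_assoc 6.81, ← Real.sqrt_mul (by norm_num)]
  congr 4
  ring

lemma tempScale_sq (hk : 1 < k) (hL : 0 ≤ confTerm d ε) :
    tempScale k d ε n ^ 2 = 2 * confTerm d ε / ((k - 1) * n) := by
  have h : 0 < k - 1 := by linarith
  exact Real.sq_sqrt (by positivity)

lemma gammaMinus_eq (hk : 1 < k) (hL : 0 ≤ confTerm d ε) :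
    gammaMinus k d ε n = tempScale k d ε n ^ 2 / 3 := by
  rw [tempScale_sq hk hL, gammaMinus, div_div]
  congr 1
  ring

lemma sampleSizeCond_iff (hk : 1 < k) (hn : 1 ≤ n) (hL : 0 ≤ confTerm d ε) :
    SampleSizeCond k d ε n ↔
      20 * dimScale k d n + 5 / 2 * ((k - 1) * tempScale k d ε n) + tempScale k d ε n / 2 < 1 := by
  have h : 0 < k - 1 := by linarith
  have hn0 : (0 : ℝ) < n := by exact_mod_cast hn
  have hsn : 0 < √(n : ℝ) := Real.sqrt_pos.2 hn0
  have e1 : √(k * d) = dimScale k d n * √n := by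
    rw [dimScale, ← Real.sqrt_mul (by positivity), div_mul_cancel₀ _ hn0.ne']
  have e2 : √(2 * (k - 1) * confTerm d ε) = (k - 1) * tempScale k d ε n * √n := by
    rw [tempScale_mul hk, ← Real.sqrt_mul (by positivity)]
    congr 1
    field_simp
  have ht : 0 ≤ tempScale k d ε n := Real.sqrt_nonneg _
  have hs : 0 ≤ dimScale k d n := Real.sqrt_nonneg _
  set t := tempScale k d ε n
  set s := dimScale k d n
  have e3 : 20 * (s * √n) + (5 / 2 + 1 / (2 * (k - 1))) * ((k - 1) * t * √n) =
      (20 * s + 5 / 2 * ((k - 1) * t) + t / 2) * √n := by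
    field_simp
    ring
  unfold SampleSizeCond
  rw [e1, e2, e3, mul_pow, Real.sq_sqrt hn0.le, mul_lt_iff_lt_one_left hn0,
    sq_lt_one_iff₀ (by positivity)]

lemma scales (hd : 1 ≤ d) (hn : 1 ≤ n) (hk : 1 < k) (hε : 0 < ε) (hε1 : ε ≤ 1) :
    Scales d n k ε (tempScale k d ε n) (dimScale k d n) := by
  have hL := confTerm_pos hd hε hε1
  have h : 0 < k - 1 := by linarith
  have hn0 : (0 : ℝ) < n := by exact_mod_cast hn
  have hd0 : (0 : ℝ) < d := by exact_mod_cast hd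
  have ht : 0 < 2 * confTerm d ε / ((k - 1) * n) := by positivity
  refine ⟨hd, hn, hk, hε, hε1, Real.sqrt_pos.2 ht, Real.sqrt_pos.2 (by positivity), ?_, ?_⟩
  · rw [dimScale, Real.sq_sqrt (by positivity), div_mul_cancel₀ _ hn0.ne']
  · rw [tempScale_sq hk hL.le]
    field_simp

lemma mu_lt (hk : 1 < k) (hn : 1 ≤ n) (hL : 0 ≤ confTerm d ε) (h : SampleSizeCond k d ε n) :
    mu k d ε n < 0.482 := by
  rw [sampleSizeCond_iff hk hn hL] at h
  rw [mu_eq hk]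
  have ht : 0 ≤ tempScale k d ε n := Real.sqrt_nonneg _
  have hs : 0 ≤ dimScale k d n := Real.sqrt_nonneg _
  have hx : 0 ≤ (k - 1) * tempScale k d ε n := mul_nonneg (by linarith) ht
  have h2 : √2 < 1.4143 := by
    rw [Real.sqrt_lt' (by norm_num)]; norm_num
  nlinarith

lemma mu_nonneg : 0 ≤ mu k d ε n := by unfold mu; positivity

lemma mu_le_deltaHat (h : mu k d ε n < 1 / 2) : mu k d ε n ≤ deltaHat k d ε n := by
  have h0 : 0 ≤ mu k d ε n := mu_nonneg
  rw [deltaHat, le_div_iff₀ (by linarith)]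
  nlinarith

/-- The level of the lower bound for the empirical quadratic form is at least
`(1 - γ₋) / (1 + δ̂)`. -/
lemma form_lower_bound_ge (hk : 1 < k) (hn : 1 ≤ n) (hL : 0 ≤ confTerm d ε)
    (h : SampleSizeCond k d ε n) :
    (1 - gammaMinus k d ε n) / (1 + deltaHat k d ε n) ≤
      1 - ((k - 1) * tempScale k d ε n +
        0.3 * tempScale k d ε n * ((k - 1) * tempScale k d ε n) + 8 * dimScale k d n) := by
  have hm := mu_lt hk hn hL h
  have hm0 : 0 ≤ mu k d ε n := mu_nonneg
  have hme := mu_eq (ε := ε) (d := d) (n := n) hk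
  rw [gammaMinus_eq hk hL]
  have ht : 0 ≤ tempScale k d ε n := Real.sqrt_nonneg _
  have hs : 0 ≤ dimScale k d n := Real.sqrt_nonneg _
  have hx : 0 ≤ (k - 1) * tempScale k d ε n := mul_nonneg (by linarith) ht
  have h2 : 1.414 < √2 := by
    rw [Real.lt_sqrt (by norm_num)]; norm_num
  set m := mu k d ε n
  set t := tempScale k d ε n
  set s := dimScale k d n
  set x := (k - 1) * t
  have e : 1 + deltaHat k d ε n = (1 - m) / (1 - 2 * m) := by
    have : 1 - 2 * m ≠ 0 := by linarith
    change 1 + m / (1 - 2 * m) = _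
    rw [eq_div_iff this, add_mul, div_mul_cancel₀ _ this]
    ring
  have hms : x + 9.6 * s ≤ m := by nlinarith
  rw [e, div_div_eq_mul_div, div_le_iff₀ (by linarith)]
  -- the difference of the two sides is controlled by a definite quadratic form in `m` and `t`
  have hq : 0 ≤ m ^ 2 + t ^ 2 / 3 * (1 - 2 * m) - 0.3 * t * m * (1 - m) := by
    have e2 : m ^ 2 + t ^ 2 / 3 * (1 - 2 * m) - 0.3 * t * m * (1 - m) =
        (m - 0.15 * t * (1 - m)) ^ 2 + t ^ 2 * ((1 - 2 * m) / 3 - 0.0225 * (1 - m) ^ 2) := by ring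
    have h3 : 0 ≤ (1 - 2 * m) / 3 - 0.0225 * (1 - m) ^ 2 := by nlinarith
    rw [e2]
    positivity
  have h4 : x + 0.3 * t * x + 8 * s ≤ m + 0.3 * t * m := by nlinarith
  nlinarith

lemma mul_one_add_le_one {a b : ℝ} (ha : 0 ≤ a) (hb : 0 ≤ b) :
    max (1 - a) 0 * max (1 - b) 0 * (1 + b + a) ≤ 1 := by
  have h1 : max (1 - a) 0 * (1 + a) ≤ 1 := by
    rcases max_cases (1 - a) 0 with ⟨h, _⟩ | ⟨h, _⟩ <;> rw [h] <;> nlinarith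
  have h2 : max (1 - b) 0 * (1 + b) ≤ 1 := by
    rcases max_cases (1 - b) 0 with ⟨h, _⟩ | ⟨h, _⟩ <;> rw [h] <;> nlinarith
  have ha' : 0 ≤ max (1 - a) 0 := le_max_right _ _
  have hb' : 0 ≤ max (1 - b) 0 := le_max_right _ _
  calc max (1 - a) 0 * max (1 - b) 0 * (1 + b + a)
      ≤ max (1 - a) 0 * max (1 - b) 0 * ((1 + a) * (1 + b)) := by
        gcongr; nlinarith
    _ = (max (1 - a) 0 * (1 + a)) * (max (1 - b) 0 * (1 + b)) := by ring
    _ ≤ 1 := mul_le_one₀ h1 (by positivity) h2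

end

/-! ### The constant `C_q` -/

section

variable {q : ℝ}

lemma mul_log_ge {x : ℝ} (hx : 0 ≤ x) : x - 1 ≤ x * Real.log x := by
  rcases hx.eq_or_lt with rfl | h
  · simp
  · have := Real.one_sub_inv_le_log_of_pos h
    have h2 := mul_le_mul_of_nonneg_left this h.le
    rw [mul_sub, mul_inv_cancel₀ h.ne', mul_one] at h2
    exact h2

/-- The constant of `mean_deviation` is `1`, so that `C_q ≥ 1` leaves room. -/
lemma one_le_cq (h1 : 1 ≤ q) (h2 : q ≤ 2) : 1 ≤ cq q := by
  rcases h1.eq_or_lt with rfl | h1'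
  · norm_num [cq]
  rcases h2.eq_or_lt with rfl | h2'
  · norm_num [cq]
  have a1 : 0 < q - 1 := by linarith
  have a2 : 0 < 1 - q / 2 := by linarith
  have hq : 0 < q := by linarith
  unfold cq
  rw [one_le_div (by positivity), ← Real.log_le_log_iff (by positivity) (by positivity),
    Real.log_mul (by positivity) (by positivity), Real.log_mul (by positivity) (by positivity),
    Real.log_rpow a1, Real.log_rpow a2, Real.log_rpow hq]
  -- tangent lines of the logarithm at `1`
  have b1 : Real.log (2 * (q - 1) / q) ≤ 2 * (q - 1) / q - 1 :=
    Real.log_le_sub_one_of_pos (by positivity)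
  rw [Real.log_div (by positivity) hq.ne', Real.log_mul (by norm_num) a1.ne'] at b1
  have b2 : Real.log (2 - q) ≤ 2 - q - 1 := Real.log_le_sub_one_of_pos (by linarith)
  have b3 : Real.log (1 - q / 2) = Real.log (2 - q) - Real.log 2 := by
    rw [← Real.log_div (by linarith) (by norm_num)]; congr 1; ring
  have b4 : Real.log 2 < 2 := by linarith [Real.log_two_lt_d9]
  rw [b3]
  have c1 : q * (Real.log 2 + Real.log (q - 1) - Real.log q) ≤ q - 2 := by
    have := mul_le_mul_of_nonneg_left b1 hq.le
    have e : q * (2 * (q - 1) / q - 1) = q - 2 := by field_simp; ring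
    linarith
  have c2 : (2 - q) * Real.log (2 - q) ≤ (2 - q) * (1 - q) :=
    mul_le_mul_of_nonneg_left (by linarith) (by linarith)
  have e : (2 - q) / q * (Real.log (2 - q) - Real.log 2) =
      ((2 - q) * Real.log (2 - q) - (2 - q) * Real.log 2) / q := by field_simp
  rw [e, ← sub_nonneg]
  have e2 : (q - 1) * Real.log q - (Real.log 2 + (q - 1) * Real.log (q - 1) +
      ((2 - q) * Real.log (2 - q) - (2 - q) * Real.log 2) / q) =
      (q * (q - 1) * (Real.log q - Real.log (q - 1)) - q * Real.log 2 -
        (2 - q) * Real.log (2 - q) + (2 - q) * Real.log 2) / q := by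
    field_simp; ring
  rw [e2]
  apply div_nonneg _ hq.le
  have c3 := mul_le_mul_of_nonneg_left c1 a1.le
  have c4 := mul_nonneg (mul_nonneg a1.le (by linarith : 0 ≤ 2 - q))
    (by linarith : 0 ≤ 2 - Real.log 2)
  nlinarith

lemma cq_le (h1 : 1 ≤ q) (h2 : q ≤ 2) : cq q ≤ Real.exp 3 := by
  have hq : 0 < q := by linarith
  have key : ∀ {x : ℝ}, 0 ≤ x → Real.exp (-1) ≤ x ^ x := by
    intro x hx
    rcases hx.eq_or_lt with rfl | h
    · simp
    · rw [Real.rpow_def_of_pos h]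
      apply Real.exp_le_exp.2
      have := mul_log_ge hx
      linarith
  have k1 : Real.exp (-1) ≤ (q - 1) ^ (q - 1) := key (by linarith)
  have k2 : Real.exp (-2) ≤ (1 - q / 2) ^ ((2 - q) / q) := by
    have h0 : 0 ≤ 1 - q / 2 := by linarith
    have e : (2 - q) / q = (1 - q / 2) * (2 / q) := by field_simp
    rw [e, Real.rpow_mul h0]
    have h3 : (1 - q / 2) ^ (1 - q / 2) ≤ 1 := Real.rpow_le_one h0 (by linarith) h0
    calc Real.exp (-2) = Real.exp (-1) ^ (2 : ℝ) := by
          rw [← Real.exp_mul]; norm_num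
      _ ≤ ((1 - q / 2) ^ (1 - q / 2)) ^ (2 : ℝ) :=
          Real.rpow_le_rpow (Real.exp_pos _).le (key h0) (by norm_num)
      _ ≤ _ := Real.rpow_le_rpow_of_exponent_ge ((Real.exp_pos _).trans_le (key h0)) h3 (by
          rw [div_le_iff₀ hq]; linarith)
  have k3 : q ^ (q - 1) ≤ 2 := by
    calc q ^ (q - 1) ≤ q ^ (1 : ℝ) := Real.rpow_le_rpow_of_exponent_le h1 (by linarith)
      _ ≤ 2 := by rwa [Real.rpow_one]
  have hpos : 0 < 2 * (q - 1) ^ (q - 1) * (1 - q / 2) ^ ((2 - q) / q) :=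
    mul_pos (mul_pos two_pos ((Real.exp_pos _).trans_le k1)) ((Real.exp_pos _).trans_le k2)
  unfold cq
  rw [div_le_iff₀ hpos]
  have e3 : Real.exp 3 * (2 * Real.exp (-1) * Real.exp (-2)) = 2 := by
    have : Real.exp 3 * (Real.exp (-1) * Real.exp (-2)) = 1 := by
      rw [← Real.exp_add, ← Real.exp_add]; norm_num
    linarith
  calc q ^ (q - 1) ≤ 2 := k3
    _ = Real.exp 3 * (2 * Real.exp (-1) * Real.exp (-2)) := e3.symm
    _ ≤ _ := by gcongr

end

/-! ### Two-sided bounds for the excess risk on events of large probability -/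

section

variable {d n : ℕ} {ν : Measure (EuclideanSpace ℝ (Fin d) × ℝ)}
  {θs : EuclideanSpace ℝ (Fin d)} {p q k ε : ℝ}

/-- The quantity `γ̃₊` with the kurtosis coefficient replaced by an arbitrary `k`, and without the
factors `C_q ≥ 1` and `(1 + δ̂)^(p+1) ≥ 1`. -/
noncomputable def gammaBase (ν : Measure (EuclideanSpace ℝ (Fin d) × ℝ)) (k p q ε : ℝ) (n : ℕ) :
    ℝ :=
  1 / (p + 1) * (2 * confTerm d ε / ((k - 1) * n)) ^ (p / 2) *
    (whitenedMoment ν (2 * (p + 1)) + whitenedMoment ν (2 * q * (p + 1)) ^ (1 / q) /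
        (ε ^ (1 / q) * (n : ℝ) ^ (1 - 1 / q)))

/-- The factor by which the excess risk may fall below the squared norm of the mean score. -/
noncomputable def shrinkage (ν : Measure (EuclideanSpace ℝ (Fin d) × ℝ)) (k p q ε : ℝ) (n : ℕ) :
    ℝ :=
  (max (1 - gammaBase ν k p q ε n) 0 * max (1 - mu k d ε n) 0) ^ 2

/-- `z` is a sample whose design vectors all lie in the range of the Gram matrix. -/
def GoodSample (ν : Measure (EuclideanSpace ℝ (Fin d) × ℝ))
    (z : Fin n → EuclideanSpace ℝ (Fin d) × ℝ) : Prop :=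
  ∀ i, gramSqrt ν (whiten ν (z i).1) = (z i).1

/-- `θ` minimizes the empirical risk of the sample `z`. -/
def EmpiricalArgmin (z : Fin n → EuclideanSpace ℝ (Fin d) × ℝ) (θ : EuclideanSpace ℝ (Fin d)) :
    Prop :=
  ∀ θ' : EuclideanSpace ℝ (Fin d), ∑ i, ((z i).2 - inner ℝ θ (z i).1) ^ 2 ≤
    ∑ i, ((z i).2 - inner ℝ θ' (z i).1) ^ 2

lemma whitenedMoment_nonneg (r : ℝ) : 0 ≤ whitenedMoment ν r :=
  integral_nonneg fun _ => Real.rpow_nonneg (norm_nonneg _) r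

lemma gammaBase_nonneg (hp : 1 ≤ p) (hk : 1 < k) (hL : 0 ≤ confTerm d ε) (hε : 0 < ε) :
    0 ≤ gammaBase ν k p q ε n := by
  have h1 := whitenedMoment_nonneg (ν := ν) (2 * (p + 1))
  have h2 := whitenedMoment_nonneg (ν := ν) (2 * q * (p + 1))
  have h3 : 0 ≤ k - 1 := by linarith
  unfold gammaBase
  positivity

lemma min_sq_cube_le_rpow (hp1 : 1 ≤ p) (hp2 : p ≤ 2) {y : ℝ} (hy : 0 ≤ y) :
    min (y ^ 2) (y ^ 3) ≤ y ^ (p + 1) := by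
  rcases hy.eq_or_lt with h0 | h0
  · rw [← h0]; simp [Real.zero_rpow (by linarith : p + 1 ≠ 0)]
  rcases le_total y 1 with h1 | h1
  · refine (min_le_right _ _).trans ?_
    rw [← Real.rpow_natCast]
    exact Real.rpow_le_rpow_of_exponent_ge h0 h1 (by push_cast; linarith)
  · refine (min_le_left _ _).trans ?_
    rw [← Real.rpow_natCast]
    exact Real.rpow_le_rpow_of_exponent_le h1 (by push_cast; linarith)

/-- Interpolation of the remainder of the upper bound for the empirical quadratic form between its
quadratic and its cubic regime. -/
lemma sum_min_div_le {a : Fin n → ℝ} (ha : ∀ i, 0 ≤ a i) {l M : ℝ} (hl : 0 < l) (hp1 : 1 ≤ p)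
    (hp2 : p ≤ 2) (hM : (∑ i, a i ^ (2 * (p + 1))) / n ≤ M) :
    (∑ i, min ((l * a i ^ 2) ^ 2) ((l * a i ^ 2) ^ 3)) / (3 * l * n) ≤ l ^ p / (p + 1) * M := by
  have hs0 : 0 ≤ ∑ i, a i ^ (2 * (p + 1)) :=
    Finset.sum_nonneg fun i _ => Real.rpow_nonneg (ha i) _
  have hM0 : 0 ≤ M := (div_nonneg hs0 n.cast_nonneg).trans hM
  have e3 : ∀ i, min ((l * a i ^ 2) ^ 2) ((l * a i ^ 2) ^ 3) ≤
      l ^ (p + 1) * a i ^ (2 * (p + 1)) := by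
    intro i
    have hi := ha i
    refine (min_sq_cube_le_rpow hp1 hp2 (by positivity)).trans (le_of_eq ?_)
    rw [Real.mul_rpow hl.le (by positivity), Real.rpow_mul hi, Real.rpow_two]
  have h3 : (∑ i, min ((l * a i ^ 2) ^ 2) ((l * a i ^ 2) ^ 3)) ≤
      l ^ (p + 1) * ∑ i, a i ^ (2 * (p + 1)) := by
    rw [Finset.mul_sum]
    exact Finset.sum_le_sum fun i _ => e3 i
  calc _ ≤ (l ^ (p + 1) * ∑ i, a i ^ (2 * (p + 1))) / (3 * l * n) :=
        div_le_div_of_nonneg_right h3 (by positivity)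
    _ = l ^ p / 3 * ((∑ i, a i ^ (2 * (p + 1))) / n) := by
        rw [Real.rpow_add_one hl.ne', div_mul_div_comm]
        rw [show l ^ p * l * (∑ i, a i ^ (2 * (p + 1))) = l * (l ^ p * ∑ i, a i ^ (2 * (p + 1)))
          by ring, show 3 * l * (n : ℝ) = l * (3 * n) by ring, mul_div_mul_left _ _ hl.ne']
    _ ≤ l ^ p / 3 * M := mul_le_mul_of_nonneg_left hM (by positivity)
    _ ≤ l ^ p / (p + 1) * M := by
        refine mul_le_mul_of_nonneg_right ?_ hM0
        exact div_le_div_of_nonneg_left (by positivity) (by linarith) (by linarith)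

lemma shrinkage_nonneg : 0 ≤ shrinkage ν k p q ε n := sq_nonneg _

lemma shrinkage_le_one (hp : 1 ≤ p) (hk : 1 < k) (hL : 0 ≤ confTerm d ε) (hε : 0 < ε) :
    shrinkage ν k p q ε n ≤ 1 := by
  have h1 : max (1 - gammaBase ν k p q ε n) 0 ≤ 1 :=
    max_le (by linarith [gammaBase_nonneg (ν := ν) (q := q) (n := n) hp hk hL hε]) zero_le_one
  have h2 : max (1 - mu k d ε n) 0 ≤ 1 :=
    max_le (by linarith [mu_nonneg (k := k) (d := d) (ε := ε) (n := n)]) zero_le_one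
  exact pow_le_one₀ (mul_nonneg (le_max_right _ _) (le_max_right _ _))
    (mul_le_one₀ h1 (le_max_right _ _) h2)

namespace Assumptions

/-- The upper bound for the excess risk, from the lower bound for the empirical form. -/
lemma exists_sample_upper [IsProbabilityMeasure ν] (h : Assumptions ν θs p q) (hkk : kappa ν ≤ k)
    (hk : 1 < k) (hε : 0 < ε) (hε1 : ε ≤ 1) (hc : SampleSizeCond k d ε n)
    (hγ : gammaMinus k d ε n < 1) :
    ∃ B : Set (Fin n → EuclideanSpace ℝ (Fin d) × ℝ), MeasurableSet B ∧
      (Measure.pi fun _ : Fin n => ν) Bᶜ ≤ ENNReal.ofReal (ε / 4) ∧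
      ∀ z ∈ B, GoodSample ν z → ∀ θ, EmpiricalArgmin z θ →
        excess ν θs θ ≤ ((1 + deltaHat k d ε n) / (1 - gammaMinus k d ε n)) ^ 2 *
          ‖meanScore ν θs z‖ ^ 2 := by
  have hn := hc.one_le
  have hL := confTerm_pos h.one_le_dim hε hε1
  have hm := mu_lt hk hn hL.le hc
  have hδ := mu_le_deltaHat (by linarith : mu k d ε n < 1 / 2)
  have hm0 : 0 ≤ mu k d ε n := mu_nonneg
  have hl3 : tempScale k d ε n ^ 2 < 3 := by
    rw [gammaMinus_eq hk hL.le] at hγ; linarith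
  obtain ⟨B, hB, hQ, hz⟩ := empirical_lower (h.momentBound hkk)
    (scales h.one_le_dim hn hk hε hε1) hl3
  refine ⟨B, hB, hQ, fun z hzB hg θ hθ => ?_⟩
  have h1 := norm_le_of_form_ge (θs := θs) h.memLp_fst hθ hg
    (fun u hu1 hu2 => (form_lower_bound_ge hk hn hL.le hc).trans (hz z hzB u hu1 hu2))
  rw [h.excess_eq, ← mul_pow]
  refine pow_le_pow_left₀ (norm_nonneg _) ?_ 2
  rw [div_mul_eq_mul_div, div_le_iff₀ (by linarith)] at h1
  rw [div_mul_eq_mul_div, le_div_iff₀ (by linarith)]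
  linarith

lemma integrable_whiten_rpow_rpow [IsProbabilityMeasure ν] (h : Assumptions ν θs p q) :
    Integrable (fun z => (‖whiten ν z.1‖ ^ (2 * (p + 1))) ^ q) ν := by
  have h1 := h.one_le_p
  have h2 := h.one_le_q
  have := h.integrable_whiten_rpow (r := 2 * q * (p + 1)) (by positivity) le_rfl
  refine this.congr (ae_of_all _ fun z => ?_)
  change ‖whiten ν z.1‖ ^ (2 * q * (p + 1)) = (‖whiten ν z.1‖ ^ (2 * (p + 1))) ^ q
  rw [← Real.rpow_mul (norm_nonneg _)]
  congr 1
  ring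

lemma integral_whiten_rpow_rpow :
    ∫ z, (‖whiten ν z.1‖ ^ (2 * (p + 1))) ^ q ∂ν = whitenedMoment ν (2 * q * (p + 1)) := by
  refine integral_congr_ae (ae_of_all _ fun z => ?_)
  change _ = ‖whiten ν z.1‖ ^ (2 * q * (p + 1))
  simp only
  rw [← Real.rpow_mul (norm_nonneg _)]
  congr 1
  ring

/-- The lower bound for the excess risk, from the upper bound for the empirical form. The event is
the intersection of those of `empirical_upper` and of `mean_deviation`. -/
lemma exists_sample_lower [IsProbabilityMeasure ν] (h : Assumptions ν θs p q) (hkk : kappa ν ≤ k)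
    (hk : 1 < k) (hε : 0 < ε) (hε1 : ε ≤ 1) (hc : SampleSizeCond k d ε n) :
    ∃ B : Set (Fin n → EuclideanSpace ℝ (Fin d) × ℝ), MeasurableSet B ∧
      (Measure.pi fun _ : Fin n => ν) Bᶜ ≤ ENNReal.ofReal (5 * ε / 4) ∧
      ∀ z ∈ B, GoodSample ν z → ∀ θ, EmpiricalArgmin z θ →
        shrinkage ν k p q ε n * ‖meanScore ν θs z‖ ^ 2 ≤ excess ν θs θ := by
  have hn := hc.one_le
  have hn0 : (0 : ℝ) < n := by exact_mod_cast hn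
  have hp1 := h.one_le_p
  have hp2 := h.p_le_two
  have hL := confTerm_pos h.one_le_dim hε hε1
  have hm0 : 0 ≤ mu k d ε n := mu_nonneg
  have hsc := scales h.one_le_dim hn hk hε hε1
  have hl := hsc.l_pos
  have hs := hsc.s_pos
  have hW : Measurable fun z : EuclideanSpace ℝ (Fin d) × ℝ => ‖whiten ν z.1‖ :=
    (measurable_whiten.comp measurable_fst).norm
  obtain ⟨B₁, hB₁, hQ₁, hz₁⟩ := empirical_upper (h.momentBound hkk) hsc
  obtain ⟨B₂, hB₂, hQ₂, hz₂⟩ := mean_deviation (ν := ν) hn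
    (f := fun z => ‖whiten ν z.1‖ ^ (2 * (p + 1))) (fun z => by positivity)
    (hW.pow_const _) h.one_le_q h.q_le_two h.integrable_whiten_rpow_rpow hε
  have hγ0 : 0 ≤ gammaBase ν k p q ε n := gammaBase_nonneg hp1 hk hL.le hε
  have hγe : gammaBase ν k p q ε n = tempScale k d ε n ^ p / (p + 1) *
      (∫ z, ‖whiten ν z.1‖ ^ (2 * (p + 1)) ∂ν +
        (∫ z, (‖whiten ν z.1‖ ^ (2 * (p + 1))) ^ q ∂ν) ^ (1 / q) /
          (ε ^ (1 / q) * (n : ℝ) ^ (1 - 1 / q))) := by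
    rw [integral_whiten_rpow_rpow]
    have : ((2 : ℕ) : ℝ) * (p / 2) = p := by push_cast; ring
    rw [gammaBase, ← tempScale_sq hk hL.le, ← Real.rpow_natCast, ← Real.rpow_mul hl.le, this,
      one_div_mul_eq_div]
    rfl
  set γ := gammaBase ν k p q ε n with hγ
  refine ⟨B₁ ∩ B₂, hB₁.inter hB₂, ?_, fun z hz hg θ hθ => ?_⟩
  · rw [Set.compl_inter]
    refine (measure_union_le _ _).trans ((add_le_add hQ₁ hQ₂).trans (le_of_eq ?_))
    rw [← ENNReal.ofReal_add (by positivity) hε.le]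
    congr 1
    ring
  · have hb : ∀ u : EuclideanSpace ℝ (Fin d), ‖u‖ = 1 →
        ∫ z, inner ℝ u (whiten ν z.1) ^ 2 ∂ν = 1 →
        (∑ i, inner ℝ u (whiten ν (z i).1) ^ 2) / n ≤ 1 + mu k d ε n + γ := by
      intro u hu1 hu2
      refine (hz₁ z hz.1 u hu1 hu2).trans ?_
      have h2 : 1.414 < √2 := by
        rw [Real.lt_sqrt (by norm_num)]; norm_num
      have e1 : (k - 1) * tempScale k d ε n + 9 * dimScale k d n ≤ mu k d ε n := by
        rw [mu_eq hk]; nlinarith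
      have e2 : (∑ i, min ((tempScale k d ε n * ‖whiten ν (z i).1‖ ^ 2) ^ 2)
          ((tempScale k d ε n * ‖whiten ν (z i).1‖ ^ 2) ^ 3)) / (3 * tempScale k d ε n * n) ≤
          γ := by
        rw [hγe]
        exact sum_min_div_le (fun i => norm_nonneg _) hl hp1 hp2 (hz₂ z hz.2)
      linarith
    have h1 := norm_ge_of_form_le (θs := θs) h.memLp_fst hθ hg
      (b := 1 + mu k d ε n + γ) (by positivity) hb
    have h3 := mul_one_add_le_one hγ0 hm0
    rw [h.excess_eq, shrinkage, ← mul_pow]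
    have h4 : 0 ≤ max (1 - γ) 0 * max (1 - mu k d ε n) 0 :=
      mul_nonneg (le_max_right _ _) (le_max_right _ _)
    refine pow_le_pow_left₀ (mul_nonneg h4 (norm_nonneg _)) ?_ 2
    calc _ ≤ max (1 - γ) 0 * max (1 - mu k d ε n) 0 *
          ((1 + mu k d ε n + γ) * ‖gramSqrt ν (θ - θs)‖) := mul_le_mul_of_nonneg_left h1 h4
      _ = (max (1 - γ) 0 * max (1 - mu k d ε n) 0 * (1 + mu k d ε n + γ)) *
          ‖gramSqrt ν (θ - θs)‖ := by ring
      _ ≤ 1 * ‖gramSqrt ν (θ - θs)‖ := by gcongr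
      _ = _ := one_mul _

lemma measurable_excess (h : Assumptions ν θs p q) : Measurable (excess ν θs) := by
  have : excess ν θs = fun θ => ‖gramSqrt ν (θ - θs)‖ ^ 2 := funext h.excess_eq
  rw [this]
  exact (measurable_gramSqrt.comp (measurable_id.sub_const θs)).norm.pow_const 2

lemma excess_nonneg (h : Assumptions ν θs p q) (θ : EuclideanSpace ℝ (Fin d)) :
    0 ≤ excess ν θs θ := by
  rw [h.excess_eq]; positivity

end Assumptions

namespace IsERM

variable {S : Type*} [MeasurableSpace S] {P : Measure S}
  {Z : Fin n → S → EuclideanSpace ℝ (Fin d) × ℝ} {θhat : S → EuclideanSpace ℝ (Fin d)}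

lemma hasLaw_sample (hE : IsERM ν P Z θhat) :
    HasLaw (fun ω i => Z i ω) (Measure.pi fun _ : Fin n => ν) P :=
  hE.indep.hasLaw_pi hE.law

/-- A set of samples is transferred to an event on the probability space. The sample is only almost
everywhere measurable, hence the exceptional null set. -/
lemma exists_event [IsProbabilityMeasure ν] (hE : IsERM ν P Z θhat)
    {B : Set (Fin n → EuclideanSpace ℝ (Fin d) × ℝ)}
    (hB : MeasurableSet B) : ∃ A : Set S, MeasurableSet A ∧
      P Aᶜ = (Measure.pi fun _ : Fin n => ν) Bᶜ ∧
      ∀ᵐ ω ∂P, ω ∈ A → (fun i => Z i ω) ∈ B := by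
  have hl := hE.hasLaw_sample
  refine ⟨hl.aemeasurable.mk _ ⁻¹' B, hl.aemeasurable.measurable_mk hB, ?_, ?_⟩
  · rw [← Set.preimage_compl, ← Measure.map_apply hl.aemeasurable.measurable_mk hB.compl,
      ← Measure.map_congr hl.aemeasurable.ae_eq_mk, hl.map_eq]
  · filter_upwards [hl.aemeasurable.ae_eq_mk] with ω hω hA
    rw [hω]
    exact hA

lemma ae_goodSample (hE : IsERM ν P Z θhat) (h : Assumptions ν θs p q) :
    ∀ᵐ ω ∂P, GoodSample ν (fun i => Z i ω) := by
  unfold GoodSample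
  rw [ae_all_iff]
  intro i
  refine ae_of_ae_map (f := Z i) (p := fun z => gramSqrt ν (whiten ν z.1) = z.1)
    (hE.law i).aemeasurable ?_
  rw [(hE.law i).map_eq]
  exact ae_gramSqrt_whiten h.memLp_fst

lemma error_upper [IsProbabilityMeasure ν] (hE : IsERM ν P Z θhat) (h : Assumptions ν θs p q)
    (hkk : kappa ν ≤ k) (hk : 1 < k) (hε : 0 < ε) (hε1 : ε ≤ 1) (hc : SampleSizeCond k d ε n)
    (hγ : gammaMinus k d ε n < 1) :
    ∃ A : Set S, MeasurableSet A ∧ P.real Aᶜ ≤ ε / 4 ∧ ∀ᵐ ω ∂P, ω ∈ A →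
      excess ν θs (θhat ω) ≤ ((1 + deltaHat k d ε n) / (1 - gammaMinus k d ε n)) ^ 2 *
        ‖meanScore ν θs (fun i => Z i ω)‖ ^ 2 := by
  obtain ⟨B, hB, hQ, hz⟩ := h.exists_sample_upper hkk hk hε hε1 hc hγ
  obtain ⟨A, hA, hP, hAB⟩ := hE.exists_event hB
  refine ⟨A, hA, ENNReal.toReal_le_of_le_ofReal (by positivity) (hP.trans_le hQ), ?_⟩
  filter_upwards [hAB, hE.ae_goodSample h, hE.isArgmin] with ω h1 h2 h3 h4
  exact hz _ (h1 h4) h2 _ h3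

lemma error_lower [IsProbabilityMeasure ν] (hE : IsERM ν P Z θhat) (h : Assumptions ν θs p q)
    (hkk : kappa ν ≤ k) (hk : 1 < k) (hε : 0 < ε) (hε1 : ε ≤ 1) (hc : SampleSizeCond k d ε n) :
    ∃ A : Set S, MeasurableSet A ∧ P.real Aᶜ ≤ 5 * ε / 4 ∧ ∀ᵐ ω ∂P, ω ∈ A →
      shrinkage ν k p q ε n * ‖meanScore ν θs (fun i => Z i ω)‖ ^ 2 ≤
        excess ν θs (θhat ω) := by
  obtain ⟨B, hB, hQ, hz⟩ := h.exists_sample_lower hkk hk hε hε1 hc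
  obtain ⟨A, hA, hP, hAB⟩ := hE.exists_event hB
  refine ⟨A, hA, ENNReal.toReal_le_of_le_ofReal (by positivity) (hP.trans_le hQ), ?_⟩
  filter_upwards [hAB, hE.ae_goodSample h, hE.isArgmin] with ω h1 h2 h3 h4
  exact hz _ (h1 h4) h2 _ h3

lemma aestronglyMeasurable_excess (hE : IsERM ν P Z θhat) (h : Assumptions ν θs p q) :
    AEStronglyMeasurable (fun ω => excess ν θs (θhat ω)) P :=
  (h.measurable_excess.comp_aemeasurable hE.aemeasurable).aestronglyMeasurable

/-- The second and fourth moments of the mean score. -/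
lemma moments_meanScore [IsProbabilityMeasure ν] (hE : IsERM ν P Z θhat) (h : Assumptions ν θs p q)
    (hn : 1 ≤ n) :
    Integrable (fun ω => ‖meanScore ν θs (fun i => Z i ω)‖ ^ 4) P ∧
    Integrable (fun ω => ‖meanScore ν θs (fun i => Z i ω)‖ ^ 2) P ∧
    ∫ ω, ‖meanScore ν θs (fun i => Z i ω)‖ ^ 2 ∂P = rateConst ν θs / n ∧
    ∫ ω, ‖meanScore ν θs (fun i => Z i ω)‖ ^ 4 ∂P ≤
      3 * (rateConst ν θs / n) ^ 2 * (1 + (kappa' ν θs - 3) / (3 * n)) := by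
  have hn0 : (0 : ℝ) < n := by exact_mod_cast hn
  obtain ⟨i4, -, m2, m4⟩ := moments_sum measurable_score h.integrable_score_four
    h.score_centered n
  have hl := hE.hasLaw_sample
  set Q := Measure.pi fun _ : Fin n => ν
  have hm : Measurable fun z : Fin n → EuclideanSpace ℝ (Fin d) × ℝ => ∑ i, score ν θs (z i) :=
    Finset.measurable_sum _ fun i _ => measurable_score.comp (measurable_pi_apply i)
  have i2 : Integrable (fun z : Fin n → EuclideanSpace ℝ (Fin d) × ℝ =>
    ‖∑ i, score ν θs (z i)‖ ^ 2) Q := integrable_norm_sq_of_four hm i4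
  have e : ∀ (z : Fin n → EuclideanSpace ℝ (Fin d) × ℝ) (m : ℕ), ‖meanScore ν θs z‖ ^ m =
      ((n : ℝ) ^ m)⁻¹ * ‖∑ i, score ν θs (z i)‖ ^ m := by
    intro z m
    rw [meanScore, norm_smul, mul_pow, norm_inv, inv_pow, Real.norm_eq_abs, abs_of_pos hn0]
  have j : ∀ {m : ℕ}, Integrable (fun z : Fin n → EuclideanSpace ℝ (Fin d) × ℝ =>
      ‖∑ i, score ν θs (z i)‖ ^ m) Q →
      Integrable (fun ω => ‖meanScore ν θs (fun i => Z i ω)‖ ^ m) P := by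
    intro m hi
    simp_rw [e]
    rw [← hl.map_eq] at hi
    exact (hi.comp_aemeasurable hl.aemeasurable).const_mul _
  have c : ∀ m : ℕ, ∫ ω, ‖meanScore ν θs (fun i => Z i ω)‖ ^ m ∂P =
      ((n : ℝ) ^ m)⁻¹ * ∫ z, ‖∑ i, score ν θs (z i)‖ ^ m ∂Q := by
    intro m
    simp_rw [e, integral_const_mul]
    congr 1
    have := hl.integral_comp (f := fun z => ‖∑ i, score ν θs (z i)‖ ^ m)
      (hm.norm.pow_const m).aestronglyMeasurable
    exact this
  refine ⟨j i4, j i2, ?_, ?_⟩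
  · rw [c, m2, Assumptions.integral_score_sq]
    field_simp
  · rw [c, inv_mul_le_iff₀ (by positivity)]
    rw [Assumptions.integral_score_sq, h.integral_score_four] at m4
    refine m4.trans (le_of_eq ?_)
    field_simp
    ring

lemma integrable_min_excess [IsProbabilityMeasure P] (hE : IsERM ν P Z θhat)
    (h : Assumptions ν θs p q) {M : ℝ} (hM : 0 < M) :
    Integrable (fun ω => min (excess ν θs (θhat ω)) M) P := by
  refine Integrable.of_bound
    ((hE.aestronglyMeasurable_excess h).inf aestronglyMeasurable_const) M (ae_of_all _ fun ω => ?_)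
  rw [Real.norm_eq_abs]
  rw [abs_of_nonneg (le_min (h.excess_nonneg _) hM.le)]
  exact min_le_right _ _

/-- Markov's inequality for the truncated excess risk. -/
lemma measureReal_excess_ge_le [IsProbabilityMeasure P] (hE : IsERM ν P Z θhat)
    (h : Assumptions ν θs p q) {M : ℝ} (hM : 0 < M) :
    P.real {ω | M ≤ excess ν θs (θhat ω)} ≤
      (∫ ω, min (excess ν θs (θhat ω)) M ∂P) / M := by
  have h1 := mul_meas_ge_le_integral_of_nonneg
    (ae_of_all _ fun ω => le_min (h.excess_nonneg _) hM.le) (hE.integrable_min_excess h hM) M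
  have e : {ω | M ≤ min (excess ν θs (θhat ω)) M} = {ω | M ≤ excess ν θs (θhat ω)} := by
    ext ω; simp
  rw [e] at h1
  rw [le_div_iff₀ hM]
  linarith

end IsERM

namespace Assumptions

lemma gammaBase_le_gammaPlus (h : Assumptions ν θs p q) (hk : 1 < kappa ν) (hε : 0 < ε)
    (hL : 0 ≤ confTerm d ε) (hμ : mu (kappa ν) d ε n < 1 / 2) :
    gammaBase ν (kappa ν) p q ε n ≤ gammaPlus ν p q ε n := by
  have hp1 := h.one_le_p
  have hcq := one_le_cq h.one_le_q h.q_le_two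
  have hδ : 0 ≤ deltaHat (kappa ν) d ε n := mu_nonneg.trans (mu_le_deltaHat hμ)
  have h1 := whitenedMoment_nonneg (ν := ν) (2 * (p + 1))
  have h2 := whitenedMoment_nonneg (ν := ν) (2 * q * (p + 1))
  have h3 : 0 ≤ kappa ν - 1 := by linarith
  unfold gammaBase gammaPlus
  refine mul_le_mul ?_ ?_ (by positivity) (by positivity)
  · exact le_mul_of_one_le_right (by positivity) (Real.one_le_rpow (by linarith) (by linarith))
  · gcongr
    exact le_mul_of_one_le_left (by positivity) hcq

lemma lowerFactor_le_shrinkage (h : Assumptions ν θs p q) (hk : 1 < kappa ν) (hε : 0 < ε)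
    (hε1 : ε ≤ 1) (hc : SampleSizeCond (kappa ν) d ε n) :
    lowerFactor ν p q ε n ≤ shrinkage ν (kappa ν) p q ε n := by
  have hL := confTerm_pos h.one_le_dim hε hε1
  have hμ : mu (kappa ν) d ε n < 1 / 2 := by
    linarith [mu_lt hk hc.one_le hL.le hc]
  have h1 := h.gammaBase_le_gammaPlus hk hε hL.le hμ
  have h2 := mu_le_deltaHat hμ
  unfold lowerFactor shrinkage
  rw [← mul_pow]
  gcongr

end Assumptions

end

/-! ### Expectations of the excess risk on an event and of the truncated excess risk -/

section

/-- The Cauchy–Schwarz inequality on the complement of an event. -/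
lemma integral_sub_sqrt_le_setIntegral {S : Type*} [MeasurableSpace S] {P : Measure S}
    [IsProbabilityMeasure P] {X : S → ℝ} (hX : Integrable X P)
    (hX2 : Integrable (fun ω => X ω ^ 2) P) {A : Set S} (hA : MeasurableSet A) {b m : ℝ}
    (hb : ∫ ω, X ω ^ 2 ∂P ≤ b) (hm : P.real Aᶜ ≤ m) :
    ∫ ω, X ω ∂P - √(b * m) ≤ ∫ ω in A, X ω ∂P := by
  have h1 := integral_add_compl hA hX
  have hb0 : 0 ≤ b := (integral_nonneg fun ω => sq_nonneg _).trans hb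
  have hm0 : 0 ≤ m := measureReal_nonneg.trans hm
  suffices h : (∫ ω in Aᶜ, X ω ∂P) ≤ √(b * m) by linarith
  refine Real.le_sqrt_of_sq_le ?_
  set a := ∫ ω in Aᶜ, X ω ∂P with ha
  have h2 : ∫ ω in Aᶜ, X ω ^ 2 ∂P ≤ b :=
    (setIntegral_le_integral hX2 (ae_of_all _ fun ω => sq_nonneg _)).trans hb
  have key : ∀ t : ℝ, 0 ≤ b - 2 * t * a + t ^ 2 * m := by
    intro t
    have h3 : 0 ≤ ∫ ω in Aᶜ, (X ω - t) ^ 2 ∂P := integral_nonneg fun ω => sq_nonneg _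
    have e : ∀ ω, (X ω - t) ^ 2 = X ω ^ 2 - 2 * t * X ω + t ^ 2 := fun ω => by ring
    have i1 : Integrable (fun ω => X ω ^ 2 - 2 * t * X ω) (P.restrict Aᶜ) :=
      hX2.restrict.sub (hX.restrict.const_mul _)
    simp_rw [e] at h3
    rw [integral_add i1 (integrable_const _), integral_sub hX2.restrict (hX.restrict.const_mul _),
      integral_const_mul, setIntegral_const, smul_eq_mul] at h3
    have h4 : P.real Aᶜ * t ^ 2 ≤ m * t ^ 2 := by gcongr
    linarith
  have h5 := discrim_le_zero (a := m) (b := -2 * a) (c := b) fun t => by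
    have := key t; nlinarith
  rw [discrim] at h5
  nlinarith

variable {d n : ℕ} {ν : Measure (EuclideanSpace ℝ (Fin d) × ℝ)} [IsProbabilityMeasure ν]
  {θs : EuclideanSpace ℝ (Fin d)} {p q k ε : ℝ}
  {S : Type*} [MeasurableSpace S] {P : Measure S} [IsProbabilityMeasure P]
  {Z : Fin n → S → EuclideanSpace ℝ (Fin d) × ℝ} {θhat : S → EuclideanSpace ℝ (Fin d)}

lemma Assumptions.kurtosis_factor_nonneg (h : Assumptions ν θs p q) (hn : 1 ≤ n) :
    0 ≤ 1 + (kappa' ν θs - 3) / (3 * n) := by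
  have h1 := h.one_le_kappa'
  have hn0 : (1 : ℝ) ≤ n := by exact_mod_cast hn
  have e : 1 + (kappa' ν θs - 3) / (3 * n) = (3 * n + (kappa' ν θs - 3)) / (3 * n) := by
    field_simp
  rw [e]
  apply div_nonneg <;> linarith

lemma sqrt_six_eq {r B : ℝ} (hr : 0 ≤ r) (hB : 0 ≤ B) :
    √(3 * r ^ 2 * B * (2 * ε)) = r * (√6 * √B * √ε) := by
  rw [show 3 * r ^ 2 * B * (2 * ε) = r ^ 2 * (6 * B * ε) by ring, Real.sqrt_mul (sq_nonneg r),
    Real.sqrt_sq hr, Real.sqrt_mul (by positivity), Real.sqrt_mul (by norm_num)]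

namespace IsERM

/-- The squared norm of the mean score on an event of large probability. -/
lemma setIntegral_meanScore_ge (hE : IsERM ν P Z θhat) (h : Assumptions ν θs p q) (hn : 1 ≤ n)
    {A : Set S} (hA : MeasurableSet A) (hPA : P.real Aᶜ ≤ 2 * ε) :
    (1 - √6 * √(1 + (kappa' ν θs - 3) / (3 * n)) * √ε) * (rateConst ν θs / n) ≤
      ∫ ω in A, ‖meanScore ν θs (fun i => Z i ω)‖ ^ 2 ∂P := by
  obtain ⟨i4, i2, m2, m4⟩ := hE.moments_meanScore h hn
  have hB := h.kurtosis_factor_nonneg hn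
  have hr : 0 ≤ rateConst ν θs / n := div_nonneg h.rateConst_pos.le n.cast_nonneg
  have e4 : ∀ x : ℝ, (x ^ 2) ^ 2 = x ^ 4 := fun x => by ring
  have h1 := integral_sub_sqrt_le_setIntegral i2 (by simp_rw [e4]; exact i4) hA
    (by simp_rw [e4]; exact m4) hPA
  rw [m2, sqrt_six_eq hr hB] at h1
  linarith

/-- The two bounds for the excess risk hold on the intersection of the events of `error_upper` and
`error_lower`. The upper bound is integrated directly, and the lower bound loses the contribution
of the complement to the second moment of the mean score. -/
theorem exists_event_integral_bounds (hE : IsERM ν P Z θhat) (h : Assumptions ν θs p q)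
    (hkk : kappa ν ≤ k) (hk : 1 < k) (hε : 0 < ε) (hε1 : ε ≤ 1) (hc : SampleSizeCond k d ε n)
    (hγ : gammaMinus k d ε n < 1) :
    ∃ A : Set S, MeasurableSet A ∧ 1 - 3 / 2 * ε ≤ P.real A ∧
      IntegrableOn (fun ω => excess ν θs (θhat ω)) A P ∧
      shrinkage ν k p q ε n *
        ((1 - √6 * √(1 + (kappa' ν θs - 3) / (3 * n)) * √ε) * (rateConst ν θs / n)) ≤
        ∫ ω in A, excess ν θs (θhat ω) ∂P ∧
      ∫ ω in A, excess ν θs (θhat ω) ∂P ≤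
        ((1 + deltaHat k d ε n) / (1 - gammaMinus k d ε n)) ^ 2 * (rateConst ν θs / n) := by
  have hn := hc.one_le
  obtain ⟨A₁, hA₁, hP₁, h₁⟩ := hE.error_upper h hkk hk hε hε1 hc hγ
  obtain ⟨A₂, hA₂, hP₂, h₂⟩ := hE.error_lower h hkk hk hε hε1 hc
  obtain ⟨i4, i2, m2, m4⟩ := hE.moments_meanScore h hn
  have hA := hA₁.inter hA₂
  have hPA : P.real (A₁ ∩ A₂)ᶜ ≤ 3 / 2 * ε := by
    rw [Set.compl_inter]
    refine (measureReal_union_le _ _).trans ?_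
    linarith
  set U := ((1 + deltaHat k d ε n) / (1 - gammaMinus k d ε n)) ^ 2
  have hU : 0 ≤ U := sq_nonneg _
  have hup : ∀ᵐ ω ∂(P.restrict (A₁ ∩ A₂)), excess ν θs (θhat ω) ≤
      U * ‖meanScore ν θs (fun i => Z i ω)‖ ^ 2 := by
    rw [ae_restrict_iff' hA]
    filter_upwards [h₁] with ω hω hωA using hω hωA.1
  have hlo : ∀ᵐ ω ∂(P.restrict (A₁ ∩ A₂)), shrinkage ν k p q ε n *
      ‖meanScore ν θs (fun i => Z i ω)‖ ^ 2 ≤ excess ν θs (θhat ω) := by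
    rw [ae_restrict_iff' hA]
    filter_upwards [h₂] with ω hω hωA using hω hωA.2
  have hint : IntegrableOn (fun ω => excess ν θs (θhat ω)) (A₁ ∩ A₂) P := by
    refine (i2.restrict.const_mul U).mono' (hE.aestronglyMeasurable_excess h).restrict ?_
    filter_upwards [hup] with ω hω
    rwa [Real.norm_eq_abs, abs_of_nonneg (h.excess_nonneg _)]
  refine ⟨A₁ ∩ A₂, hA, ?_, hint, ?_, ?_⟩
  · rw [probReal_compl_eq_one_sub hA] at hPA
    linarith
  · calc _ ≤ shrinkage ν k p q ε n *
          ∫ ω in A₁ ∩ A₂, ‖meanScore ν θs (fun i => Z i ω)‖ ^ 2 ∂P :=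
          mul_le_mul_of_nonneg_left (hE.setIntegral_meanScore_ge h hn hA (by linarith))
            shrinkage_nonneg
      _ ≤ _ := by
          rw [← integral_const_mul]
          exact integral_mono_ae (i2.restrict.const_mul _) hint hlo
  · calc _ ≤ ∫ ω in A₁ ∩ A₂, U * ‖meanScore ν θs (fun i => Z i ω)‖ ^ 2 ∂P :=
          integral_mono_ae hint (i2.restrict.const_mul _) hup
      _ ≤ U * ∫ ω, ‖meanScore ν θs (fun i => Z i ω)‖ ^ 2 ∂P := by
          rw [integral_const_mul]
          exact mul_le_mul_of_nonneg_left
            (setIntegral_le_integral i2 (ae_of_all _ fun ω => by positivity)) hU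
      _ = _ := by rw [m2]

/-- The lower bound rests on the inequality `x - x² / (4 M) ≤ min x M`. -/
theorem integral_min_excess_ge (hE : IsERM ν P Z θhat) (h : Assumptions ν θs p q)
    (hkk : kappa ν ≤ k) (hk : 1 < k) (hε : 0 < ε) (hε1 : ε ≤ 1) (hc : SampleSizeCond k d ε n)
    {M : ℝ} (hM : 0 < M) :
    shrinkage ν k p q ε n *
      (1 - 3 * rateConst ν θs / (4 * M * n) * (1 + (kappa' ν θs - 3) / (3 * n))
        - √6 * √(1 + (kappa' ν θs - 3) / (3 * n)) * √ε) ≤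
      n / rateConst ν θs * ∫ ω, min (excess ν θs (θhat ω)) M ∂P := by
  have hn := hc.one_le
  have hn0 : (0 : ℝ) < n := by exact_mod_cast hn
  have hC := h.rateConst_pos
  have hp1 := h.one_le_p
  have hL := confTerm_pos h.one_le_dim hε hε1
  obtain ⟨A, hA, hP, hlow⟩ := hE.error_lower h hkk hk hε hε1 hc
  obtain ⟨i4, i2, m2, m4⟩ := hE.moments_meanScore h hn
  have hc1 : shrinkage ν k p q ε n ≤ 1 := shrinkage_le_one hp1 hk hL.le hε
  have hc0 : 0 ≤ shrinkage ν k p q ε n := shrinkage_nonneg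
  set c := shrinkage ν k p q ε n
  set B := 1 + (kappa' ν θs - 3) / (3 * n)
  set r := rateConst ν θs / n with hr
  have imin := hE.integrable_min_excess h hM
  have h1 := hE.setIntegral_meanScore_ge h hn hA (ε := ε) (by linarith)
  have h2 : ∫ ω in A, ‖meanScore ν θs (fun i => Z i ω)‖ ^ 4 ∂P ≤ 3 * r ^ 2 * B :=
    (setIntegral_le_integral i4 (ae_of_all _ fun ω => by positivity)).trans m4
  have hpt : ∀ᵐ ω ∂(P.restrict A), c * (‖meanScore ν θs (fun i => Z i ω)‖ ^ 2 -
      (4 * M)⁻¹ * ‖meanScore ν θs (fun i => Z i ω)‖ ^ 4) ≤ min (excess ν θs (θhat ω)) M := by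
    rw [ae_restrict_iff' hA]
    filter_upwards [hlow] with ω hω hωA
    have h3 := hω hωA
    set y := ‖meanScore ν θs (fun i => Z i ω)‖ ^ 2 with hy
    have hy0 : 0 ≤ y := sq_nonneg _
    have e : ‖meanScore ν θs (fun i => Z i ω)‖ ^ 4 = y ^ 2 := by rw [hy]; ring
    rw [e]
    have h4 : y - (4 * M)⁻¹ * y ^ 2 ≤ y := by
      have : 0 ≤ (4 * M)⁻¹ * y ^ 2 := by positivity
      linarith
    have h5 : y - (4 * M)⁻¹ * y ^ 2 ≤ M := by
      have : M - (y - (4 * M)⁻¹ * y ^ 2) = (4 * M)⁻¹ * (y - 2 * M) ^ 2 := by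
        field_simp; ring
      have : 0 ≤ (4 * M)⁻¹ * (y - 2 * M) ^ 2 := by positivity
      linarith
    refine le_min ((mul_le_mul_of_nonneg_left h4 hc0).trans h3) ?_
    calc c * (y - (4 * M)⁻¹ * y ^ 2) ≤ c * M := mul_le_mul_of_nonneg_left h5 hc0
      _ ≤ M := mul_le_of_le_one_left hM.le hc1
  have hmain : c * ((1 - √6 * √B * √ε) * r - (4 * M)⁻¹ * (3 * r ^ 2 * B)) ≤
      ∫ ω, min (excess ν θs (θhat ω)) M ∂P := by
    calc _ ≤ c * (∫ ω in A, ‖meanScore ν θs (fun i => Z i ω)‖ ^ 2 ∂P -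
          (4 * M)⁻¹ * ∫ ω in A, ‖meanScore ν θs (fun i => Z i ω)‖ ^ 4 ∂P) := by
          refine mul_le_mul_of_nonneg_left (sub_le_sub h1 ?_) hc0
          exact mul_le_mul_of_nonneg_left h2 (by positivity)
      _ = ∫ ω in A, c * (‖meanScore ν θs (fun i => Z i ω)‖ ^ 2 -
          (4 * M)⁻¹ * ‖meanScore ν θs (fun i => Z i ω)‖ ^ 4) ∂P := by
          rw [integral_const_mul, integral_sub i2.restrict (i4.restrict.const_mul _),
            integral_const_mul]
      _ ≤ ∫ ω in A, min (excess ν θs (θhat ω)) M ∂P :=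
          integral_mono_ae ((i2.restrict.sub (i4.restrict.const_mul _)).const_mul _)
            imin.restrict hpt
      _ ≤ _ := setIntegral_le_integral imin
          (ae_of_all _ fun ω => le_min (h.excess_nonneg _) hM.le)
  have e : c * (1 - 3 * rateConst ν θs / (4 * M * n) * B - √6 * √B * √ε) =
      n / rateConst ν θs * (c * ((1 - √6 * √B * √ε) * r - (4 * M)⁻¹ * (3 * r ^ 2 * B))) := by
    rw [hr]; field_simp; ring
  rw [e]
  exact mul_le_mul_of_nonneg_left hmain (by positivity)

/-- The exceptional event contributes at most `M` times its probability. -/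
theorem integral_min_excess_le (hE : IsERM ν P Z θhat) (h : Assumptions ν θs p q)
    (hkk : kappa ν ≤ k) (hk : 1 < k) (hε : 0 < ε) (hε1 : ε ≤ 1) (hc : SampleSizeCond k d ε n)
    (hγ : gammaMinus k d ε n < 1) {M : ℝ} (hM : 0 < M) :
    ∫ ω, min (excess ν θs (θhat ω)) M ∂P ≤
      ((1 + deltaHat k d ε n) / (1 - gammaMinus k d ε n)) ^ 2 * (rateConst ν θs / n) +
        M * (ε / 4) := by
  have hn := hc.one_le
  obtain ⟨A, hA, hP, hup⟩ := hE.error_upper h hkk hk hε hε1 hc hγ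
  obtain ⟨-, i2, m2, -⟩ := hE.moments_meanScore h hn
  set U := ((1 + deltaHat k d ε n) / (1 - gammaMinus k d ε n)) ^ 2
  have hU : 0 ≤ U := sq_nonneg _
  have imin := hE.integrable_min_excess h hM
  rw [← integral_add_compl hA imin]
  refine add_le_add ?_ ?_
  · calc _ ≤ ∫ ω in A, U * ‖meanScore ν θs (fun i => Z i ω)‖ ^ 2 ∂P := by
          refine integral_mono_ae imin.restrict (i2.restrict.const_mul _) ?_
          change ∀ᵐ ω ∂(P.restrict A), min (excess ν θs (θhat ω)) M ≤
            U * ‖meanScore ν θs (fun i => Z i ω)‖ ^ 2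
          rw [ae_restrict_iff' hA]
          filter_upwards [hup] with ω hω hωA
          exact (min_le_left _ _).trans (hω hωA)
      _ ≤ U * ∫ ω, ‖meanScore ν θs (fun i => Z i ω)‖ ^ 2 ∂P := by
          rw [integral_const_mul]
          exact mul_le_mul_of_nonneg_left
            (setIntegral_le_integral i2 (ae_of_all _ fun ω => by positivity)) hU
      _ = _ := by rw [m2]
  · calc _ ≤ ∫ _ω in Aᶜ, M ∂P :=
          integral_mono imin.restrict (integrable_const _) fun ω => min_le_right _ _
      _ = P.real Aᶜ * M := by rw [setIntegral_const, smul_eq_mul]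
      _ ≤ ε / 4 * M := by gcongr
      _ = _ := mul_comm _ _

end IsERM

end

/-! ### Orders of magnitude -/

section

variable {d n : ℕ} {ν : Measure (EuclideanSpace ℝ (Fin d) × ℝ)} {θs : EuclideanSpace ℝ (Fin d)}
  {p q k ε b D : ℝ}

/-- Consequences of a bound for the rate `√(k D / n)`, where `D` is an upper bound for the
dimension and for the confidence term. The number `b` measures how far `k` is from `1`. -/
structure OrderBounds (k : ℝ) (d : ℕ) (ε : ℝ) (n : ℕ) (b D : ℝ) : Prop where
  cond : SampleSizeCond k d ε n
  gammaMinus_le : gammaMinus k d ε n ≤ √(k * D / n)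
  rate_le : √(k * D / n) ≤ 1 / 48
  mu_le : mu k d ε n ≤ 12 * √(k * D / n)
  deltaHat_nonneg : 0 ≤ deltaHat k d ε n
  deltaHat_le : deltaHat k d ε n ≤ 24 * √(k * D / n)
  base_le : 2 * confTerm d ε / ((k - 1) * n) ≤ 2 * b * (D / (k * n))

lemma orderBounds (hd : 1 ≤ d) (hn : 1 ≤ n) (hk : 1 < k) (hb : 1 ≤ b) (hbk : k ≤ b * (k - 1))
    (hε : 0 < ε) (hε1 : ε ≤ 1) (hdD : d ≤ D) (hL : confTerm d ε ≤ D)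
    (hy : √(k * D / n) ≤ 1 / (48 + 2 * b)) : OrderBounds k d ε n b D := by
  have hL0 := confTerm_pos hd hε hε1
  have hn0 : (0 : ℝ) < n := by exact_mod_cast hn
  have hD : 0 < D := hL0.trans_le hL
  have hk1 : 0 < k - 1 := by linarith
  have hk0 : 0 < k := by linarith
  have ht : 0 ≤ tempScale k d ε n := Real.sqrt_nonneg _
  have h2 : √2 < 1.4143 := by
    rw [Real.sqrt_lt' (by norm_num)]; norm_num
  have hsq2 : 0 ≤ √2 := Real.sqrt_nonneg _
  have hys : √(k * D / n) ^ 2 = k * D / n := Real.sq_sqrt (by positivity)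
  have hs : dimScale k d n ≤ √(k * D / n) := Real.sqrt_le_sqrt (by gcongr)
  have hx : (k - 1) * tempScale k d ε n ≤ √2 * √(k * D / n) := by
    rw [tempScale_mul hk, ← Real.sqrt_mul (by norm_num)]
    apply Real.sqrt_le_sqrt
    calc 2 * (k - 1) / n * confTerm d ε ≤ 2 * k / n * D := by gcongr; linarith
      _ = _ := by ring
  have hbase : 2 * confTerm d ε / ((k - 1) * n) ≤ 2 * b * (D / (k * n)) := by
    rw [div_le_iff₀ (by positivity)]
    have e : 2 * b * (D / (k * n)) * ((k - 1) * n) = 2 * D * (b * (k - 1)) / k := by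
      field_simp
    rw [e, le_div_iff₀ hk0]
    nlinarith
  have hl2 : tempScale k d ε n ^ 2 ≤ 2 * b * √(k * D / n) ^ 2 := by
    rw [tempScale_sq hk hL0.le, hys]
    refine hbase.trans ?_
    have : D / (k * n) ≤ k * D / n := by
      rw [div_le_div_iff₀ (by positivity) hn0]
      have : D * n * 1 ≤ D * n * (k * k) := by gcongr; nlinarith
      nlinarith
    gcongr
  have hy0 : 0 ≤ √(k * D / n) := Real.sqrt_nonneg _
  set y := √(k * D / n)
  rw [le_div_iff₀ (by linarith)] at hy
  have hy48 : y ≤ 1 / 48 := by nlinarith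
  have hyb : b * y ≤ 1 / 2 := by nlinarith
  have hl : tempScale k d ε n ≤ 2 * b * y := by
    apply le_of_sq_le_sq _ (by positivity)
    refine hl2.trans ?_
    rw [mul_pow, mul_pow]
    have : b ≤ b ^ 2 := by nlinarith
    have : 0 ≤ y ^ 2 := sq_nonneg y
    nlinarith
  have hcond : SampleSizeCond k d ε n := by
    rw [sampleSizeCond_iff hk hn hL0.le]
    nlinarith
  have hmu0 : 0 ≤ mu k d ε n := mu_nonneg
  have hmu : mu k d ε n ≤ 12 * y := by
    rw [mu_eq hk]
    have hs0 : 0 ≤ dimScale k d n := Real.sqrt_nonneg _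
    have h3 : 6.81 * √2 * dimScale k d n ≤ 6.81 * √2 * y := by gcongr
    nlinarith
  have hmu4 : mu k d ε n ≤ 1 / 4 := by linarith
  refine ⟨hcond, ?_, hy48, hmu, hmu0.trans (mu_le_deltaHat (by linarith)), ?_, hbase⟩
  · rw [gammaMinus_eq hk hL0.le]
    nlinarith
  · rw [deltaHat, div_le_iff₀ (by linarith)]
    nlinarith

namespace OrderBounds

lemma gammaMinus_lt (h : OrderBounds k d ε n b D) : gammaMinus k d ε n < 1 := by
  linarith [h.gammaMinus_le, h.rate_le]

lemma ratio_sq_le (h : OrderBounds k d ε n b D) :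
    ((1 + deltaHat k d ε n) / (1 - gammaMinus k d ε n)) ^ 2 ≤ 1 + 67 * √(k * D / n) := by
  obtain ⟨-, hg, hy, -, hδ0, hδ, -⟩ := h
  set y := √(k * D / n)
  set g := gammaMinus k d ε n
  set δ := deltaHat k d ε n
  have hy0 : 0 ≤ y := Real.sqrt_nonneg _
  rw [div_pow, div_le_iff₀ (by apply pow_pos; linarith)]
  have h1 : (1 + δ) ^ 2 ≤ 1 + 60 * y := by nlinarith
  have h2 : (1 - y) ^ 2 ≤ (1 - g) ^ 2 := pow_le_pow_left₀ (by linarith) (by linarith) 2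
  have h3 : 1 + 60 * y ≤ (1 + 67 * y) * (1 - y) ^ 2 := by
    have e : (1 + 67 * y) * (1 - y) ^ 2 - (1 + 60 * y) = y * (5 - 133 * y + 67 * y ^ 2) := by ring
    have : 0 ≤ y * (5 - 133 * y + 67 * y ^ 2) := mul_nonneg hy0 (by nlinarith)
    linarith
  nlinarith

lemma base_rpow_le (h : OrderBounds k d ε n b D) (hk : 1 < k) (hb : 1 ≤ b) (hD : 0 ≤ D)
    (hL : 0 ≤ confTerm d ε) (hp1 : 1 ≤ p) (hp2 : p ≤ 2) :
    (2 * confTerm d ε / ((k - 1) * n)) ^ (p / 2) ≤ 2 * b * (D / (k * n)) ^ (p / 2) := by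
  have hk1 : 0 < k - 1 := by linarith
  have h1 : 0 ≤ D / (k * n) := by positivity
  calc _ ≤ (2 * b * (D / (k * n))) ^ (p / 2) :=
        Real.rpow_le_rpow (by positivity) h.base_le (by linarith)
    _ = (2 * b) ^ (p / 2) * (D / (k * n)) ^ (p / 2) := Real.mul_rpow (by linarith) h1
    _ ≤ (2 * b) ^ (1 : ℝ) * (D / (k * n)) ^ (p / 2) := by
        gcongr <;> linarith
    _ = _ := by rw [Real.rpow_one]

end OrderBounds

namespace Assumptions

lemma gammaPlus_le_of_orderBounds (h : Assumptions ν θs p q) (hk : 1 < kappa ν) (hb : 1 ≤ b)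
    (hε : 0 < ε) (hε1 : ε ≤ 1) (hD : 0 ≤ D) (hB : OrderBounds (kappa ν) d ε n b D) :
    gammaPlus ν p q ε n ≤ 71 * b * ((D / (kappa ν * n)) ^ (p / 2) *
      (whitenedMoment ν (2 * (p + 1)) + whitenedMoment ν (2 * q * (p + 1)) ^ (1 / q) /
        (ε ^ (1 / q) * (n : ℝ) ^ (1 - 1 / q)))) := by
  have hp1 := h.one_le_p
  have hp2 := h.p_le_two
  have hcq1 := one_le_cq h.one_le_q h.q_le_two
  have hcq : cq q ≤ 21 := (cq_le h.one_le_q h.q_le_two).trans (by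
    rw [show (3 : ℝ) = (3 : ℕ) * 1 by norm_num, Real.exp_nat_mul]
    calc Real.exp 1 ^ 3 ≤ 2.7182818286 ^ 3 := by
          gcongr; exact Real.exp_one_lt_d9.le
      _ ≤ 21 := by norm_num)
  have hL := confTerm_pos h.one_le_dim hε hε1
  have h1 := whitenedMoment_nonneg (ν := ν) (2 * (p + 1))
  have h2 := whitenedMoment_nonneg (ν := ν) (2 * q * (p + 1))
  have hk0 : 0 < kappa ν := by linarith
  have hk1 : 0 < kappa ν - 1 := by linarith
  have hδ0 := hB.deltaHat_nonneg
  have hδ : (1 + deltaHat (kappa ν) d ε n) ^ (p + 1) ≤ 27 / 8 := by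
    have h3 : deltaHat (kappa ν) d ε n ≤ 1 / 2 := by linarith [hB.deltaHat_le, hB.rate_le]
    calc _ ≤ (1 + deltaHat (kappa ν) d ε n) ^ (3 : ℝ) :=
          Real.rpow_le_rpow_of_exponent_le (by linarith) (by linarith)
      _ = (1 + deltaHat (kappa ν) d ε n) ^ 3 := by
          rw [← Real.rpow_natCast]; norm_num
      _ ≤ (3 / 2) ^ 3 := by gcongr; linarith
      _ = _ := by norm_num
  have hbase := hB.base_rpow_le hk hb hD hL.le hp1 hp2
  set m₁ := whitenedMoment ν (2 * (p + 1))
  set X := whitenedMoment ν (2 * q * (p + 1)) ^ (1 / q) with hX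
  have hX0 : 0 ≤ X := by positivity
  set W := ε ^ (1 / q) * (n : ℝ) ^ (1 - 1 / q)
  have hW0 : 0 ≤ W := by positivity
  have hbr : m₁ + cq q * X / W ≤ 21 * (m₁ + X / W) := by
    have : cq q * X / W ≤ 21 * (X / W) := by
      rw [mul_div_assoc]
      exact mul_le_mul_of_nonneg_right hcq (by positivity)
    linarith
  unfold gammaPlus
  calc _ ≤ 1 / 2 * (2 * b * (D / (kappa ν * n)) ^ (p / 2)) * (27 / 8) * (21 * (m₁ + X / W)) := by
        have hp : 1 / (p + 1) ≤ 1 / 2 := by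
          apply one_div_le_one_div_of_le <;> linarith
        have hcq0 : 0 ≤ cq q := by linarith
        have : 0 ≤ 1 + deltaHat (kappa ν) d ε n := by linarith
        gcongr
    _ = (27 / 8 * 21) * b * ((D / (kappa ν * n)) ^ (p / 2) * (m₁ + X / W)) := by ring
    _ ≤ _ := by
        have : 0 ≤ (D / (kappa ν * n)) ^ (p / 2) * (m₁ + X / W) := by positivity
        gcongr
        norm_num

lemma gammaBase_le_of_orderBounds (h : Assumptions ν θs p q) (hk : 1 < k) (hb : 1 ≤ b)
    (hε : 0 < ε) (hε1 : ε ≤ 1) (hD : 0 ≤ D) (hB : OrderBounds k d ε n b D) :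
    gammaBase ν k p q ε n ≤ b * ((D / (k * n)) ^ (p / 2) *
      (whitenedMoment ν (2 * (p + 1)) + whitenedMoment ν (2 * q * (p + 1)) ^ (1 / q) /
        (ε ^ (1 / q) * (n : ℝ) ^ (1 - 1 / q)))) := by
  have hp1 := h.one_le_p
  have hp2 := h.p_le_two
  have hL := confTerm_pos h.one_le_dim hε hε1
  have h1 := whitenedMoment_nonneg (ν := ν) (2 * (p + 1))
  have h2 := whitenedMoment_nonneg (ν := ν) (2 * q * (p + 1))
  have hk1 : 0 < k - 1 := by linarith
  have hbase := hB.base_rpow_le hk hb hD hL.le hp1 hp2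
  have hp : 1 / (p + 1) ≤ 1 / 2 := by
    apply one_div_le_one_div_of_le <;> linarith
  unfold gammaBase
  calc _ ≤ 1 / 2 * (2 * b * (D / (k * n)) ^ (p / 2)) *
        (whitenedMoment ν (2 * (p + 1)) + whitenedMoment ν (2 * q * (p + 1)) ^ (1 / q) /
        (ε ^ (1 / q) * (n : ℝ) ^ (1 - 1 / q))) := by gcongr
    _ = _ := by ring

/-- Jensen's inequality between the two whitened moments. -/
lemma whitenedMoment_le_rpow [IsProbabilityMeasure ν] (h : Assumptions ν θs p q) :
    whitenedMoment ν (2 * (p + 1)) ≤ whitenedMoment ν (2 * q * (p + 1)) ^ (1 / q) := by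
  have hq1 := h.one_le_q
  have hp1 := h.one_le_p
  have hq0 : 0 < q := by linarith
  have i1 := h.integrable_whiten_rpow (r := 2 * (p + 1)) (by positivity) (by nlinarith)
  have h0 := whitenedMoment_nonneg (ν := ν) (2 * (p + 1))
  have hj := (convexOn_rpow hq1).map_integral_le (μ := ν)
    (f := fun z => ‖whiten ν z.1‖ ^ (2 * (p + 1)))
    (Real.continuous_rpow_const hq0.le).continuousOn isClosed_Ici
    (ae_of_all _ fun z => by simp only [Set.mem_Ici]; positivity) i1
    h.integrable_whiten_rpow_rpow
  rw [integral_whiten_rpow_rpow] at hj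
  change whitenedMoment ν (2 * (p + 1)) ^ q ≤ _ at hj
  calc whitenedMoment ν (2 * (p + 1)) = (whitenedMoment ν (2 * (p + 1)) ^ q) ^ (1 / q) := by
        rw [← Real.rpow_mul h0, mul_one_div_cancel hq0.ne', Real.rpow_one]
    _ ≤ _ := Real.rpow_le_rpow (by positivity) hj (by positivity)

end Assumptions

lemma rpow_confidence_mul (hq : 1 ≤ q) (hn : 1 ≤ n) :
    ((n : ℝ) ^ (-(q - 1))) ^ (1 / q) * (n : ℝ) ^ (1 - 1 / q) = 1 := by
  have hn0 : (0 : ℝ) < n := by exact_mod_cast hn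
  rw [← Real.rpow_mul hn0.le, ← Real.rpow_add hn0]
  have : -(q - 1) * (1 / q) + (1 - 1 / q) = 0 := by field_simp; ring
  rw [this, Real.rpow_zero]

lemma log_inv_rpow_neg (hn : 1 ≤ n) :
    Real.log (((n : ℝ) ^ (-(q - 1)))⁻¹) = (q - 1) * Real.log n := by
  have hn0 : (0 : ℝ) < n := by exact_mod_cast hn
  rw [Real.log_inv, Real.log_rpow hn0]; ring

lemma confTerm_rpow_neg_le (hq2 : q ≤ 2) (hn : 1 ≤ n) :
    confTerm d ((n : ℝ) ^ (-(q - 1))) ≤ Real.log n + d := by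
  have h1 : 0 ≤ Real.log n := Real.log_natCast_nonneg n
  have h2 : (0 : ℝ) ≤ d := d.cast_nonneg
  rw [confTerm, log_inv_rpow_neg hn]
  nlinarith

lemma rpow_neg_le_one (hq1 : 1 ≤ q) (hn : 1 ≤ n) : (n : ℝ) ^ (-(q - 1)) ≤ 1 :=
  Real.rpow_le_one_of_one_le_of_nonpos (by exact_mod_cast hn) (by linarith)

end

section

variable {d : ℕ} {ν : Measure (EuclideanSpace ℝ (Fin d) × ℝ)}
  {θs : EuclideanSpace ℝ (Fin d)} {p q : ℝ}

/-! ### Bounds on an event -/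

lemma cond_integral_eq {S : Type*} [MeasurableSpace S] {P : Measure S} (f : S → ℝ) (A : Set S) :
    ∫ ω, f ω ∂(ProbabilityTheory.cond P A) = (P.real A)⁻¹ * ∫ ω in A, f ω ∂P := by
  rw [ProbabilityTheory.cond, integral_smul_measure, ENNReal.toReal_inv, smul_eq_mul]
  rfl

lemma one_sub_le_sq_mul_max {a b : ℝ} (ha : 0 ≤ a) (hb : 0 ≤ b) :
    1 - 2 * a - 2 * b ≤ (max (1 - a) 0 * max (1 - b) 0) ^ 2 := by
  have h1 : 1 - a ≤ max (1 - a) 0 := le_max_left _ _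
  have h2 : 1 - b ≤ max (1 - b) 0 := le_max_left _ _
  have h3 : max (1 - a) 0 ≤ 1 := max_le (by linarith) zero_le_one
  have h4 : max (1 - b) 0 ≤ 1 := max_le (by linarith) zero_le_one
  nlinarith [mul_nonneg (sub_nonneg.2 h3) (sub_nonneg.2 h4),
    sq_nonneg (max (1 - a) 0 * max (1 - b) 0 - 1)]

lemma one_sub_le_shrinkage {k ε : ℝ} {n : ℕ} (h : Assumptions ν θs p q) (hk : 1 < k)
    (hε : 0 < ε) (hε1 : ε ≤ 1) :
    1 - 2 * gammaBase ν k p q ε n - 2 * mu k d ε n ≤ shrinkage ν k p q ε n := by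
  exact one_sub_le_sq_mul_max
    (gammaBase_nonneg h.one_le_p hk (confTerm_pos h.one_le_dim hε hε1).le hε) mu_nonneg

/-- For `p > 1` the moment term is negligible with respect to the main rate. -/
lemma eventually_rates_small (h : Assumptions ν θs p q) (hk : 1 < kappa ν) (hp : 1 < p) {ε : ℝ}
    (hε : 0 < ε) (hε1 : ε ≤ 1) {b D : ℝ} (hb : 0 ≤ b) (hD : 0 < D) :
    ∀ᶠ n : ℕ in atTop, √(kappa ν * D / n) ≤ 1 / (48 + 2 * b) ∧
      gammaBase ν (kappa ν) p q ε n ≤ √(kappa ν * D / n) ∧ kappa' ν θs ≤ n ∧ 1 ≤ n := by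
  have hL := confTerm_pos h.one_le_dim hε hε1
  have hk0 : 0 < kappa ν := by linarith
  have hk1 : 0 < kappa ν - 1 := by linarith
  have hq1 := h.one_le_q
  have t1 : Tendsto (fun n : ℕ => √(kappa ν * D / n)) atTop (𝓝 0) := by
    have := (tendsto_const_div_atTop_nhds_zero_nat (kappa ν * D)).sqrt
    simpa using this
  have h1 := whitenedMoment_nonneg (ν := ν) (2 * (p + 1))
  have h2 := whitenedMoment_nonneg (ν := ν) (2 * q * (p + 1))
  set a := 1 / (p + 1) * (2 * confTerm d ε / (kappa ν - 1)) ^ (p / 2) *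
    (whitenedMoment ν (2 * (p + 1)) + whitenedMoment ν (2 * q * (p + 1)) ^ (1 / q) /
      ε ^ (1 / q)) with ha
  have t2 : Tendsto (fun n : ℕ => a * (n : ℝ) ^ (-((p - 1) / 2))) atTop (𝓝 0) := by
    have := ((tendsto_rpow_neg_atTop (by linarith : 0 < (p - 1) / 2)).comp
      tendsto_natCast_atTop_atTop).const_mul a
    simpa using this
  have hkD : 0 < √(kappa ν * D) := Real.sqrt_pos.2 (by positivity)
  filter_upwards [t1.eventually_le_const (by positivity : 0 < 1 / (48 + 2 * b)),
    t2.eventually_le_const hkD, eventually_ge_atTop 1,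
    tendsto_natCast_atTop_atTop.eventually_ge_atTop (kappa' ν θs)] with n e1 e2 e3 e4
  refine ⟨e1, ?_, e4, e3⟩
  have hn0 : (0 : ℝ) < n := by exact_mod_cast e3
  have hn1 : (1 : ℝ) ≤ n := by exact_mod_cast e3
  have hbr : whitenedMoment ν (2 * q * (p + 1)) ^ (1 / q) / (ε ^ (1 / q) * (n : ℝ) ^ (1 - 1 / q)) ≤
      whitenedMoment ν (2 * q * (p + 1)) ^ (1 / q) / ε ^ (1 / q) := by
    refine div_le_div_of_nonneg_left (by positivity) (by positivity) ?_
    refine le_mul_of_one_le_right (by positivity) (Real.one_le_rpow hn1 ?_)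
    rw [sub_nonneg, div_le_one (by linarith)]
    exact hq1
  have hbase : (2 * confTerm d ε / ((kappa ν - 1) * n)) ^ (p / 2) =
      (2 * confTerm d ε / (kappa ν - 1)) ^ (p / 2) * ((n : ℝ) ^ (-((p - 1) / 2)) / √n) := by
    rw [← div_div, Real.div_rpow (by positivity) hn0.le, div_eq_mul_inv, Real.sqrt_eq_rpow,
      ← Real.rpow_neg hn0.le, ← Real.rpow_sub hn0]
    congr 2
    ring
  rw [gammaBase, hbase, Real.sqrt_div' _ hn0.le]
  calc _ ≤ 1 / (p + 1) * ((2 * confTerm d ε / (kappa ν - 1)) ^ (p / 2) *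
        ((n : ℝ) ^ (-((p - 1) / 2)) / √n)) *
        (whitenedMoment ν (2 * (p + 1)) + whitenedMoment ν (2 * q * (p + 1)) ^ (1 / q) /
          ε ^ (1 / q)) := by gcongr
    _ = a * (n : ℝ) ^ (-((p - 1) / 2)) / √n := by rw [ha]; ring
    _ ≤ _ := by gcongr

lemma abs_sub_one_le_of_event {ε π y c I : ℝ} (hε : 0 < ε) (hε2 : ε < 1 / 2)
    (hπ : 1 - 3 / 2 * ε ≤ π) (hπ1 : π ≤ 1) (hy0 : 0 ≤ y) (hy : y ≤ 1 / 48) (hc : 1 - 26 * y ≤ c)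
    (hI0 : 0 ≤ I) (hlo : c * (1 - 3 * √ε) ≤ I) (hup : I ≤ 1 + 67 * y) :
    |π⁻¹ * I - 1| ≤ 67 * (y + √ε) ∧ |I - 1| ≤ 67 * (y + √ε) := by
  have hse : 0 ≤ √ε := Real.sqrt_nonneg _
  have hεs : ε ≤ √ε := Real.le_sqrt_of_sq_le (by nlinarith)
  have hπ0 : 0 < π := by linarith
  have hlo' : 1 - 26 * y - 3 * √ε ≤ I := by nlinarith
  have hinv1 : 1 ≤ π⁻¹ := (one_le_inv₀ hπ0).2 hπ1
  have hinv : π⁻¹ ≤ 1 + 6 * ε := by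
    rw [inv_le_iff_one_le_mul₀ hπ0]
    nlinarith
  have hup' : π⁻¹ * I ≤ 1 + 67 * y + 18 * ε := by
    calc π⁻¹ * I ≤ π⁻¹ * (1 + 67 * y) := by gcongr
      _ ≤ (1 + 6 * ε) * (1 + 67 * y) := by gcongr
      _ ≤ _ := by nlinarith
  have hlo2 : I ≤ π⁻¹ * I := le_mul_of_one_le_left hI0 hinv1
  constructor <;> rw [abs_le] <;> constructor <;> linarith

variable [IsProbabilityMeasure ν]

/-- The bounds with the constants `γ̃₊`, `δ̂` and `γ₋`, and their form for large `n`. In the latter,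
the probability of the event is at least `1 - 3ε/2`, which stays above `1/4` for `ε < 1/2`, so that
the conditional expectation is close to the expectation on the event. The weaker bound `1 - 2ε`
would not be enough. -/
theorem event_bounds (h : Assumptions ν θs p q) (hk : 1 < kappa ν) {ε : ℝ} (hε : 0 < ε)
    (hε2 : ε < 1 / 2) : ∃ n₀ : ℕ, ∀ n : ℕ, SampleSizeCond (kappa ν) d ε n →
      gammaMinus (kappa ν) d ε n < 1 →
      ∀ (S : Type u) [MeasurableSpace S] (P : Measure S) [IsProbabilityMeasure P]
        (Z : Fin n → S → EuclideanSpace ℝ (Fin d) × ℝ) (θhat : S → EuclideanSpace ℝ (Fin d)),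
      IsERM ν P Z θhat →
      ∃ A : Set S, MeasurableSet A ∧ 1 - 2 * ε ≤ P.real A ∧
        IntegrableOn (fun ω => excess ν θs (θhat ω)) A P ∧
        lowerFactor ν p q ε n * (1 - √6 * √(1 + (kappa' ν θs - 3) / (3 * n)) * √ε) *
            (rateConst ν θs / n)
          ≤ ∫ ω in A, excess ν θs (θhat ω) ∂P ∧
        ∫ ω in A, excess ν θs (θhat ω) ∂P
          ≤ ∫ ω, excess ν θs (θhat ω) ∂(ProbabilityTheory.cond P A) ∧
        ∫ ω, excess ν θs (θhat ω) ∂(ProbabilityTheory.cond P A)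
          ≤ (1 + deltaHat (kappa ν) d ε n) ^ 2 /
              ((1 - gammaMinus (kappa ν) d ε n) ^ 2 * (1 - 2 * ε)) * (rateConst ν θs / n) ∧
        (1 < p → n₀ ≤ n →
          |n / rateConst ν θs * ∫ ω, excess ν θs (θhat ω) ∂(ProbabilityTheory.cond P A) - 1|
            ≤ 67 * (√(kappa ν * (d + Real.log ε⁻¹) / n) + √ε) ∧
          |n / rateConst ν θs * ∫ ω in A, excess ν θs (θhat ω) ∂P - 1|
            ≤ 67 * (√(kappa ν * (d + Real.log ε⁻¹) / n) + √ε)) := by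
  have hε1 : ε ≤ 1 := by linarith
  have hd : (1 : ℝ) ≤ d := by exact_mod_cast h.one_le_dim
  have hlog : 0 ≤ Real.log ε⁻¹ := Real.log_nonneg ((one_le_inv₀ hε).2 hε1)
  have hk1 : 0 < kappa ν - 1 := by linarith
  have hC := h.rateConst_pos
  set b := kappa ν / (kappa ν - 1) with hb
  have hb1 : 1 ≤ b := by rw [hb, one_le_div hk1]; linarith
  have hbk : kappa ν ≤ b * (kappa ν - 1) := by rw [hb, div_mul_cancel₀ _ hk1.ne']
  set D := d + Real.log ε⁻¹ with hD
  obtain ⟨n₀, hn₀⟩ : ∃ n₀ : ℕ, 1 < p → ∀ n, n₀ ≤ n → √(kappa ν * D / n) ≤ 1 / (48 + 2 * b) ∧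
      gammaBase ν (kappa ν) p q ε n ≤ √(kappa ν * D / n) ∧ kappa' ν θs ≤ n ∧ 1 ≤ n := by
    by_cases hp : 1 < p
    · obtain ⟨n₀, hn₀⟩ := eventually_atTop.1 (eventually_rates_small (b := b) (D := D) h hk hp hε
        hε1 (by linarith) (by linarith))
      exact ⟨n₀, fun _ => hn₀⟩
    · exact ⟨0, fun h' => absurd h' hp⟩
  refine ⟨n₀, fun n hc hγ S _ P _ Z θhat hE => ?_⟩
  have hn := hc.one_le
  have hn0 : (0 : ℝ) < n := by exact_mod_cast hn
  obtain ⟨A, hA, hPA, hint, hlo, hup⟩ :=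
    hE.exists_event_integral_bounds h le_rfl hk hε hε1 hc hγ
  have hr : 0 < rateConst ν θs / n := by positivity
  have hP0 : 0 < P.real A := by linarith
  have hP1 : P.real A ≤ 1 := measureReal_le_one
  have hI0 : 0 ≤ ∫ ω in A, excess ν θs (θhat ω) ∂P := integral_nonneg fun ω => h.excess_nonneg _
  have hmono : ∫ ω in A, excess ν θs (θhat ω) ∂P ≤
      (P.real A)⁻¹ * ∫ ω in A, excess ν θs (θhat ω) ∂P :=
    le_mul_of_one_le_left hI0 ((one_le_inv₀ hP0).2 hP1)
  have hlf := h.lowerFactor_le_shrinkage hk hε hε1 hc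
  have hlf0 : 0 ≤ lowerFactor ν p q ε n := by unfold lowerFactor; positivity
  set I := ∫ ω in A, excess ν θs (θhat ω) ∂P
  set r := rateConst ν θs / n with hrdef
  refine ⟨A, hA, by linarith, hint, ?_, ?_, ?_, fun hp hnn => ?_⟩
  · set br := 1 - √6 * √(1 + (kappa' ν θs - 3) / (3 * n)) * √ε
    rcases le_total 0 br with h0 | h0
    · refine le_trans ?_ hlo
      rw [mul_assoc]
      exact mul_le_mul_of_nonneg_right hlf (by positivity)
    · refine le_trans ?_ hI0
      exact mul_nonpos_of_nonpos_of_nonneg (mul_nonpos_of_nonneg_of_nonpos hlf0 h0) hr.le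
  · rw [cond_integral_eq]
    exact hmono
  · rw [cond_integral_eq, inv_mul_le_iff₀ hP0]
    have h1 : 0 < (1 - gammaMinus (kappa ν) d ε n) ^ 2 := by apply pow_pos; linarith
    refine hup.trans ?_
    rw [div_pow]
    have h2 : (1 - 2 * ε) * ((1 + deltaHat (kappa ν) d ε n) ^ 2 /
        ((1 - gammaMinus (kappa ν) d ε n) ^ 2 * (1 - 2 * ε)) * r) =
        (1 + deltaHat (kappa ν) d ε n) ^ 2 / (1 - gammaMinus (kappa ν) d ε n) ^ 2 * r := by
      have : 1 - 2 * ε ≠ 0 := by linarith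
      field_simp
    rw [← h2]
    have : 0 < 1 - 2 * ε := by linarith
    refine mul_le_mul_of_nonneg_right (by linarith) (by positivity)
  · obtain ⟨hy, hg, hk', -⟩ := hn₀ hp n hnn
    have hB := orderBounds (D := D) h.one_le_dim hn hk hb1 hbk hε hε1 (by linarith) (by
      rw [confTerm]; linarith) hy
    have hU := hB.ratio_sq_le
    have hy48 := hB.rate_le
    have hmu := hB.mu_le
    have hsh := one_sub_le_shrinkage (n := n) h hk hε hε1
    have hsh0 : 0 ≤ shrinkage ν (kappa ν) p q ε n := shrinkage_nonneg
    have hy0 : 0 ≤ √(kappa ν * D / n) := Real.sqrt_nonneg _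
    have hsq : √6 * √(1 + (kappa' ν θs - 3) / (3 * n)) ≤ 3 := by
      rw [← Real.sqrt_mul (by norm_num)]
      refine Real.sqrt_le_iff.2 ⟨by norm_num, ?_⟩
      have : (kappa' ν θs - 3) / (3 * n) ≤ 1 / 3 := by
        rw [div_le_iff₀ (by positivity)]; linarith
      linarith
    have hC' : 0 < n / rateConst ν θs := by positivity
    have hcancel : ∀ x : ℝ, n / rateConst ν θs * (x * r) = x := fun x => by
      rw [hrdef]; field_simp
    have hlo' : shrinkage ν (kappa ν) p q ε n * (1 - 3 * √ε) ≤ n / rateConst ν θs * I := by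
      have h1 := mul_le_mul_of_nonneg_left hlo hC'.le
      rw [← mul_assoc (shrinkage ν (kappa ν) p q ε n), hcancel] at h1
      refine (mul_le_mul_of_nonneg_left ?_ hsh0).trans h1
      have := mul_le_mul_of_nonneg_right hsq (Real.sqrt_nonneg ε)
      linarith
    have hup' : n / rateConst ν θs * I ≤ 1 + 67 * √(kappa ν * D / n) := by
      have h1 := mul_le_mul_of_nonneg_left hup hC'.le
      rw [hcancel] at h1
      exact h1.trans hU
    have hfin := abs_sub_one_le_of_event hε hε2 hPA hP1 hy0 hy48 (by linarith)
      (mul_nonneg hC'.le hI0) hlo' hup'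
    rw [cond_integral_eq, mul_left_comm]
    exact hfin

/-! ### Lower bounds for the truncated excess risk -/

theorem truncated_lower_bound (h : Assumptions ν θs p q) (hk : 1 < kappa ν) {ε M : ℝ} {n : ℕ}
    (hε : 0 < ε) (hε1 : ε < 1) (hM : 0 < M) (hc : SampleSizeCond (kappa ν) d ε n)
    {S : Type*} [MeasurableSpace S] {P : Measure S} [IsProbabilityMeasure P]
    {Z : Fin n → S → EuclideanSpace ℝ (Fin d) × ℝ} {θhat : S → EuclideanSpace ℝ (Fin d)}
    (hE : IsERM ν P Z θhat) :
    lowerFactor ν p q ε n *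
      (1 - 3 * rateConst ν θs / (4 * M * n) * (1 + (kappa' ν θs - 3) / (3 * n))
        - √6 * √(1 + (kappa' ν θs - 3) / (3 * n)) * √ε) ≤
      n / rateConst ν θs * ∫ ω, min (excess ν θs (θhat ω)) M ∂P := by
  have h1 := hE.integral_min_excess_ge h le_rfl hk hε hε1.le hc hM
  have hlf := h.lowerFactor_le_shrinkage hk hε hε1.le hc
  have hlf0 : 0 ≤ lowerFactor ν p q ε n := by unfold lowerFactor; positivity
  have hC := h.rateConst_pos
  set br := 1 - 3 * rateConst ν θs / (4 * M * n) * (1 + (kappa' ν θs - 3) / (3 * n))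
        - √6 * √(1 + (kappa' ν θs - 3) / (3 * n)) * √ε
  -- a negative bracket makes the bound trivial, and `lowerFactor` need not be compared then
  rcases le_total 0 br with h0 | h0
  · exact (mul_le_mul_of_nonneg_right hlf h0).trans h1
  · refine (mul_nonpos_of_nonneg_of_nonpos hlf0 h0).trans ?_
    exact mul_nonneg (by positivity)
      (integral_nonneg fun ω => le_min (h.excess_nonneg _) hM.le)

/-- Here `k = 2 κ` is used in place of `κ`, so that `κ = 1` is allowed. When the rate
`√(κ (d + log n) / n)` is not small, the claimed bound is nonpositive. -/
theorem truncated_lower_bound_rate (h : Assumptions ν θs p q) {M : ℝ} {n : ℕ}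
    (hM : 0 < M) (hn : 1 ≤ n)
    {S : Type*} [MeasurableSpace S] {P : Measure S} [IsProbabilityMeasure P]
    {Z : Fin n → S → EuclideanSpace ℝ (Fin d) × ℝ} {θhat : S → EuclideanSpace ℝ (Fin d)}
    (hE : IsERM ν P Z θhat) :
    1 - 100 * (√(kappa ν * (d + Real.log n) / n)
        + ((Real.log n + d) / (kappa ν * n)) ^ (p / 2) *
            whitenedMoment ν (2 * q * (p + 1)) ^ (1 / q)
        + (1 + kappa' ν θs / n) * rateConst ν θs / (M * n)
        + √(1 + kappa' ν θs / n) * (n : ℝ) ^ (-(q - 1) / 2)) ≤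
      n / rateConst ν θs * ∫ ω, min (excess ν θs (θhat ω)) M ∂P := by
  have hn0 : (0 : ℝ) < n := by exact_mod_cast hn
  have hκ := h.one_le_kappa
  have hκ' := h.one_le_kappa'
  have hC := h.rateConst_pos
  have hq1 := h.one_le_q
  have hp1 := h.one_le_p
  have hlog : 0 ≤ Real.log n := Real.log_natCast_nonneg n
  have hd : (1 : ℝ) ≤ d := by exact_mod_cast h.one_le_dim
  have hm := whitenedMoment_nonneg (ν := ν) (2 * q * (p + 1))
  set y := √(kappa ν * (d + Real.log n) / n) with hy
  have hy0 : 0 ≤ y := Real.sqrt_nonneg _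
  set G := ((Real.log n + d) / (kappa ν * n)) ^ (p / 2) *
    whitenedMoment ν (2 * q * (p + 1)) ^ (1 / q) with hG
  have hG0 : 0 ≤ G := by positivity
  set T := (1 + kappa' ν θs / n) * rateConst ν θs / (M * n) with hT
  have hT0 : 0 ≤ T := by positivity
  set W := √(1 + kappa' ν θs / n) * (n : ℝ) ^ (-(q - 1) / 2) with hW
  have hW0 : 0 ≤ W := by positivity
  rcases lt_or_ge (1 / 100) y with hbig | hsmall
  · have : 0 ≤ n / rateConst ν θs * ∫ ω, min (excess ν θs (θhat ω)) M ∂P :=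
      mul_nonneg (by positivity) (integral_nonneg fun ω => le_min (h.excess_nonneg _) hM.le)
    linarith
  have h2 : √2 < 1.4143 := by
    rw [Real.sqrt_lt' (by norm_num)]; norm_num
  set ε := (n : ℝ) ^ (-(q - 1)) with hεdef
  have hε : 0 < ε := by positivity
  have hε1 : ε ≤ 1 := rpow_neg_le_one hq1 hn
  have hyk : √(2 * kappa ν * (Real.log n + d) / n) = √2 * y := by
    rw [hy, ← Real.sqrt_mul (by norm_num)]
    congr 1
    ring
  have hB := orderBounds (k := 2 * kappa ν) (b := 2) (D := Real.log n + d) h.one_le_dim hn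
    (by linarith) (by norm_num) (by linarith) hε hε1 (by linarith)
    (confTerm_rpow_neg_le h.q_le_two hn) (by rw [hyk]; nlinarith)
  have h1 := hE.integral_min_excess_ge h (by linarith : kappa ν ≤ 2 * kappa ν) (by linarith) hε hε1
    hB.cond hM
  have hsh := one_sub_le_shrinkage (k := 2 * kappa ν) (n := n) h (by linarith) hε hε1
  have hmu := hB.mu_le
  rw [hyk] at hmu
  have hγ : gammaBase ν (2 * kappa ν) p q ε n ≤ 4 * G := by
    refine (h.gammaBase_le_of_orderBounds (by linarith) (by norm_num) hε hε1 (by linarith)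
      hB).trans ?_
    rw [rpow_confidence_mul hq1 hn, div_one]
    have hj := h.whitenedMoment_le_rpow
    have hm1 := whitenedMoment_nonneg (ν := ν) (2 * (p + 1))
    set X := whitenedMoment ν (2 * q * (p + 1)) ^ (1 / q)
    have hX0 : 0 ≤ X := (whitenedMoment_nonneg _).trans hj
    have hbase : ((Real.log n + d) / (2 * kappa ν * n)) ^ (p / 2) ≤
        ((Real.log n + d) / (kappa ν * n)) ^ (p / 2) := by
      have : kappa ν ≤ 2 * kappa ν := by linarith
      gcongr
    calc _ ≤ 2 * (((Real.log n + d) / (kappa ν * n)) ^ (p / 2) * (X + X)) := by gcongr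
      _ = 4 * G := by rw [hG]; ring
  set B := 1 + (kappa' ν θs - 3) / (3 * n) with hBdef
  have hB1 : B ≤ 1 + kappa' ν θs / n := by
    have : (kappa' ν θs - 3) / (3 * n) ≤ kappa' ν θs / n := by
      rw [div_le_div_iff₀ (by positivity) hn0]
      nlinarith
    linarith
  have hB0 : 0 ≤ B := h.kurtosis_factor_nonneg hn
  have hT1 : 3 * rateConst ν θs / (4 * M * n) * B ≤ T := by
    calc 3 * rateConst ν θs / (4 * M * n) * B ≤
        rateConst ν θs / (M * n) * (1 + kappa' ν θs / n) := by
          have : 3 * rateConst ν θs / (4 * M * n) ≤ rateConst ν θs / (M * n) := by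
            rw [div_le_div_iff₀ (by positivity) (by positivity)]
            have : 0 < rateConst ν θs * (M * n) := by positivity
            nlinarith
          gcongr
      _ = T := by rw [hT]; ring
  have hW1 : √6 * √B * √ε ≤ 3 * W := by
    have e1 : √ε = (n : ℝ) ^ (-(q - 1) / 2) := by
      rw [hεdef, Real.sqrt_eq_rpow, ← Real.rpow_mul hn0.le]
      congr 1; ring
    have e2 : √6 ≤ 3 := Real.sqrt_le_iff.2 ⟨by norm_num, by norm_num⟩
    rw [e1, hW, ← mul_assoc]
    have := Real.sqrt_le_sqrt hB1
    gcongr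
  have hT2 : 0 ≤ 3 * rateConst ν θs / (4 * M * n) * B := by positivity
  have hW2 : 0 ≤ √6 * √B * √ε := by positivity
  set c := shrinkage ν (2 * kappa ν) p q ε n
  have hc1 : c ≤ 1 :=
    shrinkage_le_one hp1 (by linarith) (confTerm_pos h.one_le_dim hε hε1).le hε
  refine le_trans ?_ h1
  nlinarith

end

section

variable {d : ℕ} {ν : Measure (EuclideanSpace ℝ (Fin d) × ℝ)} [IsProbabilityMeasure ν]
  {θs : EuclideanSpace ℝ (Fin d)} {p q : ℝ}

/-! ### The exact rate of the truncated excess risk -/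

lemma eventually_dim_add_log_le (d : ℕ) {r : ℝ} (hr : 0 < r) :
    ∀ᶠ n : ℕ in atTop, (d : ℝ) + 2 * Real.log n ≤ (n : ℝ) ^ r := by
  have h1 : (fun x : ℝ => 2 * Real.log x) =o[atTop] fun x : ℝ => x ^ r :=
    (isLittleO_log_rpow_atTop hr).const_mul_left 2
  have h2 : (fun _ : ℝ => (d : ℝ)) =o[atTop] fun x : ℝ => x ^ r :=
    Asymptotics.isLittleO_const_left.2
      (Or.inr (tendsto_norm_atTop_atTop.comp (tendsto_rpow_atTop hr)))
  have h3 := (h2.add h1).def one_pos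
  filter_upwards [tendsto_natCast_atTop_atTop.eventually h3] with n hn
  rw [one_mul, Real.norm_eq_abs, Real.norm_eq_abs, abs_of_nonneg (by positivity : 0 ≤ (n : ℝ) ^ r)]
    at hn
  exact (le_abs_self _).trans hn

lemma sqrt_mul_rpow_div_eq {a : ℝ} (ha : 0 ≤ a) {n : ℕ} (hn : 1 ≤ n) :
    √(a * (n : ℝ) ^ (2 - q) / n) = √a * (n : ℝ) ^ (-(q - 1) / 2) := by
  have hn0 : (0 : ℝ) < n := by exact_mod_cast hn
  rw [mul_div_assoc, Real.sqrt_mul ha]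
  congr 1
  rw [← Real.rpow_sub_one hn0.ne', Real.sqrt_eq_rpow, ← Real.rpow_mul hn0.le]
  congr 1
  ring

lemma inv_le_rpow_rate (hq : q ≤ 2) {n : ℕ} (hn : 1 ≤ n) :
    (n : ℝ)⁻¹ ≤ (n : ℝ) ^ (-(q - 1) / 2) := by
  rw [← Real.rpow_neg_one]
  exact Real.rpow_le_rpow_of_exponent_le (by exact_mod_cast hn) (by linarith)

/-- The lower bound, with a constant that depends on the law and on a lower bound for the
truncation level. -/
lemma exists_truncated_lower_rate (h : Assumptions ν θs p q) (hq1 : 1 < q) (hq2 : q < 2) {m : ℝ}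
    (hm : 0 < m) : ∃ B : ℝ, 0 ≤ B ∧ ∀ᶠ n : ℕ in atTop,
      ∀ (S : Type u) [MeasurableSpace S] (P : Measure S) [IsProbabilityMeasure P]
        (Z : Fin n → S → EuclideanSpace ℝ (Fin d) × ℝ) (θhat : S → EuclideanSpace ℝ (Fin d)),
      IsERM ν P Z θhat → ∀ M : ℝ, m ≤ M →
        1 - B * (n : ℝ) ^ (-(q - 1) / 2) ≤
          n / rateConst ν θs * ∫ ω, min (excess ν θs (θhat ω)) M ∂P := by
  have hκ := h.one_le_kappa
  have hκ' := h.one_le_kappa'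
  have hC := h.rateConst_pos
  have hp1 := h.one_le_p
  have hX : 0 ≤ whitenedMoment ν (2 * q * (p + 1)) ^ (1 / q) :=
    Real.rpow_nonneg (whitenedMoment_nonneg _) _
  set X := whitenedMoment ν (2 * q * (p + 1)) ^ (1 / q) with hXdef
  refine ⟨100 * (√(kappa ν) + X + (1 + kappa' ν θs) * rateConst ν θs / m + √(1 + kappa' ν θs)),
    by positivity, ?_⟩
  filter_upwards [eventually_dim_add_log_le d (by linarith : 0 < 2 - q), eventually_ge_atTop 1]
    with n hlog hn S _ P _ Z θhat hE M hM
  have hn0 : (0 : ℝ) < n := by exact_mod_cast hn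
  have hn1 : (1 : ℝ) ≤ n := by exact_mod_cast hn
  have hln : 0 ≤ Real.log n := Real.log_natCast_nonneg n
  have hM0 : 0 < M := hm.trans_le hM
  refine le_trans ?_ (truncated_lower_bound_rate h hM0 hn hE)
  have hr0 : 0 ≤ (n : ℝ) ^ (-(q - 1) / 2) := by positivity
  have h1 : √(kappa ν * (d + Real.log n) / n) ≤ √(kappa ν) * (n : ℝ) ^ (-(q - 1) / 2) := by
    rw [← sqrt_mul_rpow_div_eq (by linarith) hn]
    apply Real.sqrt_le_sqrt
    gcongr
    linarith
  have h2 : ((Real.log n + d) / (kappa ν * n)) ^ (p / 2) ≤ (n : ℝ) ^ (-(q - 1) / 2) := by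
    have hb : (Real.log n + d) / (kappa ν * n) ≤ (n : ℝ) ^ (-(q - 1)) := by
      have e : (n : ℝ) ^ (-(q - 1)) = (n : ℝ) ^ (2 - q) / n := by
        rw [← Real.rpow_sub_one hn0.ne']; congr 1; ring
      rw [e]
      apply div_le_div₀ (by positivity) (by linarith) hn0
      exact le_mul_of_one_le_left hn0.le hκ
    calc _ ≤ ((n : ℝ) ^ (-(q - 1))) ^ (p / 2) :=
          Real.rpow_le_rpow (by positivity) hb (by linarith)
      _ ≤ ((n : ℝ) ^ (-(q - 1))) ^ (1 / 2 : ℝ) :=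
          Real.rpow_le_rpow_of_exponent_ge (by positivity) (rpow_neg_le_one hq1.le hn)
            (by linarith)
      _ = _ := by rw [← Real.rpow_mul hn0.le]; congr 1; ring
  have hκn : kappa' ν θs / n ≤ kappa' ν θs := div_le_self (by linarith) hn1
  have h3 : (1 + kappa' ν θs / n) * rateConst ν θs / (M * n) ≤
      (1 + kappa' ν θs) * rateConst ν θs / m * (n : ℝ) ^ (-(q - 1) / 2) := by
    rw [← div_div, div_eq_mul_inv _ (n : ℝ)]
    have := inv_le_rpow_rate hq2.le hn
    gcongr
  have h4 : √(1 + kappa' ν θs / n) * (n : ℝ) ^ (-(q - 1) / 2) ≤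
      √(1 + kappa' ν θs) * (n : ℝ) ^ (-(q - 1) / 2) := by
    have := Real.sqrt_le_sqrt (by linarith : 1 + kappa' ν θs / n ≤ 1 + kappa' ν θs)
    gcongr
  have h2' := mul_le_mul_of_nonneg_right h2 hX
  linarith

/-- The upper bound. The confidence level `n⁻² exp(-n^(2 - q))` makes the contribution of the
exceptional event negligible, while its logarithm is of the order of `n^(2 - q)`. -/
lemma exists_truncated_upper_rate (h : Assumptions ν θs p q) (hq1 : 1 < q) (hq2 : q < 2) {m : ℝ}
    (hm : 0 ≤ m) : ∃ B : ℝ, 0 ≤ B ∧ ∀ᶠ n : ℕ in atTop,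
      ∀ (S : Type u) [MeasurableSpace S] (P : Measure S) [IsProbabilityMeasure P]
        (Z : Fin n → S → EuclideanSpace ℝ (Fin d) × ℝ) (θhat : S → EuclideanSpace ℝ (Fin d)),
      IsERM ν P Z θhat → ∀ M : ℝ, 0 < M → M ≤ m * Real.exp ((n : ℝ) ^ (2 - q)) →
        n / rateConst ν θs * ∫ ω, min (excess ν θs (θhat ω)) M ∂P ≤
          1 + B * (n : ℝ) ^ (-(q - 1) / 2) := by
  have hκ := h.one_le_kappa
  have hC := h.rateConst_pos
  have hd : (1 : ℝ) ≤ d := by exact_mod_cast h.one_le_dim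
  refine ⟨67 * √(4 * kappa ν) + m / (4 * rateConst ν θs), by positivity, ?_⟩
  have t1 : Tendsto (fun n : ℕ => √(4 * kappa ν) * (n : ℝ) ^ (-(q - 1) / 2)) atTop (𝓝 0) := by
    have := ((tendsto_rpow_neg_atTop (by linarith : 0 < (q - 1) / 2)).comp
      tendsto_natCast_atTop_atTop).const_mul √(4 * kappa ν)
    rw [mul_zero] at this
    simpa only [neg_div, Function.comp_def] using this
  filter_upwards [eventually_dim_add_log_le d (by linarith : 0 < 2 - q), eventually_ge_atTop 1,
    t1.eventually_le_const (by norm_num : (0 : ℝ) < 1 / 52)]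
    with n hlog hn hsmall S _ P _ Z θhat hE M hM0 hM
  have hn0 : (0 : ℝ) < n := by exact_mod_cast hn
  have hn1 : (1 : ℝ) ≤ n := by exact_mod_cast hn
  have hln : 0 ≤ Real.log n := Real.log_natCast_nonneg n
  have hN : 0 < (n : ℝ) ^ (2 - q) := by positivity
  set ε := ((n : ℝ) ^ 2)⁻¹ * Real.exp (-(n : ℝ) ^ (2 - q)) with hεdef
  have hε : 0 < ε := by positivity
  have hε1 : ε ≤ 1 :=
    mul_le_one₀ (inv_le_one_of_one_le₀ (one_le_pow₀ hn1)) (Real.exp_pos _).le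
      (Real.exp_le_one_iff.2 (by linarith))
  have hlogε : Real.log ε⁻¹ = 2 * Real.log n + (n : ℝ) ^ (2 - q) := by
    rw [Real.log_inv, hεdef, Real.log_mul (by positivity) (by positivity), Real.log_exp,
      Real.log_inv, Real.log_pow]
    push_cast
    ring
  have hy : √(2 * kappa ν * (2 * (n : ℝ) ^ (2 - q)) / n) =
      √(4 * kappa ν) * (n : ℝ) ^ (-(q - 1) / 2) := by
    rw [← sqrt_mul_rpow_div_eq (by linarith) hn]
    congr 1
    ring
  have hB := orderBounds (k := 2 * kappa ν) (b := 2) (D := 2 * (n : ℝ) ^ (2 - q)) h.one_le_dim hn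
    (by linarith) (by norm_num) (by linarith) hε hε1 (by linarith)
    (by rw [confTerm, hlogε]; linarith) (by rw [hy]; norm_num at hsmall ⊢; linarith)
  have h1 := hE.integral_min_excess_le h (by linarith : kappa ν ≤ 2 * kappa ν) (by linarith) hε hε1
    hB.cond hB.gammaMinus_lt hM0
  have hU := hB.ratio_sq_le
  rw [hy] at hU
  have hC' : 0 < n / rateConst ν θs := by positivity
  have h2 := mul_le_mul_of_nonneg_left h1 hC'.le
  have h3 : n / rateConst ν θs * (M * (ε / 4)) ≤
      m / (4 * rateConst ν θs) * (n : ℝ) ^ (-(q - 1) / 2) := by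
    have hMε : M * ε ≤ m * ((n : ℝ) ^ 2)⁻¹ := by
      calc M * ε ≤ m * Real.exp ((n : ℝ) ^ (2 - q)) * ε := by gcongr
        _ = m * ((n : ℝ) ^ 2)⁻¹ * (Real.exp ((n : ℝ) ^ (2 - q)) *
            Real.exp (-(n : ℝ) ^ (2 - q))) := by rw [hεdef]; ring
        _ = _ := by rw [← Real.exp_add, add_neg_cancel, Real.exp_zero, mul_one]
    calc n / rateConst ν θs * (M * (ε / 4)) = n / (4 * rateConst ν θs) * (M * ε) := by
          field_simp
      _ ≤ n / (4 * rateConst ν θs) * (m * ((n : ℝ) ^ 2)⁻¹) := by gcongr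
      _ = m / (4 * rateConst ν θs) * (n : ℝ)⁻¹ := by field_simp
      _ ≤ _ := by
          have := inv_le_rpow_rate hq2.le hn
          gcongr
  have h4 : n / rateConst ν θs * (((1 + deltaHat (2 * kappa ν) d ε n) /
      (1 - gammaMinus (2 * kappa ν) d ε n)) ^ 2 * (rateConst ν θs / n)) =
      ((1 + deltaHat (2 * kappa ν) d ε n) / (1 - gammaMinus (2 * kappa ν) d ε n)) ^ 2 := by
    field_simp
  rw [mul_add, h4] at h2
  linarith

theorem exists_truncated_rate (h : Assumptions ν θs p q) (hq1 : 1 < q) (hq2 : q < 2) {m₁ m₂ : ℝ}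
    (hm₁ : 0 < m₁) (hm₂ : 0 ≤ m₂) : ∃ (B : ℝ) (n₀ : ℕ), 0 ≤ B ∧ 1 ≤ n₀ ∧ ∀ n : ℕ, n₀ ≤ n →
      ∀ (S : Type u) [MeasurableSpace S] (P : Measure S) [IsProbabilityMeasure P]
        (Z : Fin n → S → EuclideanSpace ℝ (Fin d) × ℝ) (θhat : S → EuclideanSpace ℝ (Fin d)),
      IsERM ν P Z θhat → ∀ M : ℝ, m₁ ≤ M → M ≤ m₂ * Real.exp ((n : ℝ) ^ (2 - q)) →
        |n / rateConst ν θs * ∫ ω, min (excess ν θs (θhat ω)) M ∂P - 1| ≤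
          B * (n : ℝ) ^ (-(q - 1) / 2) := by
  obtain ⟨B₁, hB₁, h₁⟩ := exists_truncated_lower_rate.{u} h hq1 hq2 hm₁
  obtain ⟨B₂, hB₂, h₂⟩ := exists_truncated_upper_rate.{u} h hq1 hq2 hm₂
  obtain ⟨n₀, hn₀⟩ := eventually_atTop.1 (h₁.and h₂)
  refine ⟨B₁ + B₂, max n₀ 1, by positivity, le_max_right _ _,
    fun n hn S _ P _ Z θhat hE M hM1 hM2 => ?_⟩
  obtain ⟨h1, h2⟩ := hn₀ n ((le_max_left _ _).trans hn)
  have e1 := h1 S P Z θhat hE M hM1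
  have e2 := h2 S P Z θhat hE M (hm₁.trans_le hM1) hM2
  have hr0 : 0 ≤ (n : ℝ) ^ (-(q - 1) / 2) := by positivity
  have e3 := mul_nonneg hB₁ hr0
  have e4 := mul_nonneg hB₂ hr0
  rw [abs_le]
  constructor <;> linarith

/-- The consequence of a relative error bound for the tail bound. -/
lemma div_exp_le {I C r B N : ℝ} {n : ℕ} (hn : 1 ≤ n) (hC : 0 < C) (hB : 0 ≤ B) (hr : r ≤ 1)
    (h : |n / C * I - 1| ≤ B * r) :
    I / (C * Real.exp N) ≤ (1 + B) / (n * Real.exp N) := by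
  have hn0 : (0 : ℝ) < n := by exact_mod_cast hn
  have h1 : n / C * I ≤ 1 + B := by
    have := (abs_le.1 h).2
    nlinarith
  have h2 : n * I ≤ (1 + B) * C := by
    rw [div_mul_eq_mul_div, div_le_iff₀ hC] at h1
    exact h1
  have hE := Real.exp_pos N
  rw [div_le_div_iff₀ (by positivity) (by positivity)]
  nlinarith

/-! ### Sample size conditions in terms of orders of magnitude -/

lemma sqrt_div_le_of_le {k D T : ℝ} {n : ℕ} (hT : 0 < T) (hn : 1 ≤ n)
    (h : T ^ 2 * (k * D) ≤ n) : √(k * D / n) ≤ 1 / T := by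
  have hn0 : (0 : ℝ) < n := by exact_mod_cast hn
  refine Real.sqrt_le_iff.2 ⟨by positivity, ?_⟩
  rw [div_pow, one_pow, div_le_div_iff₀ hn0 (by positivity)]
  linarith

/-- A condition on `n` in terms of `log κ` implies the same condition in terms of `log n`. -/
lemma mul_add_log_le {κ d T : ℝ} {n : ℕ} (hκ : 1 ≤ κ) (hd : 1 ≤ d) (hT : 1 ≤ T) (hn : 1 ≤ n)
    (h : (3 * T ^ 2) ^ 2 * (κ * (d + Real.log κ)) ≤ n) :
    T ^ 2 * (κ * (Real.log n + d)) ≤ n := by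
  have hn0 : (0 : ℝ) < n := by exact_mod_cast hn
  have hκ0 : 0 < κ := by linarith
  have hlk : 0 ≤ Real.log κ := Real.log_nonneg hκ
  set y := n / κ with hy
  have hyκ : n = κ * y := by rw [hy]; field_simp
  have hy0 : 0 < y := by positivity
  have h1 : (3 * T ^ 2) ^ 2 * (d + Real.log κ) ≤ y := by
    rw [hy, le_div_iff₀ hκ0]; linarith
  have hs : √y ^ 2 = y := Real.sq_sqrt hy0.le
  have hs0 : 0 < √y := Real.sqrt_pos.2 hy0
  have hsT : 3 * T ^ 2 ≤ √y := by
    apply Real.le_sqrt_of_sq_le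
    nlinarith [sq_nonneg (3 * T ^ 2)]
  have hlog : Real.log n = Real.log κ + Real.log y := by
    rw [hyκ, Real.log_mul hκ0.ne' hy0.ne']
  have hly : Real.log y ≤ 2 * √y - 2 := by
    have := Real.log_le_sub_one_of_pos hs0
    rw [Real.log_sqrt hy0.le] at this
    linarith
  have hT2 : 1 ≤ T ^ 2 := one_le_pow₀ hT
  have key : T ^ 2 * (Real.log n + d) ≤ y := by
    rw [hlog]
    have e1 : 9 * T ^ 2 * (d + Real.log κ) ≤ y := by
      refine le_trans ?_ h1
      have : 0 ≤ d + Real.log κ := by linarith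
      gcongr
      nlinarith
    have e2 : T ^ 2 * (2 * √y) ≤ 2 / 3 * y := by nlinarith
    nlinarith
  calc T ^ 2 * (κ * (Real.log n + d)) = κ * (T ^ 2 * (Real.log n + d)) := by ring
    _ ≤ κ * y := by gcongr
    _ = n := hyκ.symm

end

end LeastSquares

/-! ### Moments and rates of the excess risk -/

open LeastSquares

theorem proposition4p12 :
    (∃ K : ℝ, 0 < K ∧
      ∀ (d : ℕ) (ν : Measure (EuclideanSpace ℝ (Fin d) × ℝ)) [IsProbabilityMeasure ν]
        (θs : EuclideanSpace ℝ (Fin d)) (p q : ℝ), LeastSquares.Assumptions ν θs p q →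
      -- Two-sided bound for the excess risk on an event of probability at least `1 - 2ε`,
      -- and its asymptotic form for `p > 1`.
      (1 < LeastSquares.kappa ν → ∀ ε : ℝ, 0 < ε → ε < 1 / 2 → ∃ n₀ : ℕ, ∀ n : ℕ,
        LeastSquares.SampleSizeCond (LeastSquares.kappa ν) d ε n →
        LeastSquares.gammaMinus (LeastSquares.kappa ν) d ε n < 1 →
        ∀ (S : Type u) [MeasurableSpace S] (P : Measure S) [IsProbabilityMeasure P]
          (Z : Fin n → S → EuclideanSpace ℝ (Fin d) × ℝ) (θhat : S → EuclideanSpace ℝ (Fin d)),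
        LeastSquares.IsERM ν P Z θhat →
        ∃ A : Set S, MeasurableSet A ∧ 1 - 2 * ε ≤ P.real A ∧
          IntegrableOn (fun ω => LeastSquares.excess ν θs (θhat ω)) A P ∧
          LeastSquares.lowerFactor ν p q ε n *
              (1 - √6 * √(1 + (LeastSquares.kappa' ν θs - 3) / (3 * n)) * √ε) *
              (LeastSquares.rateConst ν θs / n)
            ≤ ∫ ω in A, LeastSquares.excess ν θs (θhat ω) ∂P ∧
          ∫ ω in A, LeastSquares.excess ν θs (θhat ω) ∂P
            ≤ ∫ ω, LeastSquares.excess ν θs (θhat ω) ∂(ProbabilityTheory.cond P A) ∧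
          ∫ ω, LeastSquares.excess ν θs (θhat ω) ∂(ProbabilityTheory.cond P A)
            ≤ (1 + LeastSquares.deltaHat (LeastSquares.kappa ν) d ε n) ^ 2 /
                ((1 - LeastSquares.gammaMinus (LeastSquares.kappa ν) d ε n) ^ 2 * (1 - 2 * ε)) *
              (LeastSquares.rateConst ν θs / n) ∧
          (1 < p → n₀ ≤ n →
            |n / LeastSquares.rateConst ν θs *
                ∫ ω, LeastSquares.excess ν θs (θhat ω) ∂(ProbabilityTheory.cond P A) - 1|
              ≤ K * (√(LeastSquares.kappa ν * (d + Real.log ε⁻¹) / n) + √ε) ∧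
            |n / LeastSquares.rateConst ν θs *
                ∫ ω in A, LeastSquares.excess ν θs (θhat ω) ∂P - 1|
              ≤ K * (√(LeastSquares.kappa ν * (d + Real.log ε⁻¹) / n) + √ε))) ∧
      -- Non-asymptotic lower bound for the truncated excess risk.
      (1 < LeastSquares.kappa ν → ∀ (ε M : ℝ) (n : ℕ), 0 < ε → ε < 1 → 0 < M →
        LeastSquares.SampleSizeCond (LeastSquares.kappa ν) d ε n →
        ∀ (S : Type u) [MeasurableSpace S] (P : Measure S) [IsProbabilityMeasure P]
          (Z : Fin n → S → EuclideanSpace ℝ (Fin d) × ℝ) (θhat : S → EuclideanSpace ℝ (Fin d)),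
        LeastSquares.IsERM ν P Z θhat →
          LeastSquares.lowerFactor ν p q ε n *
              (1 - 3 * LeastSquares.rateConst ν θs / (4 * M * n) *
                  (1 + (LeastSquares.kappa' ν θs - 3) / (3 * n))
                - √6 * √(1 + (LeastSquares.kappa' ν θs - 3) / (3 * n)) * √ε)
            ≤ n / LeastSquares.rateConst ν θs *
                ∫ ω, min (LeastSquares.excess ν θs (θhat ω)) M ∂P) ∧
      -- The same lower bound for `ε = n ^ (-(q - 1))`, up to universal constants.
      (1 < q → ∀ (M : ℝ) (n : ℕ), 0 < M →
        K * (LeastSquares.kappa ν * (d + Real.log (LeastSquares.kappa ν))) ≤ n →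
        ∀ (S : Type u) [MeasurableSpace S] (P : Measure S) [IsProbabilityMeasure P]
          (Z : Fin n → S → EuclideanSpace ℝ (Fin d) × ℝ) (θhat : S → EuclideanSpace ℝ (Fin d)),
        LeastSquares.IsERM ν P Z θhat →
          1 - K * (√(LeastSquares.kappa ν * (d + Real.log n) / n)
              + ((Real.log n + d) / (LeastSquares.kappa ν * n)) ^ (p / 2) *
                  LeastSquares.whitenedMoment ν (2 * q * (p + 1)) ^ (1 / q)
              + (1 + LeastSquares.kappa' ν θs / n) * LeastSquares.rateConst ν θs / (M * n)
              + √(1 + LeastSquares.kappa' ν θs / n) * (n : ℝ) ^ (-(q - 1) / 2))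
            ≤ n / LeastSquares.rateConst ν θs *
                ∫ ω, min (LeastSquares.excess ν θs (θhat ω)) M ∂P) ∧
      -- Exact rate for a fixed truncation level.
      (1 < q → q < 2 → ∀ M : ℝ, 0 < M → ∃ (B : ℝ) (n₀ : ℕ), ∀ n : ℕ, n₀ ≤ n →
        ∀ (S : Type u) [MeasurableSpace S] (P : Measure S) [IsProbabilityMeasure P]
          (Z : Fin n → S → EuclideanSpace ℝ (Fin d) × ℝ) (θhat : S → EuclideanSpace ℝ (Fin d)),
        LeastSquares.IsERM ν P Z θhat →
          |n / LeastSquares.rateConst ν θs *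
              ∫ ω, min (LeastSquares.excess ν θs (θhat ω)) M ∂P - 1|
            ≤ B * (n : ℝ) ^ (-(q - 1) / 2)) ∧
      -- Exact rate for the truncation level `C exp(n ^ (2 - q))`, and the probability that the
      -- excess risk exceeds this level.
      (1 < q → q < 2 → ∃ (B : ℝ) (n₀ : ℕ), ∀ n : ℕ, n₀ ≤ n →
        ∀ (S : Type u) [MeasurableSpace S] (P : Measure S) [IsProbabilityMeasure P]
          (Z : Fin n → S → EuclideanSpace ℝ (Fin d) × ℝ) (θhat : S → EuclideanSpace ℝ (Fin d)),
        LeastSquares.IsERM ν P Z θhat →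
          |n / LeastSquares.rateConst ν θs *
              ∫ ω, min (LeastSquares.excess ν θs (θhat ω))
                (LeastSquares.rateConst ν θs * Real.exp ((n : ℝ) ^ (2 - q))) ∂P - 1|
            ≤ B * (n : ℝ) ^ (-(q - 1) / 2) ∧
          P.real {ω | LeastSquares.rateConst ν θs * Real.exp ((n : ℝ) ^ (2 - q)) ≤
              LeastSquares.excess ν θs (θhat ω)}
            ≤ (∫ ω, min (LeastSquares.excess ν θs (θhat ω))
                (LeastSquares.rateConst ν θs * Real.exp ((n : ℝ) ^ (2 - q))) ∂P) /
              (LeastSquares.rateConst ν θs * Real.exp ((n : ℝ) ^ (2 - q))) ∧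
          (∫ ω, min (LeastSquares.excess ν θs (θhat ω))
                (LeastSquares.rateConst ν θs * Real.exp ((n : ℝ) ^ (2 - q))) ∂P) /
              (LeastSquares.rateConst ν θs * Real.exp ((n : ℝ) ^ (2 - q)))
            ≤ B / (n * Real.exp ((n : ℝ) ^ (2 - q))))) ∧
    -- Orders of magnitude of the sample size condition, of `δ̂` and of `γ̃₊`, with constants
    -- that depend only on a lower bound `κ₀ > 1` for `κ`.
    (∀ κ₀ : ℝ, 1 < κ₀ → ∃ a : ℝ, 0 < a ∧
      ∀ (d : ℕ) (ν : Measure (EuclideanSpace ℝ (Fin d) × ℝ)) [IsProbabilityMeasure ν]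
        (θs : EuclideanSpace ℝ (Fin d)) (p q : ℝ), LeastSquares.Assumptions ν θs p q →
        κ₀ ≤ LeastSquares.kappa ν →
      (∀ (ε : ℝ) (n : ℕ), 0 < ε → ε < 1 →
        a * (LeastSquares.kappa ν * (d + Real.log ε⁻¹)) ≤ n →
          LeastSquares.SampleSizeCond (LeastSquares.kappa ν) d ε n ∧
          LeastSquares.gammaMinus (LeastSquares.kappa ν) d ε n < 1 ∧
          LeastSquares.deltaHat (LeastSquares.kappa ν) d ε n
            ≤ a * √(LeastSquares.kappa ν * (d + Real.log ε⁻¹) / n) ∧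
          LeastSquares.gammaPlus ν p q ε n
            ≤ a * (((Real.log ε⁻¹ + d) / (LeastSquares.kappa ν * n)) ^ (p / 2) *
              (LeastSquares.whitenedMoment ν (2 * (p + 1)) +
                LeastSquares.whitenedMoment ν (2 * q * (p + 1)) ^ (1 / q) /
                  (ε ^ (1 / q) * (n : ℝ) ^ (1 - 1 / q))))) ∧
      (1 < q → ∀ n : ℕ,
        a * (LeastSquares.kappa ν * (d + Real.log (LeastSquares.kappa ν))) ≤ n →
          LeastSquares.SampleSizeCond (LeastSquares.kappa ν) d ((n : ℝ) ^ (-(q - 1))) n ∧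
          LeastSquares.gammaPlus ν p q ((n : ℝ) ^ (-(q - 1))) n
            ≤ a * (((Real.log n + d) / (LeastSquares.kappa ν * n)) ^ (p / 2) *
              LeastSquares.whitenedMoment ν (2 * q * (p + 1)) ^ (1 / q)))) := by
  refine ⟨⟨100, by norm_num, fun d ν _ θs p q h => ⟨?_, ?_, ?_, ?_, ?_⟩⟩, ?_⟩
  · intro hk ε hε hε2
    obtain ⟨n₀, hn₀⟩ := event_bounds.{u} h hk hε hε2
    refine ⟨n₀, fun n hc hγ S _ P _ Z θhat hE => ?_⟩
    obtain ⟨A, hA, hPA, hint, h1, h2, h3, h4⟩ := hn₀ n hc hγ S P Z θhat hE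
    refine ⟨A, hA, hPA, hint, h1, h2, h3, fun hp hn => ?_⟩
    obtain ⟨h5, h6⟩ := h4 hp hn
    have h7 : 0 ≤ √(kappa ν * (d + Real.log ε⁻¹) / n) + √ε := by positivity
    exact ⟨h5.trans (by gcongr; norm_num), h6.trans (by gcongr; norm_num)⟩
  · intro hk ε M n hε hε1 hM hc S _ P _ Z θhat hE
    exact truncated_lower_bound h hk hε hε1 hM hc hE
  · intro _ M n hM hn S _ P _ Z θhat hE
    have hκ := h.one_le_kappa
    have hκ' := h.one_le_kappa'
    have hd : (1 : ℝ) ≤ d := by exact_mod_cast h.one_le_dim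
    have hC := h.rateConst_pos
    have hn0 : (0 : ℝ) < n := by
      refine lt_of_lt_of_le ?_ hn
      have := Real.log_nonneg hκ
      positivity
    have hn1 : 1 ≤ n := by exact_mod_cast hn0
    have hlog : 0 ≤ Real.log n := Real.log_natCast_nonneg n
    have hm := whitenedMoment_nonneg (ν := ν) (2 * q * (p + 1))
    refine le_trans ?_ (truncated_lower_bound_rate h hM hn1 hE)
    refine sub_le_sub_left (mul_le_mul_of_nonneg_right (by norm_num) ?_) 1
    positivity
  · intro hq1 hq2 M hM
    obtain ⟨B, n₀, -, -, hB⟩ := exists_truncated_rate.{u} h hq1 hq2 hM hM.le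
    refine ⟨B, n₀, fun n hn S _ P _ Z θhat hE => hB n hn S P Z θhat hE M le_rfl ?_⟩
    exact le_mul_of_one_le_right hM.le (Real.one_le_exp (by positivity))
  · intro hq1 hq2
    have hC := h.rateConst_pos
    obtain ⟨B, n₀, hB0, hn1, hB⟩ := exists_truncated_rate.{u} h hq1 hq2 hC hC.le
    refine ⟨1 + B, n₀, fun n hn S _ P _ Z θhat hE => ?_⟩
    have h1 := hB n hn S P Z θhat hE (rateConst ν θs * Real.exp ((n : ℝ) ^ (2 - q)))
      (le_mul_of_one_le_right hC.le (Real.one_le_exp (by positivity))) le_rfl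
    have hr : (n : ℝ) ^ (-(q - 1) / 2) ≤ 1 :=
      Real.rpow_le_one_of_one_le_of_nonpos (by exact_mod_cast hn1.trans hn) (by linarith)
    refine ⟨h1.trans ?_, hE.measureReal_excess_ge_le h (by positivity),
      div_exp_le (hn1.trans hn) hC hB0 hr h1⟩
    gcongr
    linarith
  · intro κ₀ hκ₀
    have hκ₁ : 0 < κ₀ - 1 := by linarith
    -- `b` bounds `κ / (κ - 1)` for all `κ ≥ κ₀`, and `1 / T` is the rate required by `orderBounds`
    set b := κ₀ / (κ₀ - 1) with hb
    have hb1 : 1 ≤ b := by rw [hb, one_le_div hκ₁]; linarith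
    set T := 48 + 2 * b with hT
    have hT2 : 71 * b ≤ T ^ 2 := by nlinarith
    have hT50 : 50 ≤ T := by linarith
    have hTa : T ^ 2 ≤ (3 * T ^ 2) ^ 2 := by nlinarith
    refine ⟨(3 * T ^ 2) ^ 2, by positivity, fun d ν _ θs p q h hκ => ?_⟩
    have hk : 1 < kappa ν := by linarith
    have hd : (1 : ℝ) ≤ d := by exact_mod_cast h.one_le_dim
    have hbk : kappa ν ≤ b * (kappa ν - 1) := by
      rw [hb, div_mul_eq_mul_div, le_div_iff₀ hκ₁]
      linarith
    have hm := whitenedMoment_nonneg (ν := ν) (2 * (p + 1))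
    have hm' := whitenedMoment_nonneg (ν := ν) (2 * q * (p + 1))
    refine ⟨fun ε n hε hε1 hn => ?_, fun hq1 n hn => ?_⟩
    · have hlog : 0 ≤ Real.log ε⁻¹ := Real.log_nonneg ((one_le_inv₀ hε).2 hε1.le)
      have hn0 : (0 : ℝ) < n := lt_of_lt_of_le (by positivity) hn
      have hn1 : 1 ≤ n := by exact_mod_cast hn0
      have hB := orderBounds (b := b) (D := d + Real.log ε⁻¹) h.one_le_dim hn1 hk hb1 hbk hε hε1.le
        (by linarith) (by rw [confTerm]; linarith)
        (sqrt_div_le_of_le (by linarith) hn1 (le_trans (by gcongr) hn))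
      refine ⟨hB.cond, hB.gammaMinus_lt, hB.deltaHat_le.trans ?_,
        (h.gammaPlus_le_of_orderBounds hk hb1 hε hε1.le (by linarith) hB).trans ?_⟩
      · gcongr
        nlinarith
      · rw [add_comm (Real.log ε⁻¹)]
        gcongr
        linarith
    · have hlogκ : 0 ≤ Real.log (kappa ν) := Real.log_nonneg hk.le
      have hn0 : (0 : ℝ) < n := lt_of_lt_of_le (by positivity) hn
      have hn1 : 1 ≤ n := by exact_mod_cast hn0
      have hlog : 0 ≤ Real.log n := Real.log_natCast_nonneg n
      have hε1 := rpow_neg_le_one hq1.le hn1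
      have hB := orderBounds (b := b) (D := Real.log n + d) h.one_le_dim hn1 hk hb1 hbk
        (by positivity) hε1 (by linarith) (confTerm_rpow_neg_le h.q_le_two hn1)
        (sqrt_div_le_of_le (by linarith) hn1 (mul_add_log_le hk.le hd (by linarith) hn1 hn))
      refine ⟨hB.cond, (h.gammaPlus_le_of_orderBounds hk hb1 (by positivity) hε1 (by linarith)
        hB).trans ?_⟩
      rw [rpow_confidence_mul hq1.le hn1, div_one]
      have hj := h.whitenedMoment_le_rpow
      set X := whitenedMoment ν (2 * q * (p + 1)) ^ (1 / q)
      have hX : 0 ≤ X := hm.trans hj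
      calc _ ≤ 71 * b * (((Real.log n + d) / (kappa ν * n)) ^ (p / 2) * (X + X)) := by gcongr
        _ = 2 * (71 * b) * (((Real.log n + d) / (kappa ν * n)) ^ (p / 2) * X) := by ring
        _ ≤ _ := by
          gcongr
          nlinarith
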